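/- Let $N\in\{2,3\}$, let $\Omega\subset\mathbb R^N$ be a bounded domain with smooth boundary, $T>0$, and $\mathbb S(A)=\mu\big(A+A^{t}-\tfrac23\,\mathrm{tr}(A)\,\mathbb I\big)+\eta\,\mathrm{tr}(A)\,\mathbb I$ with $\mu>0$, $\eta\ge 0$. Let the pressure satisfy $$p\in C[0,\infty)\cap C^2(0,\infty),\quad p(0)=0,\quad p'(\varrho)>0\ (\varrho>0),\quad \liminf_{\varrho\to\infty}p'(\varrho)>0,\quad \liminf_{\varrho\to\infty}\frac{P(\varrho)}{p(\varrho)}>0,$$ where $P(\varrho)=\varrho\int_1^\varrho p(z)z^{-2}\,dz$. Consider the barotropic Navier–Stokes system $$\partial_t\varrho+\mathrm{div}(\varrho \mathbf u)=0,\qquad \partial_t(\varrho \mathbf u)+\mathrm{div}(\varrho \mathbf u\otimes \mathbf u)+\nabla p(\varrho)=\mathrm{div}\,\mathbb S(\nabla \mathbf u),\qquad \mathbf u|_{\partial\Omega}=0 .$$ **Dissipative measure-valued solutions.** Let $\nu=\{\nu_{t,x}\}$, $(t,x)\in(0,T)\times\Omega$, and $\nu_0=\{\nu_{0,x}\}$,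 $x\in\Omega$, be weakly measurable families of probability measures on $[0,\infty)\times\mathbb R^N$ (dummy variables $(s,\mathbf v)$), put $\mathbf u=\langle\nu_{t,x};\mathbf v\rangle$, and let $0\le\mathcal D\in L^\infty(0,T)$. We call $\{\nu,\mathcal D\}$ a dissipative measure-valued solution with initial state $\nu_0$ if all the integrals below are well defined (integrands measurable and integrable), $\mathbf u\in L^2(0,T;W^{1,2}_0(\Omega;\mathbb R^N))$, and there are $\chi,\xi\in L^1(0,T)$, families of ($\mathbb R^N$-, resp. $\mathbb R^{N\times N}$-valued) measures $r^C,r^M\in L^1(0,T;\mathcal M(\overline\Omega))$ and a constant $c_P$ such that for a.a. $\tau\in(0,T)$: * for every $\psi\in C^1([0,T]\times\overline\Omega)$, $|\langle r^C(\tau);\nabla\psi\rangle|\le\chi(\tau)\mathcal D(\tau)\|\psi(\tau,\cdot)\|_{C^1(\overline\Omega)}$ and $$\int_\Omega\langle\nu_{\tau,x};s\rangle\psi(\tau,\cdot)\,dx-\int_\Omega\langle\nu_{0,x};s\rangle\psi(0,\cdot)\,dx=\int_0^\tau\!\!\int_\Omega\big[\langle\nu_{t,x};s\rangle\partial_t\psi+\langle\nu_{t,x};s\mathbf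 v\rangle\cdot\nabla\psi\big]dx\,dt+\int_0^\tau\langle r^C;\nabla\psi\rangle dt;$$ * for every $\varphi\in C^1([0,T]\times\overline\Omega;\mathbb R^N)$ with $\varphi|_{\partial\Omega}=0$, $|\langle r^M(\tau);\nabla\varphi\rangle|\le\xi(\tau)\mathcal D(\tau)\|\varphi(\tau,\cdot)\|_{C^1(\overline\Omega)}$ and $$\begin{aligned}&\int_\Omega\langle\nu_{\tau,x};s\mathbf v\rangle\cdot\varphi(\tau,\cdot)\,dx-\int_\Omega\langle\nu_{0,x};s\mathbf v\rangle\cdot\varphi(0,\cdot)\,dx\\&=\int_0^\tau\!\!\int_\Omega\big[\langle\nu_{t,x};s\mathbf v\rangle\cdot\partial_t\varphi+\langle\nu_{t,x};s\,\mathbf v\otimes\mathbf v\rangle:\nabla\varphi+\langle\nu_{t,x};p(s)\rangle\,\mathrm{div}\,\varphi\big]dx\,dt-\int_0^\tau\!\!\int_\Omega\mathbb S(\nabla\mathbf u):\nabla\varphi\,dx\,dt+\int_0^\tau\langle r^M;\nabla\varphi\rangle dt;\end{aligned}$$ * $\displaystyle\int_\Omega\big\langle\nu_{\tau,x};\tfrac12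 s|\mathbf v|^2+P(s)\big\rangle dx+\int_0^\tau\!\!\int_\Omega\mathbb S(\nabla\mathbf u):\nabla\mathbf u\,dx\,dt+\mathcal D(\tau)\le\int_\Omega\big\langle\nu_{0,x};\tfrac12 s|\mathbf v|^2+P(s)\big\rangle dx;$ * $\displaystyle\int_0^\tau\!\!\int_\Omega\langle\nu_{t,x};|\mathbf v-\mathbf u|^2\rangle\,dx\,dt\le c_P\,\mathcal D(\tau).$ **Theorem.** Let $\{\nu,\mathcal D\}$ be a dissipative measure-valued solution with initial state $\nu_0$, and let $[r,\mathbf U]$ be a strong solution of the system on $(0,T)\times\Omega$ in the class $$r,\nabla r,\mathbf U,\nabla\mathbf U\in C([0,T]\times\overline\Omega),\quad \partial_t\mathbf U\in L^2(0,T;C(\overline\Omega;\mathbb R^N)),\quad r>0,\quad \mathbf U|_{\partial\Omega}=0$$ (the continuity equation holds pointwise, and $r(\partial_t\mathbf U+\mathbf U\cdot\nabla\mathbf U)+\nabla p(r)=\mathrm{div}\,\mathbb S(\nabla\mathbf U)$ for a.a. $t$, with the distributional divergence on the right). Then there is a constant $\Lambda$, depending only on the fixed data $N,\Omega,p,\mu,\eta,T,c_P$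 and on bounds for the norms of $r$, $\nabla r$, $r^{-1}$, $\mathbf U$, $\nabla\mathbf U$ in $C([0,T]\times\overline\Omega)$, of $\partial_t\mathbf U$ in $L^2(0,T;C(\overline\Omega))$ and of $\chi,\xi$ in $L^1(0,T)$, such that for a.a. $\tau\in(0,T)$ $$\begin{aligned}&\int_\Omega\Big\langle\nu_{\tau,x};\tfrac12 s|\mathbf v-\mathbf U|^2+P(s)-P'(r)(s-r)-P(r)\Big\rangle dx+\int_0^\tau\!\!\int_\Omega|\nabla\mathbf u-\nabla\mathbf U|^2dx\,dt+\mathcal D(\tau)\\&\le\Lambda\int_\Omega\Big\langle\nu_{0,x};\tfrac12 s|\mathbf v-\mathbf U(0,\cdot)|^2+P(s)-P'(r(0,\cdot))(s-r(0,\cdot))-P(r(0,\cdot))\Big\rangle dx.\end{aligned}$$ In particular, if $\nu_{0,x}=\delta_{[r(0,x),\mathbf U(0,x)]}$ for a.a. $x\in\Omega$, then $\mathcal D=0$ a.e. in $(0,T)$ and $\nu_{\tau,x}=\delta_{[r(\tau,x),\mathbf U(\tau,x)]}$ for a.a. $(\tau,x)\in(0,T)\times\Omega$. -/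

import Mathlib

open MeasureTheory Set Filter Topology
open scoped ContDiff BoundedContinuousFunction

noncomputable section

namespace NSMV

/-- The Euclidean space `R^N`. -/
abbrev Vec (N : ℕ) : Type := EuclideanSpace ℝ (Fin N)

/-- `N × N` matrices as linear maps. A gradient `∇u` is the differential of `u`: its `j`-th column,
the image of the `j`-th unit vector, is `∂_j u`. -/
abbrev Mat (N : ℕ) : Type := Vec N →L[ℝ] Vec N

variable {N : ℕ}

/-- The `i`-th unit vector. -/
def e (i : Fin N) : Vec N := EuclideanSpace.single i 1

/-- The trace; `tr (∇u) = div u`. -/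
def tr (A : Mat N) : ℝ := ∑ i, A (e i) i

/-- The contraction `A : B = ∑_{i,j} A_{ij} B_{ij}`. -/
def contr (A B : Mat N) : ℝ := ∑ j, ∑ i, A (e j) i * B (e j) i

/-- The tensor product `v ⊗ v`. -/
def tensorSq (v : Vec N) : Mat N := InnerProductSpace.rankOne ℝ v v

/-- The Newtonian viscous stress
`S(A) = μ (A + Aᵗ - (2/3) tr(A) I) + η tr(A) I`. -/
def stress (μ η : ℝ) (A : Mat N) : Mat N :=
  μ • (A + ContinuousLinearMap.adjoint A - ((2 / 3 : ℝ) * tr A) • ContinuousLinearMap.id ℝ (Vec N))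
    + (η * tr A) • ContinuousLinearMap.id ℝ (Vec N)

/-- A bounded domain with smooth boundary: near each boundary point the domain is a strict sublevel
set of a smooth function with non-vanishing differential. -/
structure IsSmoothBoundedDomain (Ω : Set (Vec N)) : Prop where
  isOpen : IsOpen Ω
  isConnected : IsConnected Ω
  isBounded : Bornology.IsBounded Ω
  smooth_boundary : ∀ x ∈ frontier Ω, ∃ V ∈ 𝓝 x, ∃ g : Vec N → ℝ,
    ContDiff ℝ ∞ g ∧ fderiv ℝ g x ≠ 0 ∧ ∀ y ∈ V, y ∈ Ω ↔ g y < 0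

/-- The pressure potential `P(ρ) = ρ ∫_1^ρ p(z) / z² dz` (with `P(0) = 0`). -/
def potential (p : ℝ → ℝ) (ρ : ℝ) : ℝ := ρ * ∫ z in (1 : ℝ)..ρ, p z / z ^ 2

/-- The structural hypotheses on the pressure. The two conditions `liminf > 0` (the lower limit may
be `∞`) say that the quantity is eventually bounded below by a positive constant. -/
structure IsPressure (p : ℝ → ℝ) : Prop where
  continuousOn : ContinuousOn p (Ici 0)
  contDiffOn : ContDiffOn ℝ 2 p (Ioi 0)
  map_zero : p 0 = 0
  deriv_pos : ∀ ρ, 0 < ρ → 0 < deriv p ρ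
  liminf_deriv : ∃ c > 0, ∀ᶠ ρ in atTop, c ≤ deriv p ρ
  liminf_ratio : ∃ c > 0, ∀ᶠ ρ in atTop, c ≤ potential p ρ / p ρ

/-- Lebesgue measure on the time interval `(0,T)`. -/
def timeMeasure (T : ℝ) : Measure ℝ := volume.restrict (Ioo 0 T)

/-- Lebesgue measure on the space-time cylinder `(0,T) × Ω`. -/
def cylMeasure (T : ℝ) (Ω : Set (Vec N)) : Measure (ℝ × Vec N) :=
  volume.restrict (Ioo 0 T ×ˢ Ω)

/-- `f ∈ C_c^∞(Ω; R^N)`. -/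
def IsTestField (Ω : Set (Vec N)) (f : Vec N → Vec N) : Prop :=
  ContDiff ℝ ∞ f ∧ HasCompactSupport f ∧ tsupport f ⊆ Ω

/-- `f ∈ W^{1,2}_0(Ω; R^N)` with gradient `g`: the pair `(f, g)` is a limit in `L²(Ω)` of
`(φₙ, ∇φₙ)` with `φₙ ∈ C_c^∞(Ω; R^N)`. -/
def MemW012 (Ω : Set (Vec N)) (f : Vec N → Vec N) (g : Vec N → Mat N) : Prop :=
  MemLp f 2 (volume.restrict Ω) ∧ MemLp g 2 (volume.restrict Ω) ∧
  ∃ φ : ℕ → Vec N → Vec N, (∀ n, IsTestField Ω (φ n)) ∧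
    Tendsto (fun n => eLpNorm (fun x => φ n x - f x) 2 (volume.restrict Ω)) atTop (𝓝 0) ∧
    Tendsto (fun n => eLpNorm (fun x => fderiv ℝ (φ n) x - g x) 2 (volume.restrict Ω)) atTop (𝓝 0)

/-- `u ∈ L²(0,T; W^{1,2}_0(Ω; R^N))` with spatial gradient `G`. -/
def MemL2W012 (T : ℝ) (Ω : Set (Vec N)) (u : ℝ × Vec N → Vec N) (G : ℝ × Vec N → Mat N) : Prop :=
  MemLp u 2 (cylMeasure T Ω) ∧ MemLp G 2 (cylMeasure T Ω) ∧
  ∀ᵐ t ∂timeMeasure T, MemW012 Ω (fun x => u (t, x)) (fun x => G (t, x))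

/-- `ψ ∈ C^1([0,T] × closure Ω; F)`, where `ψt`, `ψx` are the continuous extensions to
`[0,T] × closure Ω` of the time derivative and of the spatial differential. -/
structure IsC1 {F : Type*} [NormedAddCommGroup F] [NormedSpace ℝ F] (T : ℝ) (Ω : Set (Vec N))
    (ψ ψt : ℝ → Vec N → F) (ψx : ℝ → Vec N → (Vec N →L[ℝ] F)) : Prop where
  cont : ContinuousOn (fun q : ℝ × Vec N => ψ q.1 q.2) (Icc 0 T ×ˢ closure Ω)
  cont_t : ContinuousOn (fun q : ℝ × Vec N => ψt q.1 q.2) (Icc 0 T ×ˢ closure Ω)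
  cont_x : ContinuousOn (fun q : ℝ × Vec N => ψx q.1 q.2) (Icc 0 T ×ˢ closure Ω)
  deriv_t : ∀ t ∈ Ioo 0 T, ∀ x ∈ Ω, HasDerivAt (fun s => ψ s x) (ψt t x) t
  deriv_x : ∀ t ∈ Icc 0 T, ∀ x ∈ Ω, HasFDerivAt (ψ t) (ψx t x) x

/-- The norm in `C^1(closure Ω)` of a function `f` with differential `df`. -/
def c1Norm {F : Type*} [NormedAddCommGroup F] [NormedSpace ℝ F] (Ω : Set (Vec N))
    (f : Vec N → F) (df : Vec N → (Vec N →L[ℝ] F)) : ℝ :=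
  sSup ((fun x => ‖f x‖) '' closure Ω) + sSup ((fun x => ‖df x‖) '' closure Ω)

/-- `m ∈ L^1(0,T; M(closure Ω))`: a weakly measurable family of signed measures on `closure Ω` whose
total variation is integrable in time. -/
structure MemL1Meas (T : ℝ) (Ω : Set (Vec N)) (m : ℝ → SignedMeasure (Vec N)) : Prop where
  supported : ∀ᵐ t ∂timeMeasure T, (m t).variation (closure Ω)ᶜ = 0
  weak_meas : ∀ f : Vec N → ℝ, Continuous f →
    AEStronglyMeasurable (fun t => ∫ᵛ x in closure Ω, f x ∂•(m t)) (timeMeasure T)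
  integrable : ∫⁻ t, (m t).variation univ ∂timeMeasure T < ⊤

/-- `⟨m; ∇ψ⟩` for a vector-valued measure `m` with components `m i`. -/
def pairVec (m : Fin N → SignedMeasure (Vec N)) (dψ : Vec N → (Vec N →L[ℝ] ℝ)) : ℝ :=
  ∑ i, ∫ᵛ x, dψ x (e i) ∂•(m i)

/-- `⟨m; ∇φ⟩` for a matrix-valued measure `m` with components `m i j`; `(∇φ)_{ij} = ∂_j φ_i`. -/
def pairMat (m : Fin N → Fin N → SignedMeasure (Vec N)) (dφ : Vec N → Mat N) : ℝ :=
  ∑ i, ∑ j, ∫ᵛ x, dφ x (e j) i ∂•(m i j)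

/-- A measurable family of probability measures on `[0,∞) × R^N`, parameterized by `m`-almost every
point of `X`. -/
structure IsYoungMeasure {X : Type*} [MeasurableSpace X] (m : Measure X)
    (ν : X → Measure (ℝ × Vec N)) : Prop where
  aemeasurable : AEMeasurable ν m
  prob : ∀ᵐ q ∂m, IsProbabilityMeasure (ν q)
  density_nonneg : ∀ᵐ q ∂m, ν q {z | z.1 < 0} = 0

/-- The function `q ↦ ⟨ν_q; F q⟩` is well defined for a.e. `q` and integrable. -/
def BracketIntegrable {X F : Type*} [MeasurableSpace X] [NormedAddCommGroup F] [NormedSpace ℝ F]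
    (m : Measure X) (ν : X → Measure (ℝ × Vec N)) (f : X → ℝ × Vec N → F) : Prop :=
  (∀ᵐ q ∂m, Integrable (f q) (ν q)) ∧ Integrable (fun q => ∫ z, f q z ∂ν q) m

/-- The mean velocity `u = ⟨ν_{t,x}; v⟩`. -/
def meanVelocity (ν : ℝ × Vec N → Measure (ℝ × Vec N)) (q : ℝ × Vec N) : Vec N :=
  ∫ z, z.2 ∂ν q

/-- The energy density `½ s |v|² + P(s)` at `z = (s, v)`. -/
def energy (p : ℝ → ℝ) (z : ℝ × Vec N) : ℝ := 1 / 2 * z.1 * ‖z.2‖ ^ 2 + potential p z.1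

/-- The relative energy density `½ s |v - U|² + P(s) - P'(r) (s - r) - P(r)` at `z = (s, v)`. -/
def relEnergy (p : ℝ → ℝ) (r : ℝ) (U : Vec N) (z : ℝ × Vec N) : ℝ :=
  1 / 2 * z.1 * ‖z.2 - U‖ ^ 2 + potential p z.1 - deriv (potential p) r * (z.1 - r) - potential p r

/-- `ν` (with initial state `ν₀`) is a dissipative measure-valued solution of the barotropic
Navier–Stokes system with no-slip boundary condition, with dissipation defect `D`, where `gradu` is
the gradient of the mean velocity, `χ` and `ξ` are the functions that bound the concentration
measures of the continuity and momentum equation, and `cP` is the constant in the Poincaré-type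
inequality. -/
structure IsDissipativeMVSolution (T : ℝ) (Ω : Set (Vec N)) (p : ℝ → ℝ) (μ η cP : ℝ)
    (ν : ℝ × Vec N → Measure (ℝ × Vec N)) (ν₀ : Vec N → Measure (ℝ × Vec N)) (D : ℝ → ℝ)
    (gradu : ℝ × Vec N → Mat N) (χ ξ : ℝ → ℝ) : Prop where
  young : IsYoungMeasure (cylMeasure T Ω) ν
  young_init : IsYoungMeasure (volume.restrict Ω) ν₀
  defect_memLp : MemLp D ⊤ (timeMeasure T)
  defect_nonneg : ∀ᵐ τ ∂timeMeasure T, 0 ≤ D τ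
  chi_integrable : Integrable χ (timeMeasure T)
  xi_integrable : Integrable ξ (timeMeasure T)
  -- all integrals below are well defined
  int_density : BracketIntegrable (cylMeasure T Ω) ν (fun _ z => z.1)
  int_velocity : BracketIntegrable (cylMeasure T Ω) ν (fun _ z => z.2)
  int_momentum : BracketIntegrable (cylMeasure T Ω) ν (fun _ z => z.1 • z.2)
  int_convective : BracketIntegrable (cylMeasure T Ω) ν (fun _ z => z.1 • tensorSq z.2)
  int_pressure : BracketIntegrable (cylMeasure T Ω) ν (fun _ z => p z.1)
  int_energy : BracketIntegrable (cylMeasure T Ω) ν (fun _ z => energy p z)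
  int_fluctuation : BracketIntegrable (cylMeasure T Ω) ν
    (fun q z => ‖z.2 - meanVelocity ν q‖ ^ 2)
  int_init_density : BracketIntegrable (volume.restrict Ω) ν₀ (fun _ z => z.1)
  int_init_momentum : BracketIntegrable (volume.restrict Ω) ν₀ (fun _ z => z.1 • z.2)
  int_init_energy : BracketIntegrable (volume.restrict Ω) ν₀ (fun _ z => energy p z)
  -- equation of continuity
  continuity : ∃ rC : ℝ → Fin N → SignedMeasure (Vec N),
    (∀ i, MemL1Meas T Ω (fun t => rC t i)) ∧
    ∀ᵐ τ ∂timeMeasure T, ∀ (ψ ψt : ℝ → Vec N → ℝ) (ψx : ℝ → Vec N → (Vec N →L[ℝ] ℝ)),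
      IsC1 T Ω ψ ψt ψx →
      |pairVec (rC τ) (ψx τ)| ≤ χ τ * D τ * c1Norm Ω (ψ τ) (ψx τ) ∧
      (∫ x in Ω, (∫ z, z.1 ∂ν (τ, x)) * ψ τ x) - (∫ x in Ω, (∫ z, z.1 ∂ν₀ x) * ψ 0 x)
        = (∫ t in (0 : ℝ)..τ, ∫ x in Ω,
            ((∫ z, z.1 ∂ν (t, x)) * ψt t x + ψx t x (∫ z, z.1 • z.2 ∂ν (t, x))))
          + ∫ t in (0 : ℝ)..τ, pairVec (rC t) (ψx t)
  -- momentum equation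
  velocity_mem : MemL2W012 T Ω (meanVelocity ν) gradu
  momentum : ∃ rM : ℝ → Fin N → Fin N → SignedMeasure (Vec N),
    (∀ i j, MemL1Meas T Ω (fun t => rM t i j)) ∧
    ∀ᵐ τ ∂timeMeasure T, ∀ (φ φt : ℝ → Vec N → Vec N) (φx : ℝ → Vec N → Mat N),
      IsC1 T Ω φ φt φx → (∀ t ∈ Icc 0 T, ∀ x ∈ frontier Ω, φ t x = 0) →
      |pairMat (rM τ) (φx τ)| ≤ ξ τ * D τ * c1Norm Ω (φ τ) (φx τ) ∧
      (∫ x in Ω, inner ℝ (∫ z, z.1 • z.2 ∂ν (τ, x)) (φ τ x))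
          - (∫ x in Ω, inner ℝ (∫ z, z.1 • z.2 ∂ν₀ x) (φ 0 x))
        = (∫ t in (0 : ℝ)..τ, ∫ x in Ω,
            (inner ℝ (∫ z, z.1 • z.2 ∂ν (t, x)) (φt t x)
              + contr (∫ z, z.1 • tensorSq z.2 ∂ν (t, x)) (φx t x)
              + (∫ z, p z.1 ∂ν (t, x)) * tr (φx t x)))
          - (∫ t in (0 : ℝ)..τ, ∫ x in Ω, contr (stress μ η (gradu (t, x))) (φx t x))
          + ∫ t in (0 : ℝ)..τ, pairMat (rM t) (φx t)
  -- energy inequality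
  energy_ineq : ∀ᵐ τ ∂timeMeasure T,
    (∫ x in Ω, ∫ z, energy p z ∂ν (τ, x))
        + (∫ t in (0 : ℝ)..τ, ∫ x in Ω, contr (stress μ η (gradu (t, x))) (gradu (t, x))) + D τ
      ≤ ∫ x in Ω, ∫ z, energy p z ∂ν₀ x
  -- Poincaré-type inequality
  poincare : ∀ᵐ τ ∂timeMeasure T,
    (∫ t in (0 : ℝ)..τ, ∫ x in Ω, ∫ z, ‖z.2 - meanVelocity ν (t, x)‖ ^ 2 ∂ν (t, x)) ≤ cP * D τ

/-- `b` is the distributional divergence in `Ω` of the matrix field `A`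
(`(div A)_i = ∑_j ∂_j A_{ij}`). -/
def IsWeakDiv (Ω : Set (Vec N)) (A : Vec N → Mat N) (b : Vec N → Vec N) : Prop :=
  ∀ φ : Vec N → Vec N, IsTestField Ω φ →
    ∫ x in Ω, contr (A x) (fderiv ℝ φ x) = -∫ x in Ω, inner ℝ (b x) (φ x)

/-- `[r, U]` is a strong solution in the class `r, ∇r, U, ∇U ∈ C([0,T] × closure Ω)`,
`∂_t U ∈ L²(0,T; C(closure Ω; R^N))`, `r > 0`, `U = 0` on `∂Ω`. Here `gradr`, `gradU` are the
(continuous extensions to `closure Ω` of the) spatial gradients and `dtU` is the time derivative of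
`U`. As the class contains no second derivatives, `div S(∇U)` is the distributional divergence, which
by the equation is a continuous function for a.e. `t`. -/
structure IsStrongSolution (T : ℝ) (Ω : Set (Vec N)) (p : ℝ → ℝ) (μ η : ℝ)
    (r : ℝ → Vec N → ℝ) (gradr : ℝ → Vec N → (Vec N →L[ℝ] ℝ))
    (U : ℝ → Vec N → Vec N) (gradU : ℝ → Vec N → Mat N)
    (dtU : ℝ → (closure Ω →ᵇ Vec N)) : Prop where
  cont_r : ContinuousOn (fun q : ℝ × Vec N => r q.1 q.2) (Icc 0 T ×ˢ closure Ω)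
  cont_gradr : ContinuousOn (fun q : ℝ × Vec N => gradr q.1 q.2) (Icc 0 T ×ˢ closure Ω)
  cont_U : ContinuousOn (fun q : ℝ × Vec N => U q.1 q.2) (Icc 0 T ×ˢ closure Ω)
  cont_gradU : ContinuousOn (fun q : ℝ × Vec N => gradU q.1 q.2) (Icc 0 T ×ˢ closure Ω)
  hasGrad_r : ∀ t ∈ Icc 0 T, ∀ x ∈ Ω, HasFDerivAt (r t) (gradr t x) x
  hasGrad_U : ∀ t ∈ Icc 0 T, ∀ x ∈ Ω, HasFDerivAt (U t) (gradU t x) x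
  dtU_memLp : MemLp dtU 2 (timeMeasure T)
  U_eq : ∀ t ∈ Icc 0 T, ∀ x : closure Ω, U t x = U 0 x + ∫ s in (0 : ℝ)..t, dtU s x
  r_pos : ∀ t ∈ Icc 0 T, ∀ x ∈ closure Ω, 0 < r t x
  no_slip : ∀ t ∈ Icc 0 T, ∀ x ∈ frontier Ω, U t x = 0
  -- `∂_t r + div (r U) = 0`
  continuity : ∀ t ∈ Ioo 0 T, ∀ x ∈ Ω,
    HasDerivAt (fun s => r s x) (-(gradr t x (U t x) + r t x * tr (gradU t x))) t
  -- `r (∂_t U + U · ∇U) + ∇p(r) = div S(∇U)`, where `∇p(r) = p'(r) ∇r`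
  momentum : ∃ divS : ℝ → Vec N → Vec N, ∀ᵐ t ∂timeMeasure T,
    IsWeakDiv Ω (fun x => stress μ η (gradU t x)) (divS t) ∧
    ∀ (x : Vec N) (hx : x ∈ Ω),
      r t x • (dtU t ⟨x, subset_closure hx⟩ + gradU t x (U t x))
        + deriv p (r t x) • (InnerProductSpace.toDual ℝ (Vec N)).symm (gradr t x) = divS t x

/-- The norms of `r`, `∇r`, `r⁻¹`, `U`, `∇U` in `C([0,T] × closure Ω)`, of `∂_t U` in
`L²(0,T; C(closure Ω))` and of `χ`, `ξ` in `L^1(0,T)` are at most `M`. -/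
structure NormsBoundedBy (M T : ℝ) (Ω : Set (Vec N))
    (r : ℝ → Vec N → ℝ) (gradr : ℝ → Vec N → (Vec N →L[ℝ] ℝ))
    (U : ℝ → Vec N → Vec N) (gradU : ℝ → Vec N → Mat N)
    (dtU : ℝ → (closure Ω →ᵇ Vec N)) (χ ξ : ℝ → ℝ) : Prop where
  bound_r : ∀ t ∈ Icc 0 T, ∀ x ∈ closure Ω, |r t x| ≤ M
  bound_gradr : ∀ t ∈ Icc 0 T, ∀ x ∈ closure Ω, ‖gradr t x‖ ≤ M
  bound_inv_r : ∀ t ∈ Icc 0 T, ∀ x ∈ closure Ω, |(r t x)⁻¹| ≤ M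
  bound_U : ∀ t ∈ Icc 0 T, ∀ x ∈ closure Ω, ‖U t x‖ ≤ M
  bound_gradU : ∀ t ∈ Icc 0 T, ∀ x ∈ closure Ω, ‖gradU t x‖ ≤ M
  bound_dtU : eLpNorm dtU 2 (timeMeasure T) ≤ ENNReal.ofReal M
  bound_chi : eLpNorm χ 1 (timeMeasure T) ≤ ENNReal.ofReal M
  bound_xi : eLpNorm ξ 1 (timeMeasure T) ≤ ENNReal.ofReal M

end NSMV

end

open MeasureTheory Set Filter Topology
open scoped ContDiff BoundedContinuousFunction

noncomputable section

namespace NSMV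

variable {N : ℕ}

/-! The distance between the measure-valued solution and `[r, U]` is measured by the relative energy
E(τ), the integral over `Ω` of ⟨ν; ½ s|v - U|² + P(s) - P'(r)(s - r) - P(r)⟩. Its density is
nonnegative because P''(s) = p'(s)/s > 0, and it vanishes only at (r, U). Since r P'(r) - P(r) =
p(r), E equals the energy, minus the momentum paired with U, plus the density paired with ½|U|² -
P'(r), plus the integral of p(r) (`integral_relEnergy`). Its growth is therefore governed by the
energy inequality, the momentum equation tested with U, the equation of continuity tested with ½|U|²
- P'(r), and the fundamental theorem of calculus for p(r). The concentration measures contribute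
only a multiple of ∫ (|χ| + |ξ|) D. This is `ae_relEnergy_test`. As ∂_t U is only in L²(0,T; C), U
itself is not an admissible test field; its Steklov averages in time are
(`IsStrongSolution.exists_test_approx`), and `ae_relEnergy_strong` passes to the limit.

The algebraic core is `testIntegrand_eq_remainder`. The momentum equation of the strong solution is
tested with u - U, which lies in W^{1,2}_0, and div (p(r)U) has zero mean; together they remove
every first-order term. What is left is the negative viscous form of ∇u - ∇U and the mean of
`remainder`, with the terms (s - r)(U - v)·(∂_t U + U·∇U + p'(r)/r ∇r), s(U - v)·∇U(v - U) and -div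
U (p(s) - p'(r)(s - r) - p(r)).

By `IsPressure.coercive` and Young's inequality the remainder is at most C_δ (1 + |∂_t U|²) times
the relative energy density plus δ|v - U|² (`IsPressure.exists_remainder_le`). The δ-term cannot be
avoided: where s is small, the kinetic part of the relative energy does not control v. It is split
along v - U = (v - u) + (u - U). The first part is absorbed by D through the Poincaré-type
inequality in the definition of the solution, the second by the viscous form through the Poincaré
and Korn inequalities in W^{1,2}_0.

Grönwall's inequality with the weight C(1 + ‖∂_t U‖²) + const·(|χ| + |ξ|), which is only integrable
in time, gives the stability estimate. If E vanishes initially, then D = 0 and the relative energy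
vanishes a.e., so the Young measure is concentrated at (r, U). -/

/-! ### Linear algebra of matrices and of the viscous stress -/

theorem contr_eq_sum_inner (A B : Mat N) : contr A B = ∑ j, inner ℝ (A (e j)) (B (e j)) := by
  simp only [contr, PiLp.inner_apply, RCLike.inner_apply, conj_trivial]
  exact Finset.sum_congr rfl fun j _ => Finset.sum_congr rfl fun i _ => mul_comm _ _

theorem contr_comm (A B : Mat N) : contr A B = contr B A := by
  simp only [contr, mul_comm]

theorem contr_add_left (A B C : Mat N) : contr (A + B) C = contr A C + contr B C := by
  simp [contr_eq_sum_inner, inner_add_left, Finset.sum_add_distrib]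

theorem contr_smul_left (a : ℝ) (A C : Mat N) : contr (a • A) C = a * contr A C := by
  simp [contr_eq_sum_inner, real_inner_smul_left, Finset.mul_sum]

theorem contr_sub_left (A B C : Mat N) : contr (A - B) C = contr A C - contr B C := by
  simp [contr_eq_sum_inner, inner_sub_left, Finset.sum_sub_distrib]

theorem contr_sub_right (A B C : Mat N) : contr C (A - B) = contr C A - contr C B := by
  rw [contr_comm, contr_sub_left, contr_comm A, contr_comm B]

theorem norm_e (i : Fin N) : ‖(e i : Vec N)‖ = 1 := by simp [e]

theorem norm_apply_e_le (A : Mat N) (i : Fin N) : ‖A (e i)‖ ≤ ‖A‖ := by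
  simpa [norm_e] using A.le_opNorm (e i)

theorem abs_contr_le (A B : Mat N) : |contr A B| ≤ N * (‖A‖ * ‖B‖) := by
  rw [contr_eq_sum_inner]
  refine (Finset.abs_sum_le_sum_abs _ _).trans ?_
  refine (Finset.sum_le_sum (g := fun _ => ‖A‖ * ‖B‖) fun j _ => ?_).trans (by simp)
  exact (abs_real_inner_le_norm _ _).trans
    (mul_le_mul (norm_apply_e_le A j) (norm_apply_e_le B j) (norm_nonneg _) (norm_nonneg _))

theorem contr_self (A : Mat N) : contr A A = ∑ j, ‖A (e j)‖ ^ 2 := by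
  simp [contr_eq_sum_inner]

theorem contr_self_nonneg (A : Mat N) : 0 ≤ contr A A := by
  rw [contr_self]; positivity

theorem norm_apply_e_sq_le (A : Mat N) (i : Fin N) : ‖A (e i)‖ ^ 2 ≤ contr A A := by
  rw [contr_self]
  exact Finset.single_le_sum (f := fun j => ‖A (e j)‖ ^ 2) (fun j _ => sq_nonneg _)
    (Finset.mem_univ i)

theorem abs_tr_le (A : Mat N) : |tr A| ≤ N * ‖A‖ := by
  refine (Finset.abs_sum_le_sum_abs _ _).trans ?_
  refine (Finset.sum_le_sum (g := fun _ => ‖A‖) fun j _ => ?_).trans (by simp)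
  exact (PiLp.norm_apply_le (A (e j)) j).trans (norm_apply_e_le A j)

theorem contr_id_left (B : Mat N) : contr (ContinuousLinearMap.id ℝ (Vec N)) B = tr B := by
  simp only [contr_eq_sum_inner, tr, ContinuousLinearMap.id_apply]
  exact Finset.sum_congr rfl fun j _ => by simp [e, EuclideanSpace.inner_single_left]

/-- For A = B = ∇φ the products are ∂_i φ_j ∂_j φ_i, which Korn's inequality compares with the
products ∂_i φ_i ∂_j φ_j in (div φ)². -/
theorem contr_adjoint_left (A B : Mat N) :
    contr (ContinuousLinearMap.adjoint A) B = ∑ j, ∑ i, A (e i) j * B (e j) i := by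
  refine Finset.sum_congr rfl fun j _ => Finset.sum_congr rfl fun i _ => ?_
  congr 1
  have h := ContinuousLinearMap.adjoint_inner_right A (e i) (e j)
  simpa [e, EuclideanSpace.inner_single_left, EuclideanSpace.inner_single_right] using h

theorem contr_stress_left (μ η : ℝ) (A B : Mat N) :
    contr (stress μ η A) B = μ * (contr A B + contr (ContinuousLinearMap.adjoint A) B)
      + (η - 2 / 3 * μ) * (tr A * tr B) := by
  simp only [stress, contr_add_left, contr_smul_left, contr_sub_left, contr_id_left]
  ring

/-- The contraction with a fixed matrix as a continuous linear form. -/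
def contrCLM (B : Mat N) : Mat N →L[ℝ] ℝ :=
  LinearMap.toContinuousLinearMap
    { toFun := fun A => contr A B
      map_add' := fun A A' => contr_add_left A A' B
      map_smul' := fun a A => contr_smul_left a A B }

@[simp] theorem contrCLM_apply (A B : Mat N) : contrCLM B A = contr A B := rfl

/-- The trace as a continuous linear form. -/
def trCLM : Mat N →L[ℝ] ℝ := contrCLM (ContinuousLinearMap.id ℝ (Vec N))

@[simp] theorem trCLM_apply (A : Mat N) : trCLM A = tr A := by
  rw [trCLM, contrCLM_apply, contr_comm, contr_id_left]

theorem tr_smul (a : ℝ) (A : Mat N) : tr (a • A) = a * tr A := by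
  simp only [← trCLM_apply, map_smul, smul_eq_mul]

theorem continuous_tr : Continuous (tr : Mat N → ℝ) := by
  have h : ⇑(trCLM (N := N)) = tr := funext trCLM_apply
  exact h ▸ (trCLM (N := N)).continuous

theorem continuous_contr : Continuous fun q : Mat N × Mat N => contr q.1 q.2 := by
  simp only [contr_eq_sum_inner]; fun_prop

/-- The viscous stress as a continuous linear map. -/
def stressCLM (μ η : ℝ) : Mat N →L[ℝ] Mat N :=
  LinearMap.toContinuousLinearMap
    { toFun := stress μ η
      map_add' := fun A B => by
        simp only [stress, ← trCLM_apply, map_add]; module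
      map_smul' := fun a A => by
        simp only [stress, ← trCLM_apply, map_smul, smul_eq_mul, RingHom.id_apply]; module }

@[simp] theorem stressCLM_apply (μ η : ℝ) (A : Mat N) : stressCLM μ η A = stress μ η A := rfl

theorem contr_tensorSq (v : Vec N) (A : Mat N) : contr (tensorSq v) A = inner ℝ v (A v) := by
  have hv : v = ∑ j, v j • (e j : Vec N) := by
    ext i; simp [e, Pi.single_apply]
  conv_rhs => rw [hv]
  rw [contr_eq_sum_inner, map_sum, inner_sum]
  refine Finset.sum_congr rfl fun j _ => ?_
  rw [← hv, map_smul, real_inner_smul_right, tensorSq, InnerProductSpace.rankOne_apply,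
    real_inner_smul_left]
  congr 1
  simp [e, EuclideanSpace.inner_single_right]

theorem tr_rankOne_comp (l : Vec N →L[ℝ] ℝ) (u : Vec N) : tr (l.smulRight u) = l u := by
  have hu : u = ∑ j, u j • (e j : Vec N) := by
    ext i; simp [e, Pi.single_apply]
  conv_rhs => rw [hu]
  simp [tr, mul_comm]

/-! ### Integral identities and Poincaré's inequality for test fields -/

theorem IsTestField.contDiff_one {Ω : Set (Vec N)} {φ : Vec N → Vec N} (h : IsTestField Ω φ) :
    ContDiff ℝ 1 φ := h.1.of_le (by exact_mod_cast le_top)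

theorem IsTestField.continuous_fderiv {Ω : Set (Vec N)} {φ : Vec N → Vec N}
    (h : IsTestField Ω φ) : Continuous (fderiv ℝ φ) := h.contDiff_one.continuous_fderiv one_ne_zero

theorem IsTestField.eq_zero {Ω : Set (Vec N)} {φ : Vec N → Vec N} (h : IsTestField Ω φ)
    {x : Vec N} (hx : x ∉ Ω) : φ x = 0 :=
  image_eq_zero_of_notMem_tsupport fun h' => hx (h.2.2 h')

theorem IsTestField.fderiv_eq_zero {Ω : Set (Vec N)} {φ : Vec N → Vec N} (h : IsTestField Ω φ)
    {x : Vec N} (hx : x ∉ Ω) : fderiv ℝ φ x = 0 :=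
  image_eq_zero_of_notMem_tsupport fun h' => hx (h.2.2 (tsupport_fderiv_subset ℝ h'))

theorem IsTestField.memLp {Ω : Set (Vec N)} {φ : Vec N → Vec N} (h : IsTestField Ω φ) :
    MemLp φ 2 (volume.restrict Ω) :=
  (h.1.continuous.memLp_of_hasCompactSupport h.2.1).restrict Ω

theorem IsTestField.memLp_fderiv {Ω : Set (Vec N)} {φ : Vec N → Vec N} (h : IsTestField Ω φ) :
    MemLp (fderiv ℝ φ) 2 (volume.restrict Ω) :=
  (h.continuous_fderiv.memLp_of_hasCompactSupport (h.2.1.fderiv ℝ)).restrict Ω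

/-- For smooth compactly supported functions `∫ ∂_v f ∂_w g = ∫ ∂_w f ∂_v g`. -/
theorem integral_fderiv_mul_fderiv_comm {f g : Vec N → ℝ} (hf : ContDiff ℝ ∞ f)
    (hg : ContDiff ℝ ∞ g) (hgs : HasCompactSupport g) (v w : Vec N) :
    ∫ x, fderiv ℝ f x v * fderiv ℝ g x w = ∫ x, fderiv ℝ f x w * fderiv ℝ g x v := by
  -- One integration by parts moves the derivative off g and leaves a second derivative of f; its
  -- symmetry then identifies the two sides.
  have key : ∀ v w : Vec N, ∫ x, fderiv ℝ f x v * fderiv ℝ g x w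
      = -∫ x, fderiv ℝ (fderiv ℝ f) x w v * g x := by
    intro v w
    have hd : ContDiff ℝ ∞ (fderiv ℝ f) := hf.fderiv_right (by simp)
    have hfv : ContDiff ℝ ∞ (fun x => fderiv ℝ f x v) := hd.clm_apply contDiff_const
    have hgd : Continuous (fderiv ℝ g) := hg.continuous_fderiv (by simp)
    have hder : ∀ x, fderiv ℝ (fun x => fderiv ℝ f x v) x w = fderiv ℝ (fderiv ℝ f) x w v := by
      intro x
      rw [fderiv_clm_apply (hd.differentiable (by simp) x) (differentiableAt_const v)]
      simp
    have hdd : Continuous (fderiv ℝ (fderiv ℝ f)) := hd.continuous_fderiv (by simp)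
    have h := integral_mul_fderiv_eq_neg_fderiv_mul_of_integrable (μ := volume)
      (f := fun x => fderiv ℝ f x v) (g := g) (v := w) ?_ ?_ ?_
      (fun x _ => hfv.differentiable (by simp) x) (fun x _ => hg.differentiable (by simp) x)
    · simpa only [hder] using h
    · simp only [hder]
      refine Continuous.integrable_of_hasCompactSupport ?_ hgs.mul_left
      have := hg.continuous
      fun_prop
    · refine Continuous.integrable_of_hasCompactSupport ?_
        (HasCompactSupport.mul_left (f' := fun x => fderiv ℝ g x w) ?_)
      · have := hfv.continuous
        fun_prop
      · exact hgs.fderiv_apply ℝ w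
    · refine Continuous.integrable_of_hasCompactSupport ?_ hgs.mul_left
      have := hg.continuous
      have := hfv.continuous
      fun_prop
  rw [key v w, key w v]
  congr 2
  ext x
  have hs : IsSymmSndFDerivAt ℝ f x := (hf.contDiffAt (x := x)).isSymmSndFDerivAt
    (by simpa using WithTop.coe_le_coe.2 (le_top : (2 : ℕ∞) ≤ ⊤))
  rw [hs.eq w v]

theorem integral_sum_sum (a : Fin N → Fin N → Vec N → ℝ) (h : ∀ j i, Integrable (a j i)) :
    ∫ x, ∑ j, ∑ i, a j i x = ∑ j, ∑ i, ∫ x, a j i x := by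
  rw [integral_finsetSum _ fun j _ => integrable_finsetSum _ fun i _ => h j i]
  exact Finset.sum_congr rfl fun j _ => integral_finsetSum _ fun i _ => h j i

theorem IsTestField.comp {Ω : Set (Vec N)} {φ : Vec N → Vec N} (h : IsTestField Ω φ) (i : Fin N) :
    ContDiff ℝ ∞ (fun x => φ x i) ∧ HasCompactSupport (fun x => φ x i) ∧
      ∀ x v, fderiv ℝ (fun x => φ x i) x v = fderiv ℝ φ x v i := by
  have hl : (fun x => φ x i) = (EuclideanSpace.proj i : Vec N →L[ℝ] ℝ) ∘ φ := rfl
  refine ⟨?_, ?_, fun x v => ?_⟩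
  · rw [hl]; exact (EuclideanSpace.proj i : Vec N →L[ℝ] ℝ).contDiff.comp h.1
  · exact h.2.1.comp_left (g := fun v : Vec N => v i) rfl
  · rw [hl, ((EuclideanSpace.proj i : Vec N →L[ℝ] ℝ).hasFDerivAt.comp x
      (h.1.differentiable (by simp) x).hasFDerivAt).fderiv]; rfl

/-- Integrating by parts twice exchanges the two derivatives in ∂_i φ_j ∂_j φ_i. The transposed part
of the viscous stress therefore acts as (div φ)² and is nonnegative in the mean. -/
theorem IsTestField.integral_contr_adjoint {Ω : Set (Vec N)} {φ : Vec N → Vec N}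
    (h : IsTestField Ω φ) :
    ∫ x in Ω, contr (ContinuousLinearMap.adjoint (fderiv ℝ φ x)) (fderiv ℝ φ x)
      = ∫ x in Ω, tr (fderiv ℝ φ x) * tr (fderiv ℝ φ x) := by
  rw [setIntegral_eq_integral_of_forall_compl_eq_zero, setIntegral_eq_integral_of_forall_compl_eq_zero]
  rotate_left
  · intro x hx; simp [h.fderiv_eq_zero hx, tr]
  · intro x hx; simp [h.fderiv_eq_zero hx, contr]
  have hint : ∀ (v w : Vec N) (i j : Fin N),
      Integrable (fun x => fderiv ℝ φ x v i * fderiv ℝ φ x w j) := by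
    intro v w i j
    have := h.continuous_fderiv
    refine Continuous.integrable_of_hasCompactSupport (by fun_prop) ?_
    refine HasCompactSupport.intro (h.2.1.fderiv ℝ) fun x hx => ?_
    simp [image_eq_zero_of_notMem_tsupport hx]
  simp only [contr_adjoint_left, tr, Finset.sum_mul_sum]
  refine (integral_sum_sum _ fun j i => hint _ _ _ _).trans
    (Eq.trans ?_ (integral_sum_sum _ fun j i => hint _ _ _ _).symm)
  refine Finset.sum_congr rfl fun j _ => Finset.sum_congr rfl fun i _ => ?_
  obtain ⟨h1, -, h3⟩ := h.comp j
  obtain ⟨g1, g2, g3⟩ := h.comp i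
  simpa only [h3, g3] using integral_fderiv_mul_fderiv_comm h1 g1 g2 (e i) (e j)

theorem IsTestField.integrable_of_continuous {Ω : Set (Vec N)} {φ : Vec N → Vec N}
    (h : IsTestField Ω φ) {F : Mat N → ℝ} (hF : Continuous F) (h0 : F 0 = 0) :
    Integrable (fun x => F (fderiv ℝ φ x)) :=
  (hF.comp h.continuous_fderiv).integrable_of_hasCompactSupport
    ((h.2.1.fderiv ℝ).comp_left (g := F) h0)

theorem IsTestField.integral_tr {Ω : Set (Vec N)} {φ : Vec N → Vec N} (h : IsTestField Ω φ) :
    ∫ x in Ω, tr (fderiv ℝ φ x) = 0 := by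
  rw [setIntegral_eq_integral_of_forall_compl_eq_zero
    fun x hx => by simp [h.fderiv_eq_zero hx, tr]]
  unfold tr
  have hint (i : Fin N) : Integrable (fun x => fderiv ℝ φ x (e i) i) :=
    h.integrable_of_continuous (F := fun A => A (e i) i) (by fun_prop) (by simp)
  rw [integral_finsetSum _ fun i _ => hint i]
  refine Finset.sum_eq_zero fun i _ => ?_
  obtain ⟨h1, h2, h3⟩ := h.comp i
  have := integral_mul_fderiv_eq_neg_fderiv_mul_of_integrable (μ := volume)
      (f := fun _ => (1 : ℝ)) (g := fun x => φ x i) (v := e i) (by simp) (by simpa [h3] using hint i)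
      (by simpa using h1.continuous.integrable_of_hasCompactSupport h2)
      (fun x _ => differentiableAt_const _) (fun x _ => h1.differentiable (by simp) x)
  simpa [h3] using this

/-- Poincaré's inequality for test fields. -/
theorem IsTestField.poincare {Ω : Set (Vec N)} {φ : Vec N → Vec N} (h : IsTestField Ω φ)
    (i : Fin N) {R : ℝ} (hR : ∀ x ∈ Ω, ‖x‖ ≤ R) :
    ∫ x in Ω, ‖φ x‖ ^ 2 ≤ 4 * R ^ 2 * ∫ x in Ω, contr (fderiv ℝ φ x) (fderiv ℝ φ x) := by
  rw [setIntegral_eq_integral_of_forall_compl_eq_zero,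
    setIntegral_eq_integral_of_forall_compl_eq_zero]
  rotate_left
  · intro x hx; simp [h.fderiv_eq_zero hx, contr]
  · intro x hx; simp [h.eq_zero hx]
  have hc := h.1.continuous
  have hcd := h.continuous_fderiv
  have hdiff := h.1.differentiable (by simp : (∞ : ℕ∞ω) ≠ 0)
  have hzero : ∀ x ∉ tsupport φ, φ x = 0 := fun x hx => image_eq_zero_of_notMem_tsupport hx
  have hxi : Continuous fun x : Vec N => x i := by fun_prop
  have hder : ∀ x, fderiv ℝ (fun x => ‖φ x‖ ^ 2) x (e i)
      = 2 * inner ℝ (φ x) (fderiv ℝ φ x (e i)) := by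
    intro x
    rw [((hdiff x).hasFDerivAt.norm_sq).fderiv]; simp
  have hderi : ∀ x : Vec N, fderiv ℝ (fun x : Vec N => x i) x (e i) = 1 := by
    intro x
    have : (fun x : Vec N => x i) = (EuclideanSpace.proj i : Vec N →L[ℝ] ℝ) := rfl
    rw [this, ContinuousLinearMap.fderiv]; simp [e]
  have hsq : Integrable (fun x => ‖φ x‖ ^ 2) :=
    Continuous.integrable_of_hasCompactSupport (by fun_prop)
      (HasCompactSupport.intro h.2.1 fun x hx => by simp [hzero x hx])
  have hcontr : Integrable (fun x => contr (fderiv ℝ φ x) (fderiv ℝ φ x)) :=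
    h.integrable_of_continuous (F := fun A => contr A A)
      (continuous_contr.comp (continuous_id.prodMk continuous_id)) (by simp [contr])
  -- Integration by parts of ∂_i(x_i) ‖φ‖² gives ∫ ‖φ‖² = -∫ 2 x_i φ·∂_i φ.
  have hparts := integral_mul_fderiv_eq_neg_fderiv_mul_of_integrable (μ := volume)
    (f := fun x : Vec N => x i) (g := fun x => ‖φ x‖ ^ 2) (v := e i) (by simpa [hderi] using hsq)
    (by
      simp only [hder]
      exact Continuous.integrable_of_hasCompactSupport (by fun_prop)
        (HasCompactSupport.intro h.2.1 fun x hx => by simp [hzero x hx]))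
    (Continuous.integrable_of_hasCompactSupport (by fun_prop)
        (HasCompactSupport.intro h.2.1 fun x hx => by simp [hzero x hx]))
    (fun x _ => by fun_prop)
    (fun x _ => (hdiff x).norm_sq ℝ)
  simp only [hder, hderi, one_mul] at hparts
  -- Young's inequality with |x_i| ≤ R; the coefficient ½ of ‖φ‖² is absorbed on the left, which
  -- doubles 2R² to 4R².
  have hle : ∫ x, -(x i * (2 * inner ℝ (φ x) (fderiv ℝ φ x (e i))))
      ≤ ∫ x, (1 / 2 * ‖φ x‖ ^ 2 + 2 * R ^ 2 * contr (fderiv ℝ φ x) (fderiv ℝ φ x)) := by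
    refine integral_mono (Continuous.integrable_of_hasCompactSupport (by fun_prop)
        (HasCompactSupport.intro h.2.1 fun x hx => by simp [hzero x hx]))
        ((hsq.const_mul _).add (hcontr.const_mul _)) fun x => ?_
    simp only
    by_cases hx : x ∈ Ω
    · have h1 := abs_real_inner_le_norm (φ x) (fderiv ℝ φ x (e i))
      have h2 : |x i| ≤ R := (PiLp.norm_apply_le x i).trans (hR x hx)
      have h3 := norm_apply_e_sq_le (fderiv ℝ φ x) i
      have hR0 : 0 ≤ R := (abs_nonneg _).trans h2
      have h4 : |x i| * |inner ℝ (φ x) (fderiv ℝ φ x (e i))|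
          ≤ R * (‖φ x‖ * ‖fderiv ℝ φ x (e i)‖) :=
        mul_le_mul h2 h1 (abs_nonneg _) hR0
      rw [← abs_mul] at h4
      have h5 := neg_abs_le (x i * inner ℝ (φ x) (fderiv ℝ φ x (e i)))
      nlinarith [sq_nonneg (‖φ x‖ - 2 * R * ‖fderiv ℝ φ x (e i)‖), sq_nonneg R,
        mul_le_mul_of_nonneg_left h3 (sq_nonneg R)]
    · simp [h.eq_zero hx, h.fderiv_eq_zero hx, contr]
  rw [integral_neg, hparts, neg_neg, integral_add (hsq.const_mul _) (hcontr.const_mul _),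
    integral_const_mul, integral_const_mul] at hle
  linarith

/-! ### From test fields to W^{1,2}_0 by density -/

/-- The pairing of two L² spaces by a bounded bilinear form is jointly continuous. Every identity or
inequality between such integrals thus passes from test fields to W^{1,2}_0. -/
theorem tendsto_integral_bilin {α ι E F : Type*} [MeasurableSpace α] {m : Measure α}
    [NormedAddCommGroup E] [NormedSpace ℝ E] [NormedAddCommGroup F] [NormedSpace ℝ F]
    {l : Filter ι} (B : E →L[ℝ] F →L[ℝ] ℝ) {f : ι → α → E} {f₀ : α → E} {g : ι → α → F}
    {g₀ : α → F} (hf : ∀ n, MemLp (f n) 2 m) (hf₀ : MemLp f₀ 2 m) (hg : ∀ n, MemLp (g n) 2 m)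
    (hg₀ : MemLp g₀ 2 m) (hfl : Tendsto (fun n => eLpNorm (fun x => f n x - f₀ x) 2 m) l (𝓝 0))
    (hgl : Tendsto (fun n => eLpNorm (fun x => g n x - g₀ x) 2 m) l (𝓝 0)) :
    Tendsto (fun n => ∫ x, B (f n x) (g n x) ∂m) l (𝓝 (∫ x, B (f₀ x) (g₀ x) ∂m)) := by
  have hf' := (Lp.tendsto_Lp_iff_tendsto_eLpNorm'' f hf f₀ hf₀).2 hfl
  have hg' := (Lp.tendsto_Lp_iff_tendsto_eLpNorm'' g hg g₀ hg₀).2 hgl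
  have hc : Continuous fun q : Lp E 2 m × Lp F 2 m => B.lpPairing m 2 2 q.1 q.2 := by fun_prop
  have hl := (hc.tendsto (hf₀.toLp f₀, hg₀.toLp g₀)).comp (hf'.prodMk_nhds hg')
  have heq : ∀ {f : α → E} {g : α → F} (hf : MemLp f 2 m) (hg : MemLp g 2 m),
      B.lpPairing m 2 2 (hf.toLp f) (hg.toLp g) = ∫ x, B (f x) (g x) ∂m := by
    intro f g hf hg
    rw [ContinuousLinearMap.lpPairing_eq_integral]
    refine integral_congr_ae ?_
    filter_upwards [hf.coeFn_toLp, hg.coeFn_toLp] with x h1 h2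
    rw [h1, h2]
  simpa only [Function.comp_def, heq] using hl

theorem tendsto_eLpNorm_sub_self {α E : Type*} [MeasurableSpace α] {m : Measure α}
    [NormedAddCommGroup E] (f : α → E) :
    Tendsto (fun _ : ℕ => eLpNorm (fun x => f x - f x) 2 m) atTop (𝓝 0) := by
  simp

theorem integrable_bilin {α E F : Type*} [MeasurableSpace α] {m : Measure α}
    [NormedAddCommGroup E] [NormedSpace ℝ E] [NormedAddCommGroup F] [NormedSpace ℝ F]
    (B : E →L[ℝ] F →L[ℝ] ℝ) {f : α → E} {g : α → F} (hf : MemLp f 2 m) (hg : MemLp g 2 m) :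
    Integrable (fun x => B (f x) (g x)) m := by
  have h : Integrable (fun x => ‖B‖ * (‖f x‖ * ‖g x‖)) m :=
    (hf.norm.integrable_mul hg.norm).const_mul _
  refine h.mono' (B.aestronglyMeasurable_comp₂ hf.1 hg.1) ?_
  filter_upwards with x
  rw [← mul_assoc]
  exact B.le_opNorm₂ _ _

/-- The contraction as a continuous bilinear form. -/
def contrBilin : Mat N →L[ℝ] Mat N →L[ℝ] ℝ :=
  (LinearMap.mk₂ ℝ contr contr_add_left contr_smul_left
    (fun A B C => by rw [contr_comm, contr_add_left, contr_comm B, contr_comm C])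
    (fun a A B => by rw [contr_comm, contr_smul_left, contr_comm B]; rfl)).mkContinuous₂ N
    fun A B => by simpa [mul_assoc] using abs_contr_le A B

@[simp] theorem contrBilin_apply (A B : Mat N) : contrBilin A B = contr A B := rfl

/-- The inner product as a continuous bilinear form. -/
def innerBilin : Vec N →L[ℝ] Vec N →L[ℝ] ℝ :=
  (innerₗ (Vec N)).mkContinuous₂ 1 fun v w => by simpa using abs_real_inner_le_norm v w

@[simp] theorem innerBilin_apply (v w : Vec N) : innerBilin v w = inner ℝ v w := rfl

theorem MemW012.sub {Ω : Set (Vec N)} {f f' : Vec N → Vec N} {g g' : Vec N → Mat N}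
    (h : MemW012 Ω f g) (h' : MemW012 Ω f' g') :
    MemW012 Ω (fun x => f x - f' x) (fun x => g x - g' x) := by
  obtain ⟨hf, hg, φ, hφ, h1, h2⟩ := h
  obtain ⟨hf', hg', φ', hφ', h1', hgl⟩ := h'
  have aux : ∀ {E : Type} [NormedAddCommGroup E] {a a' : ℕ → Vec N → E} {b b' : Vec N → E},
      (∀ n, MemLp (a n) 2 (volume.restrict Ω)) → (∀ n, MemLp (a' n) 2 (volume.restrict Ω)) →
      MemLp b 2 (volume.restrict Ω) → MemLp b' 2 (volume.restrict Ω) →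
      Tendsto (fun n => eLpNorm (fun x => a n x - b x) 2 (volume.restrict Ω)) atTop (𝓝 0) →
      Tendsto (fun n => eLpNorm (fun x => a' n x - b' x) 2 (volume.restrict Ω)) atTop (𝓝 0) →
      Tendsto (fun n => eLpNorm (fun x => (a n x - a' n x) - (b x - b' x)) 2 (volume.restrict Ω))
        atTop (𝓝 0) := by
    intro E _ a a' b b' ha ha' hb hb' hl hl'
    have hs := hl.add hl'
    rw [add_zero] at hs
    refine tendsto_of_tendsto_of_tendsto_of_le_of_le tendsto_const_nhds hs (fun _ => zero_le)
      fun n => ?_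
    have := eLpNorm_sub_le (p := 2) ((ha n).sub hb).1 ((ha' n).sub hb').1 (by norm_num)
    refine le_trans (le_of_eq ?_) this
    congr 1
    ext x
    simp only [Pi.sub_apply]
    abel
  refine ⟨hf.sub hf', hg.sub hg', fun n x => φ n x - φ' n x, fun n => ⟨?_, ?_, ?_⟩, ?_, ?_⟩
  · exact (hφ n).1.sub (hφ' n).1
  · exact (hφ n).2.1.sub (hφ' n).2.1
  · exact (tsupport_sub (φ n) (φ' n)).trans (union_subset (hφ n).2.2 (hφ' n).2.2)
  · exact aux (fun n => (hφ n).memLp) (fun n => (hφ' n).memLp) hf hf' h1 h1'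
  · have hd : ∀ n x, fderiv ℝ (fun x => φ n x - φ' n x) x
        = fderiv ℝ (φ n) x - fderiv ℝ (φ' n) x := fun n x =>
      fderiv_fun_sub ((hφ n).1.differentiable (by simp) x) ((hφ' n).1.differentiable (by simp) x)
    simp only [hd]
    exact aux (fun n => (hφ n).memLp_fderiv) (fun n => (hφ' n).memLp_fderiv) hg hg' h2 hgl

/-- Korn's inequality in `W^{1,2}_0`. -/
theorem MemW012.korn {Ω : Set (Vec N)} {f : Vec N → Vec N} {g : Vec N → Mat N} {μ η : ℝ}
    (hμ : 0 ≤ μ) (hη : 0 ≤ η) (h : MemW012 Ω f g) :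
    μ * ∫ x in Ω, contr (g x) (g x) ≤ ∫ x in Ω, contr (stress μ η (g x)) (g x) := by
  obtain ⟨hf, hg, φ, hφ, h1, h2⟩ := h
  -- The form B(A, A) = S(A):A - μ|A|² is μ Aᵗ:A + (η - ⅔μ)(tr A)². For a test field its integral is
  -- (η + μ/3) ∫ (div φ)², which is nonnegative, and the sign survives the L² limit.
  set B : Mat N →L[ℝ] Mat N →L[ℝ] ℝ :=
    contrBilin.comp (stressCLM μ η - μ • ContinuousLinearMap.id ℝ (Mat N)) with hB
  have hBa : ∀ A, B A A = contr (stress μ η A) A - μ * contr A A := by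
    intro A
    simp [hB]
  have hlim := tendsto_integral_bilin B (fun n => (hφ n).memLp_fderiv) hg
    (fun n => (hφ n).memLp_fderiv) hg h2 h2
  have hpos : 0 ≤ ∫ x in Ω, B (g x) (g x) := by
    refine ge_of_tendsto' hlim fun n => ?_
    have hc : ∀ x, B (fderiv ℝ (φ n) x) (fderiv ℝ (φ n) x)
        = μ * contr (ContinuousLinearMap.adjoint (fderiv ℝ (φ n) x)) (fderiv ℝ (φ n) x)
          + (η - 2 / 3 * μ) * (tr (fderiv ℝ (φ n) x) * tr (fderiv ℝ (φ n) x)) := by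
      intro x
      rw [hBa, contr_stress_left]; ring
    have i1 : Integrable (fun x => contr (ContinuousLinearMap.adjoint (fderiv ℝ (φ n) x))
        (fderiv ℝ (φ n) x)) :=
      (hφ n).integrable_of_continuous
        (F := fun A => contr (ContinuousLinearMap.adjoint A) A)
        (by simp only [contr_adjoint_left]; fun_prop) (by simp [contr])
    have i2 : Integrable (fun x => tr (fderiv ℝ (φ n) x) * tr (fderiv ℝ (φ n) x)) :=
      (hφ n).integrable_of_continuous (F := fun A => tr A * tr A)
        (continuous_tr.mul continuous_tr) (by simp [tr])
    simp only [hc]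
    rw [integral_add (i1.integrableOn.const_mul _) (i2.integrableOn.const_mul _),
      integral_const_mul, integral_const_mul, (hφ n).integral_contr_adjoint, ← add_mul]
    refine mul_nonneg (by linarith) (integral_nonneg fun x => mul_self_nonneg _)
  simp only [hBa] at hpos
  have j1 : Integrable (fun x => contr (stress μ η (g x)) (g x)) (volume.restrict Ω) := by
    simpa using integrable_bilin (contrBilin.comp (stressCLM μ η)) hg hg
  have j2 : Integrable (fun x => contr (g x) (g x)) (volume.restrict Ω) := by
    simpa using integrable_bilin contrBilin hg hg
  rw [integral_sub j1 (j2.const_mul _), integral_const_mul] at hpos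
  linarith

/-- Poincaré's inequality in `W^{1,2}_0`. -/
theorem MemW012.poincare {Ω : Set (Vec N)} {f : Vec N → Vec N} {g : Vec N → Mat N}
    (h : MemW012 Ω f g) (i : Fin N) {R : ℝ} (hR : ∀ x ∈ Ω, ‖x‖ ≤ R) :
    ∫ x in Ω, ‖f x‖ ^ 2 ≤ 4 * R ^ 2 * ∫ x in Ω, contr (g x) (g x) := by
  obtain ⟨hf, hg, φ, hφ, h1, h2⟩ := h
  have l1 := tendsto_integral_bilin innerBilin (fun n => (hφ n).memLp) hf
    (fun n => (hφ n).memLp) hf h1 h1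
  have l2 := tendsto_integral_bilin contrBilin (fun n => (hφ n).memLp_fderiv) hg
    (fun n => (hφ n).memLp_fderiv) hg h2 h2
  simp only [innerBilin_apply, real_inner_self_eq_norm_sq, contrBilin_apply] at l1 l2
  exact le_of_tendsto_of_tendsto' l1 (l2.const_mul _) fun n => (hφ n).poincare i hR

/-- The divergence of a field in `W^{1,2}_0` has zero mean. -/
theorem MemW012.integral_tr {Ω : Set (Vec N)} [IsFiniteMeasure (volume.restrict Ω)]
    {f : Vec N → Vec N} {g : Vec N → Mat N}
    (h : MemW012 Ω f g) : ∫ x in Ω, tr (g x) = 0 := by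
  obtain ⟨hf, hg, φ, hφ, h1, h2⟩ := h
  have hI : MemLp (fun _ : Vec N => ContinuousLinearMap.id ℝ (Vec N)) 2 (volume.restrict Ω) :=
    memLp_const _
  have l2 := tendsto_integral_bilin contrBilin (fun n : ℕ => hI) hI
    (fun n => (hφ n).memLp_fderiv) hg (tendsto_eLpNorm_sub_self _) h2
  simp only [contrBilin_apply, contr_id_left, (hφ _).integral_tr] at l2
  exact (tendsto_nhds_unique l2 tendsto_const_nhds)

/-- A distributional divergence may be tested with fields in `W^{1,2}_0`. -/
theorem MemW012.integral_contr_of_isWeakDiv {Ω : Set (Vec N)} {f : Vec N → Vec N}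
    {g : Vec N → Mat N} (h : MemW012 Ω f g) {A : Vec N → Mat N} {b : Vec N → Vec N}
    (hA : MemLp A 2 (volume.restrict Ω)) (hb : MemLp b 2 (volume.restrict Ω))
    (hw : IsWeakDiv Ω A b) :
    ∫ x in Ω, contr (A x) (g x) = -∫ x in Ω, inner ℝ (b x) (f x) := by
  obtain ⟨hf, hg, φ, hφ, h1, h2⟩ := h
  have l1 := tendsto_integral_bilin innerBilin (fun _ => hb) hb (fun n => (hφ n).memLp) hf
    (tendsto_eLpNorm_sub_self _) h1
  have l2 := tendsto_integral_bilin contrBilin (fun _ => hA) hA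
    (fun n => (hφ n).memLp_fderiv) hg (tendsto_eLpNorm_sub_self _) h2
  simp only [innerBilin_apply, contrBilin_apply, hw _ (hφ _)] at l1 l2
  exact tendsto_nhds_unique l2 l1.neg

/-! ### Fields vanishing on the boundary belong to W^{1,2}_0 -/

/-- Mollification: compactly supported `C^1` fields are limits in `C^1` of test fields. -/
theorem exists_isTestField_near {Ω : Set (Vec N)} (hΩ : IsOpen Ω) {f : Vec N → Vec N}
    (hf : ContDiff ℝ 1 f) (hfs : HasCompactSupport f) (hfΩ : tsupport f ⊆ Ω) {ε : ℝ} (hε : 0 < ε) :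
    ∃ φ : Vec N → Vec N, IsTestField Ω φ ∧ (∀ x, ‖φ x - f x‖ ≤ ε) ∧
      ∀ x, ‖fderiv ℝ φ x - fderiv ℝ f x‖ ≤ ε := by
  obtain ⟨δ₁, hδ₁, h₁⟩ := Metric.uniformContinuous_iff.1
    (hfs.uniformContinuous_of_continuous hf.continuous) ε hε
  obtain ⟨δ₂, hδ₂, h₂⟩ := Metric.uniformContinuous_iff.1
    ((hfs.fderiv ℝ).uniformContinuous_of_continuous (hf.continuous_fderiv one_ne_zero)) ε hε
  obtain ⟨δ₃, hδ₃, h₃⟩ := IsCompact.exists_cthickening_subset_open hfs hΩ hfΩ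
  -- Below the moduli of uniform continuity of f and of its differential, and small enough that the
  -- δ-thickening of the support stays in `Ω`.
  set δ := min δ₁ (min δ₂ δ₃) with hδ
  have hδ0 : 0 < δ := lt_min hδ₁ (lt_min hδ₂ hδ₃)
  let k : ContDiffBump (0 : Vec N) := ⟨δ / 2, δ, by linarith, by linarith⟩
  have hk : k.rOut = δ := rfl
  set φ : Vec N → Vec N :=
    MeasureTheory.convolution (k.normed volume) f (ContinuousLinearMap.lsmul ℝ ℝ) volume with hφ
  have hfd : ∀ x, fderiv ℝ φ x = MeasureTheory.convolution (k.normed volume) (fderiv ℝ f)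
      (ContinuousLinearMap.lsmul ℝ ℝ) volume x := by
    intro x
    exact (hfs.hasFDerivAt_convolution_right (ContinuousLinearMap.lsmul ℝ ℝ)
      k.continuous_normed.locallyIntegrable hf x).fderiv
  have hsupp : Function.support φ ⊆ Metric.cthickening δ (tsupport f) := by
    refine (MeasureTheory.support_convolution_subset _).trans ?_
    rw [k.support_normed_eq, hk]
    rintro _ ⟨y, hy, z, hz, rfl⟩
    refine Metric.mem_cthickening_of_dist_le _ z _ _ (subset_tsupport f hz) ?_
    simpa using (mem_ball_zero_iff.1 hy).le
  have htsupp : tsupport φ ⊆ Metric.cthickening δ (tsupport f) :=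
    closure_minimal hsupp Metric.isClosed_cthickening
  refine ⟨φ, ⟨?_, ?_, ?_⟩, fun x => ?_, fun x => ?_⟩
  · exact HasCompactSupport.contDiff_convolution_left (n := ⊤) _ k.hasCompactSupport_normed
      k.contDiff_normed hf.continuous.locallyIntegrable
  · exact (IsCompact.cthickening hfs).of_isClosed_subset (isClosed_tsupport φ) htsupp
  · exact htsupp.trans ((Metric.cthickening_mono (by simp [hδ]) _).trans h₃)
  · rw [← dist_eq_norm]
    refine k.dist_normed_convolution_le hf.continuous.aestronglyMeasurable fun y hy => ?_
    exact (h₁ ((Metric.mem_ball.1 hy).trans_le (by simp [hk, hδ]))).le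
  · rw [← dist_eq_norm, hfd]
    refine k.dist_normed_convolution_le
      (hf.continuous_fderiv one_ne_zero).aestronglyMeasurable fun y hy => ?_
    exact (h₂ ((Metric.mem_ball.1 hy).trans_le (by simp [hk, hδ]))).le

/-- A smooth map that vanishes near the origin, is the identity away from it and has bounded
differential. -/
theorem exists_truncation : ∃ F : Vec N → Vec N, ∃ C : ℝ, ContDiff ℝ 1 F ∧
    (∀ y, ‖y‖ < 1 → F y = 0) ∧ (∀ y, 2 ≤ ‖y‖ → F y = y) ∧ (∀ y, ‖F y - y‖ ≤ 2) ∧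
    (∀ y, ‖fderiv ℝ F y‖ ≤ C) := by
  let k : ContDiffBump (0 : Vec N) := ⟨1, 2, by norm_num, by norm_num⟩
  have hk1 : ContDiff ℝ 1 k := k.contDiff
  have hF : ContDiff ℝ 1 (fun y : Vec N => y - k y • y) := by fun_prop
  have hG : ContDiff ℝ 1 (fun y : Vec N => k y • y) := by fun_prop
  have hGs : HasCompactSupport (fun y : Vec N => k y • y) := k.hasCompactSupport.smul_right
  obtain ⟨C, hC⟩ := (hGs.fderiv ℝ).exists_bound_of_continuous (hG.continuous_fderiv one_ne_zero)
  have hz : ∀ y : Vec N, 2 ≤ ‖y‖ → k y = 0 := fun y hy =>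
    k.zero_of_le_dist (by simpa [k] using hy)
  refine ⟨fun y => y - k y • y, 1 + C, hF, fun y hy => ?_, fun y hy => ?_, fun y => ?_,
    fun y => ?_⟩
  · have : k y = 1 := k.one_of_mem_closedBall (by simpa [k] using hy.le)
    simp [this]
  · simp [hz y hy]
  · simp only [sub_sub_cancel_left, norm_neg, norm_smul, Real.norm_eq_abs, abs_of_nonneg k.nonneg]
    rcases le_or_gt 2 ‖y‖ with h | h
    · simp [hz y h]
    · have := k.le_one (x := y)
      nlinarith [k.nonneg (x := y), norm_nonneg y]
  · rw [fderiv_fun_sub differentiableAt_fun_id (hG.differentiable one_ne_zero y)]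
    refine (norm_sub_le _ _).trans (add_le_add ?_ (hC y))
    rw [fderiv_fun_id]
    exact ContinuousLinearMap.norm_id_le

/-- Dominated convergence with a constant majorant on a finite measure space; it turns pointwise
approximation of a field and its gradient into L² approximation. -/
theorem tendsto_eLpNorm_of_bounded {α E : Type*} [MeasurableSpace α] {m : Measure α}
    [IsFiniteMeasure m] [NormedAddCommGroup E] {f : ℕ → α → E} {C : ℝ}
    (hf : ∀ n, AEStronglyMeasurable (f n) m) (hC : ∀ n, ∀ᵐ x ∂m, ‖f n x‖ ≤ C)
    (hl : ∀ᵐ x ∂m, Tendsto (fun n => f n x) atTop (𝓝 0)) :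
    Tendsto (fun n => eLpNorm (f n) 2 m) atTop (𝓝 0) := by
  have h : Tendsto (fun n => ∫⁻ x, ‖f n x‖ₑ ^ (2 : ℝ) ∂m) atTop (𝓝 (∫⁻ _, 0 ∂m)) := by
    refine tendsto_lintegral_of_dominated_convergence' (fun _ => ENNReal.ofReal C ^ (2 : ℝ))
      (fun n => (hf n).enorm.pow_const _) (fun n => ?_) ?_ ?_
    · filter_upwards [hC n] with x hx
      gcongr
      rw [← ofReal_norm]
      exact ENNReal.ofReal_le_ofReal hx
    · simp [ENNReal.mul_eq_top]
    · filter_upwards [hl] with x hx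
      have := (ENNReal.continuous_rpow_const (y := (2 : ℝ))).tendsto _ |>.comp hx.enorm
      simpa [Function.comp_def] using this
  have h2 := (ENNReal.continuous_rpow_const (y := (1 / 2 : ℝ))).tendsto _ |>.comp h
  simpa [Function.comp_def, eLpNorm_eq_lintegral_rpow_enorm_toReal] using h2

/-- The differential vanishes almost everywhere on the zero set. -/
theorem ae_fderiv_eq_zero_of_eq_zero {Ω : Set (Vec N)} (hΩ : IsOpen Ω) {f : Vec N → Vec N}
    {g : Vec N → Mat N} (hf : ContinuousOn f (closure Ω))
    (hd : ∀ x ∈ Ω, HasFDerivAt f (g x) x) :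
    ∀ᵐ x ∂volume.restrict Ω, f x = 0 → g x = 0 := by
  set s := Ω ∩ (closure Ω ∩ f ⁻¹' {0}) with hs
  have hsm : MeasurableSet s := hΩ.measurableSet.inter
    (hf.preimage_isClosed_of_isClosed isClosed_closure isClosed_singleton).measurableSet
  -- On the zero set the zero map approximates f with error constant 0. At almost every point of
  -- such a set (at density points) the differential differs from the approximating map by at most
  -- that constant.
  have ha : ApproximatesLinearOn f (0 : Mat N) s 0 := by
    intro x hx y hy
    have h1 : f x = 0 := hx.2.2
    have h2 : f y = 0 := hy.2.2
    simp [h1, h2]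
  have h := ha.norm_fderiv_sub_le volume hsm g
    fun x hx => (hd x hx.1).hasFDerivWithinAt
  rw [ae_restrict_iff' hsm] at h
  rw [ae_restrict_iff' hΩ.measurableSet]
  filter_upwards [h] with x hx hxΩ hfx
  have := hx ⟨hxΩ, subset_closure hxΩ, hfx⟩
  simpa using this

theorem ContinuousOn.memLp_restrict {E : Type*} [NormedAddCommGroup E] [SecondCountableTopology E]
    {Ω : Set (Vec N)} (hΩ : IsOpen Ω) (hb : Bornology.IsBounded Ω) {f : Vec N → E}
    (hf : ContinuousOn f (closure Ω)) : MemLp f 2 (volume.restrict Ω) := by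
  have hK : IsCompact (closure Ω) := hb.isCompact_closure
  obtain ⟨C, hC⟩ := hK.exists_bound_of_continuousOn hf
  have : IsFiniteMeasure (volume.restrict Ω) := ⟨by simpa using hb.measure_lt_top⟩
  refine MemLp.of_bound ((hf.mono subset_closure).aestronglyMeasurable hΩ.measurableSet) C ?_
  filter_upwards [ae_restrict_mem hΩ.measurableSet] with x hx using hC x (subset_closure hx)

/-- A field of class `C^1` up to the boundary which vanishes on the boundary is in `W^{1,2}_0`. -/
theorem memW012_of_continuousOn_closure {Ω : Set (Vec N)} (hΩ : IsOpen Ω)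
    (hb : Bornology.IsBounded Ω) {f : Vec N → Vec N} {g : Vec N → Mat N}
    (hf : ContinuousOn f (closure Ω)) (hg : ContinuousOn g (closure Ω))
    (hd : ∀ x ∈ Ω, HasFDerivAt f (g x) x) (h0 : ∀ x ∈ frontier Ω, f x = 0) :
    MemW012 Ω f g := by
  have hK : IsCompact (closure Ω) := hb.isCompact_closure
  have hfin : IsFiniteMeasure (volume.restrict Ω) := ⟨by simpa using hb.measure_lt_top⟩
  obtain ⟨G, hG⟩ := hK.exists_bound_of_continuousOn hg
  obtain ⟨F, C, hF, hF0, hF1, hF2, hF3⟩ := exists_truncation (N := N)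
  -- With a = n + 1, the field f is truncated to a⁻¹F(a f), which vanishes where ‖f‖ < 1/a. As f
  -- vanishes on the frontier, the truncation has compact support in `Ω`. Truncation costs 2/a and
  -- mollification 1/a.
  have key : ∀ n : ℕ, ∃ φ : Vec N → Vec N, IsTestField Ω φ ∧
      (∀ x ∈ Ω, ‖φ x - f x‖ ≤ 3 / ((n : ℝ) + 1)) ∧
      (∀ x ∈ Ω, ‖fderiv ℝ φ x - (fderiv ℝ F (((n : ℝ) + 1) • f x)).comp (g x)‖
        ≤ 1 / ((n : ℝ) + 1)) := by
    intro n
    set a : ℝ := (n : ℝ) + 1 with ha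
    have ha0 : 0 < a := by positivity
    classical
    set f' : Vec N → Vec N := fun x => if x ∈ Ω then a⁻¹ • F (a • f x) else 0 with hf'
    set K := closure Ω ∩ f ⁻¹' {y | 1 ≤ ‖a • y‖} with hKdef
    have hKc : IsCompact K := hK.of_isClosed_subset
      (hf.preimage_isClosed_of_isClosed isClosed_closure
        (isClosed_le continuous_const (by fun_prop))) inter_subset_left
    have hKΩ : K ⊆ Ω := by
      intro x hx
      by_contra hxΩ
      have : f x = 0 := h0 x ⟨hx.1, by rwa [hΩ.interior_eq]⟩
      have h2 : 1 ≤ ‖a • f x‖ := hx.2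
      rw [this] at h2
      simp at h2
      linarith
    have hz : ∀ x ∉ K, f' x = 0 := by
      intro x hx
      by_cases hxΩ : x ∈ Ω
      · have : ‖a • f x‖ < 1 := by
          by_contra hcon
          exact hx ⟨subset_closure hxΩ, not_lt.1 hcon⟩
        simp [hf', hxΩ, hF0 _ this]
      · simp [hf', hxΩ]
    have hder : ∀ x ∈ Ω, HasFDerivAt f' ((fderiv ℝ F (a • f x)).comp (g x)) x := by
      intro x hx
      have h1 : HasFDerivAt (fun x => a⁻¹ • F (a • f x))
          (a⁻¹ • (fderiv ℝ F (a • f x)).comp (a • g x)) x :=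
        (((hF.differentiable one_ne_zero (a • f x)).hasFDerivAt).comp x
          ((hd x hx).fun_const_smul a)).fun_const_smul _
      have h2 : a⁻¹ • (fderiv ℝ F (a • f x)).comp (a • g x) = (fderiv ℝ F (a • f x)).comp (g x) := by
        rw [ContinuousLinearMap.comp_smul, smul_smul, inv_mul_cancel₀ ha0.ne', one_smul]
      rw [h2] at h1
      refine h1.congr_of_eventuallyEq ?_
      filter_upwards [hΩ.mem_nhds hx] with y hy
      simp [hf', hy]
    have hcd : ContDiff ℝ 1 f' := by
      rw [contDiff_iff_contDiffAt]
      intro x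
      by_cases hxΩ : x ∈ Ω
      · refine contDiffAt_one_iff.2 ⟨_, Ω, hΩ.mem_nhds hxΩ, ?_, hder⟩
        have := hF.continuous_fderiv one_ne_zero
        exact (this.comp_continuousOn ((hf.mono subset_closure).const_smul a)).clm_comp
          (hg.mono subset_closure)
      · have : f' =ᶠ[𝓝 x] fun _ => 0 := by
          filter_upwards [hKc.isClosed.isOpen_compl.mem_nhds fun h => hxΩ (hKΩ h)] with y hy
          exact hz y hy
        exact contDiffAt_const.congr_of_eventuallyEq this
    have hts : tsupport f' ⊆ K := closure_minimal
      (fun x hx => by by_contra h; exact hx (hz x h)) hKc.isClosed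
    obtain ⟨φ, hφ, h1, h2⟩ := exists_isTestField_near hΩ hcd
      (hKc.of_isClosed_subset (isClosed_tsupport _) hts) (hts.trans hKΩ) (ε := 1 / a) (by positivity)
    refine ⟨φ, hφ, fun x hx => ?_, fun x hx => ?_⟩
    · have h3 : ‖f' x - f x‖ ≤ 2 / a := by
        have : f' x - f x = a⁻¹ • (F (a • f x) - a • f x) := by
          simp [hf', hx, smul_sub, smul_smul, ha0.ne']
        rw [this, norm_smul, norm_inv, Real.norm_of_nonneg ha0.le, inv_mul_eq_div]
        gcongr
        exact hF2 _
      calc ‖φ x - f x‖ = ‖(φ x - f' x) + (f' x - f x)‖ := by congr 1; abel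
        _ ≤ 1 / a + 2 / a := (norm_add_le _ _).trans (add_le_add (h1 x) h3)
        _ = 3 / a := by ring
    · rw [← (hder x hx).fderiv]
      exact h2 x
  choose φ hφ hφ1 hφ2 using key
  have hle1 : ∀ n : ℕ, 1 / ((n : ℝ) + 1) ≤ 1 := fun n => by
    rw [div_le_one (by positivity)]; linarith [(Nat.cast_nonneg n : (0 : ℝ) ≤ n)]
  have hlim1 : Tendsto (fun n : ℕ => 1 / ((n : ℝ) + 1)) atTop (𝓝 0) :=
    tendsto_one_div_add_atTop_nhds_zero_nat
  have hfL := ContinuousOn.memLp_restrict hΩ hb hf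
  have hgL := ContinuousOn.memLp_restrict hΩ hb hg
  refine ⟨hfL, hgL, φ, hφ, ?_, ?_⟩
  · refine tendsto_eLpNorm_of_bounded (C := 3) (fun n => ((hφ n).memLp.1.sub hfL.1)) (fun n => ?_) ?_
    · filter_upwards [ae_restrict_mem hΩ.measurableSet] with x hx
      refine (hφ1 n x hx).trans ?_
      have := hle1 n
      rw [show (3 : ℝ) / ((n : ℝ) + 1) = 3 * (1 / ((n : ℝ) + 1)) by ring]
      linarith
    · filter_upwards [ae_restrict_mem hΩ.measurableSet] with x hx
      refine squeeze_zero_norm (fun n => hφ1 n x hx) ?_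
      have := hlim1.const_mul 3
      simpa [div_eq_mul_inv] using this
  · refine tendsto_eLpNorm_of_bounded (C := 1 + (C * G + G))
      (fun n => ((hφ n).memLp_fderiv.1.sub hgL.1)) (fun n => ?_) ?_
    · filter_upwards [ae_restrict_mem hΩ.measurableSet] with x hx
      have hGx := hG x (subset_closure hx)
      have h3 : ‖(fderiv ℝ F (((n : ℝ) + 1) • f x)).comp (g x)‖ ≤ C * G :=
        (ContinuousLinearMap.opNorm_comp_le _ _).trans
          (mul_le_mul (hF3 _) hGx (norm_nonneg _) ((norm_nonneg _).trans (hF3 0)))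
      calc ‖fderiv ℝ (φ n) x - g x‖
          = ‖(fderiv ℝ (φ n) x - (fderiv ℝ F (((n : ℝ) + 1) • f x)).comp (g x))
            + ((fderiv ℝ F (((n : ℝ) + 1) • f x)).comp (g x) - g x)‖ := by congr 1; abel
        _ ≤ 1 + (C * G + G) := (norm_add_le _ _).trans
            (add_le_add ((hφ2 n x hx).trans (hle1 n))
              ((norm_sub_le _ _).trans (add_le_add h3 hGx)))
    · filter_upwards [ae_restrict_mem hΩ.measurableSet, ae_fderiv_eq_zero_of_eq_zero hΩ hf hd]
        with x hx hx0
      -- Where f ≠ 0, the point (n + 1) f eventually lies outside the ball of radius 2, and F is the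
      -- identity there. Where f = 0, the gradient vanishes almost everywhere, so the truncation
      -- does no harm.
      have hev : ∀ᶠ n : ℕ in atTop, (fderiv ℝ F (((n : ℝ) + 1) • f x)).comp (g x) = g x := by
        by_cases hfx : f x = 0
        · simp [hx0 hfx]
        · have hpos : 0 < ‖f x‖ := norm_pos_iff.2 hfx
          obtain ⟨n₀, hn₀⟩ := exists_nat_gt (2 / ‖f x‖)
          filter_upwards [eventually_ge_atTop n₀] with n hn
          have hlt : 2 < ‖((n : ℝ) + 1) • f x‖ := by
            rw [norm_smul, Real.norm_of_nonneg (by positivity)]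
            have : (n₀ : ℝ) ≤ n := by exact_mod_cast hn
            rw [div_lt_iff₀ hpos] at hn₀
            nlinarith
          have : F =ᶠ[𝓝 (((n : ℝ) + 1) • f x)] id := by
            filter_upwards [(isOpen_lt continuous_const continuous_norm).mem_nhds hlt] with y hy
            exact hF1 y (le_of_lt hy)
          rw [this.fderiv_eq, fderiv_id]
          exact ContinuousLinearMap.id_comp _
      refine squeeze_zero_norm' ?_ hlim1
      filter_upwards [hev] with n hn
      have := hφ2 n x hx
      rwa [hn] at this

/-! ### Convexity and coercivity of the pressure potential -/

/-- Second-order Taylor lower bound. -/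
theorem taylor_lower_bound {f f' f'' : ℝ → ℝ} {r s c : ℝ}
    (h1 : ∀ z ∈ uIcc r s, HasDerivAt f (f' z) z) (h2 : ∀ z ∈ uIcc r s, HasDerivAt f' (f'' z) z)
    (h3 : ∀ z ∈ uIcc r s, 2 * c ≤ f'' z) :
    c * (s - r) ^ 2 ≤ f s - f r - f' r * (s - r) := by
  have hd1 : ∀ z ∈ uIcc r s, HasDerivAt (fun z => f z - f' r * (z - r) - c * (z - r) ^ 2)
      (f' z - f' r - 2 * c * (z - r)) z := by
    intro z hz
    have hid := (hasDerivAt_id z).sub_const r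
    have := ((h1 z hz).sub (hid.const_mul (f' r))).sub ((hid.pow 2).const_mul c)
    refine this.congr_deriv ?_
    simp
    ring
  have hd2 : ∀ z ∈ uIcc r s, HasDerivAt (fun z => f' z - f' r - 2 * c * (z - r))
      (f'' z - 2 * c) z := by
    intro z hz
    have hid := (hasDerivAt_id z).sub_const r
    have := ((h2 z hz).sub_const (f' r)).sub (hid.const_mul (2 * c))
    exact this.congr_deriv (by simp)
  rcases lt_trichotomy r s with hrs | hrs | hrs
  · rw [uIcc_of_le hrs.le] at *
    -- The mean value theorem is applied to f minus its tangent at r and the parabola c(z - r)², and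
    -- then to the derivative of this difference. The second application gives the derivative the
    -- sign of x - r, so the difference does not fall below its value at r.
    obtain ⟨x, hx, hxe⟩ := exists_hasDerivAt_eq_slope _ _ hrs
      (fun z hz => (hd1 z hz).continuousAt.continuousWithinAt)
      (fun z hz => hd1 z (Ioo_subset_Icc_self hz))
    have hsub : Icc r x ⊆ Icc r s := Icc_subset_Icc_right hx.2.le
    obtain ⟨y, hy, hye⟩ := exists_hasDerivAt_eq_slope _ _ hx.1
      (fun z hz => (hd2 z (hsub hz)).continuousAt.continuousWithinAt)
      (fun z hz => hd2 z (hsub (Ioo_subset_Icc_self hz)))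
    have h4 := h3 y (hsub (Ioo_subset_Icc_self hy))
    rw [eq_div_iff (by linarith [hx.1])] at hye
    rw [eq_div_iff (by linarith)] at hxe
    have h5 : 0 ≤ f' x - f' r - 2 * c * (x - r) := by
      have := mul_nonneg (sub_nonneg.2 h4) (sub_nonneg.2 hx.1.le)
      rw [hye] at this
      linarith
    have := mul_nonneg h5 (sub_nonneg.2 hrs.le)
    rw [hxe] at this
    linarith
  · subst hrs; simp
  · rw [uIcc_of_ge hrs.le] at *
    obtain ⟨x, hx, hxe⟩ := exists_hasDerivAt_eq_slope _ _ hrs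
      (fun z hz => (hd1 z hz).continuousAt.continuousWithinAt)
      (fun z hz => hd1 z (Ioo_subset_Icc_self hz))
    have hsub : Icc x r ⊆ Icc s r := Icc_subset_Icc_left hx.1.le
    obtain ⟨y, hy, hye⟩ := exists_hasDerivAt_eq_slope _ _ hx.2
      (fun z hz => (hd2 z (hsub hz)).continuousAt.continuousWithinAt)
      (fun z hz => hd2 z (hsub (Ioo_subset_Icc_self hz)))
    have h4 := h3 y (hsub (Ioo_subset_Icc_self hy))
    rw [eq_div_iff (by linarith [hx.2])] at hye
    rw [eq_div_iff (by linarith)] at hxe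
    have h5 : f' x - f' r - 2 * c * (x - r) ≤ 0 := by
      have := mul_nonneg (sub_nonneg.2 h4) (sub_nonneg.2 hx.2.le)
      rw [hye] at this
      linarith
    have := mul_nonneg_of_nonpos_of_nonpos h5 (by linarith : s - r ≤ 0)
    have e : (f' x - f' r - 2 * c * (x - r)) * (s - r)
      = -((f' x - f' r - 2 * c * (x - r)) * (r - s)) := by ring
    rw [e, hxe] at this
    linarith

section Pressure

variable {p : ℝ → ℝ}

theorem IsPressure.hasDerivAt (hp : IsPressure p) {s : ℝ} (hs : 0 < s) :
    HasDerivAt p (deriv p s) s :=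
  ((hp.contDiffOn.differentiableOn (by norm_num)).differentiableAt (Ioi_mem_nhds hs)).hasDerivAt

theorem IsPressure.contDiffOn_deriv (hp : IsPressure p) : ContDiffOn ℝ 1 (deriv p) (Ioi 0) :=
  hp.contDiffOn.deriv_of_isOpen isOpen_Ioi (by norm_num)

theorem IsPressure.hasDerivAt_deriv (hp : IsPressure p) {s : ℝ} (hs : 0 < s) :
    HasDerivAt (deriv p) (deriv (deriv p) s) s :=
  ((hp.contDiffOn_deriv.differentiableOn (by norm_num)).differentiableAt
    (Ioi_mem_nhds hs)).hasDerivAt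

theorem IsPressure.continuousOn_deriv (hp : IsPressure p) : ContinuousOn (deriv p) (Ioi 0) :=
  hp.contDiffOn_deriv.continuousOn

theorem IsPressure.continuousOn_deriv2 (hp : IsPressure p) :
    ContinuousOn (deriv (deriv p)) (Ioi 0) :=
  hp.contDiffOn_deriv.continuousOn_deriv_of_isOpen isOpen_Ioi le_rfl

theorem IsPressure.strictMonoOn (hp : IsPressure p) : StrictMonoOn p (Ici 0) :=
  strictMonoOn_of_deriv_pos (convex_Ici 0) hp.continuousOn fun x hx =>
    hp.deriv_pos x (by simpa using hx)

theorem IsPressure.pos (hp : IsPressure p) {s : ℝ} (hs : 0 < s) : 0 < p s := by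
  have := hp.strictMonoOn (mem_Ici.2 le_rfl) (mem_Ici.2 hs.le) hs
  rwa [hp.map_zero] at this

theorem IsPressure.nonneg (hp : IsPressure p) {s : ℝ} (hs : 0 ≤ s) : 0 ≤ p s := by
  rcases hs.eq_or_lt with h | h
  · rw [← h, hp.map_zero]
  · exact (hp.pos h).le

theorem IsPressure.hasDerivAt_integral (hp : IsPressure p) {s : ℝ} (hs : 0 < s) :
    HasDerivAt (fun s => ∫ z in (1 : ℝ)..s, p z / z ^ 2) (p s / s ^ 2) s := by
  have hc : ContinuousOn (fun z => p z / z ^ 2) (Ioi 0) :=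
    (hp.continuousOn.mono Ioi_subset_Ici_self).div (by fun_prop)
      fun x hx => pow_ne_zero 2 (ne_of_gt hx)
  refine intervalIntegral.integral_hasDerivAt_right ?_ ?_ (hc.continuousAt (Ioi_mem_nhds hs))
  · refine (hc.mono fun z hz => ?_).intervalIntegrable
    exact lt_of_lt_of_le (lt_min one_pos hs) hz.1
  · exact hc.stronglyMeasurableAtFilter isOpen_Ioi s hs

theorem IsPressure.hasDerivAt_potential (hp : IsPressure p) {s : ℝ} (hs : 0 < s) :
    HasDerivAt (potential p) (deriv (potential p) s) s ∧
      deriv (potential p) s = (∫ z in (1 : ℝ)..s, p z / z ^ 2) + p s / s := by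
  have h := (hasDerivAt_id s).mul (hp.hasDerivAt_integral hs)
  have h' : HasDerivAt (potential p) ((∫ z in (1 : ℝ)..s, p z / z ^ 2) + p s / s) s := by
    refine h.congr_deriv ?_
    have := hs.ne'
    simp only [id]
    field_simp
  exact ⟨h'.differentiableAt.hasDerivAt, h'.deriv⟩

theorem IsPressure.hasDerivAt_deriv_potential (hp : IsPressure p) {s : ℝ} (hs : 0 < s) :
    HasDerivAt (deriv (potential p)) (deriv p s / s) s := by
  have h := (hp.hasDerivAt_integral hs).add ((hp.hasDerivAt hs).div (hasDerivAt_id s) hs.ne')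
  refine (h.congr_deriv ?_).congr_of_eventuallyEq ?_
  · have := hs.ne'
    simp only [id]
    field_simp
    ring
  · filter_upwards [Ioi_mem_nhds hs] with z hz
    simpa using (hp.hasDerivAt_potential hz).2

/-- This relation makes p(r) the part of the relative energy that involves neither density nor
momentum. -/
theorem IsPressure.mul_deriv_potential_sub (hp : IsPressure p) {s : ℝ} (hs : 0 < s) :
    s * deriv (potential p) s - potential p s = p s := by
  rw [(hp.hasDerivAt_potential hs).2, potential]
  have := hs.ne'
  field_simp
  ring

theorem IsPressure.continuousOn_potential (hp : IsPressure p) :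
    ContinuousOn (potential p) (Ioi 0) := fun _ hs =>
  (hp.hasDerivAt_potential hs).1.continuousAt.continuousWithinAt

theorem IsPressure.continuousOn_deriv_potential (hp : IsPressure p) :
    ContinuousOn (deriv (potential p)) (Ioi 0) := fun _ hs =>
  (hp.hasDerivAt_deriv_potential hs).continuousAt.continuousWithinAt

theorem potential_zero : potential p 0 = 0 := by simp [potential]

theorem uIcc_subset_Ioi {r s : ℝ} (hr : 0 < r) (hs : 0 < s) : uIcc r s ⊆ Ioi 0 :=
  fun _ hz => lt_of_lt_of_le (lt_min hr hs) hz.1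

/-- Convexity of the pressure potential. -/
theorem IsPressure.relPotential_nonneg (hp : IsPressure p) {r s : ℝ} (hr : 0 < r) (hs : 0 ≤ s) :
    0 ≤ potential p s - deriv (potential p) r * (s - r) - potential p r := by
  rcases hs.eq_or_lt with h | h
  -- P need not be differentiable at s = 0, so the Taylor bound is not available; there the
  -- expression is r P'(r) - P(r) = p(r).
  · rw [← h, potential_zero]
    have := hp.mul_deriv_potential_sub hr
    have := hp.pos hr
    linarith
  · have := taylor_lower_bound (c := 0) (r := r) (s := s)
      (fun z hz => (hp.hasDerivAt_potential (uIcc_subset_Ioi hr h hz)).1)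
      (fun z hz => hp.hasDerivAt_deriv_potential (uIcc_subset_Ioi hr h hz))
      (fun z hz => by
        have hz0 : 0 < z := uIcc_subset_Ioi hr h hz
        have := hp.deriv_pos z hz0
        simp only [mul_zero]
        positivity)
    linarith

set_option maxHeartbeats 1000000 in
/-- Coercivity of the relative pressure potential. -/
theorem IsPressure.coercive (hp : IsPressure p) {M : ℝ} (hM : 1 ≤ M) : ∃ C : ℝ, 0 < C ∧
    ∀ r ∈ Icc M⁻¹ M, ∀ s, 0 ≤ s →
      (|p s - deriv p r * (s - r) - p r|
        ≤ C * (potential p s - deriv (potential p) r * (s - r) - potential p r)) ∧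
      (s ≤ (2 * M)⁻¹ →
        1 ≤ C * (potential p s - deriv (potential p) r * (s - r) - potential p r)) ∧
      ((2 * M)⁻¹ ≤ s → s ≤ 2 * M →
        (s - r) ^ 2 ≤ C * (potential p s - deriv (potential p) r * (s - r) - potential p r)) ∧
      (2 * M ≤ s →
        s ≤ C * (potential p s - deriv (potential p) r * (s - r) - potential p r)) := by
  have hM0 : 0 < M := by linarith
  set a := (2 * M)⁻¹ with ha
  have ha0 : 0 < a := by positivity
  have haM : M⁻¹ = 2 * a := by rw [ha, mul_inv]; ring
  have hab : a ≤ 2 * M := by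
    have : a ≤ 1 := inv_le_one_of_one_le₀ (by linarith)
    linarith
  have hI : Icc a (2 * M) ⊆ Ioi 0 := fun z hz => lt_of_lt_of_le ha0 hz.1
  have hne : (Icc a (2 * M)).Nonempty := nonempty_Icc.2 hab
  -- The constant 2c₀ is the minimum of P''(z) = p'(z)/z on [1/(2M), 2M].
  obtain ⟨c₀, hc₀, hc₀'⟩ : ∃ c > 0, ∀ z ∈ Icc a (2 * M), 2 * c ≤ deriv p z / z := by
    have hc : ContinuousOn (fun z => deriv p z / z) (Icc a (2 * M)) :=
      (hp.continuousOn_deriv.mono hI).div continuousOn_id fun z hz => ne_of_gt (hI hz)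
    obtain ⟨z₀, hz₀, hmin⟩ := isCompact_Icc.exists_isMinOn hne hc
    refine ⟨deriv p z₀ / z₀ / 2, ?_, fun z hz => ?_⟩
    · have := hp.deriv_pos z₀ (hI hz₀)
      have h0 : 0 < z₀ := hI hz₀
      positivity
    · have := isMinOn_iff.1 hmin z hz
      linarith
  obtain ⟨K, hK⟩ := isCompact_Icc.exists_bound_of_continuousOn (hp.continuousOn_deriv2.mono hI)
  obtain ⟨B₁, hB₁⟩ := isCompact_Icc.exists_bound_of_continuousOn (hp.continuousOn_deriv.mono hI)
  obtain ⟨B₂, hB₂⟩ := isCompact_Icc.exists_bound_of_continuousOn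
    (hp.continuousOn_deriv_potential.mono hI)
  obtain ⟨B₃, hB₃⟩ := isCompact_Icc.exists_bound_of_continuousOn (hp.continuousOn_potential.mono hI)
  obtain ⟨B₄, hB₄⟩ := isCompact_Icc.exists_bound_of_continuousOn
    (hp.continuousOn.mono (hI.trans Ioi_subset_Ici_self))
  obtain ⟨c₁, hc₁, hev⟩ := hp.liminf_ratio
  obtain ⟨R₀, hR₀⟩ := eventually_atTop.1 hev
  have hamem : a ∈ Icc a (2 * M) := ⟨le_rfl, hab⟩
  have hnn : ∀ {f : ℝ → ℝ} {B : ℝ}, (∀ z ∈ Icc a (2 * M), ‖f z‖ ≤ B) → 0 ≤ B :=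
    fun h => (norm_nonneg _).trans (h a hamem)
  have hK0 := hnn hK
  have hB₁0 := hnn hB₁
  have hB₂0 := hnn hB₂
  have hB₃0 := hnn hB₃
  have hB₄0 := hnn hB₄
  -- Beyond R the condition on P/p bounds the pressure by the potential; between 2M and R
  -- monotonicity bounds it by p(R).
  set R := max R₀ (2 * M) with hR
  have hRM : 2 * M ≤ R := le_max_right _ _
  have hpR : 0 ≤ p R := hp.nonneg (by linarith)
  set c₂ := min (c₀ * a ^ 2) (p a) with hc₂
  have hc₂0 : 0 < c₂ := lt_min (by positivity) (hp.pos ha0)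
  -- k₁ serves s ≤ 1/(2M), where H ≥ c₂. k₂ serves the middle range and everything that grows
  -- linearly in s. The summand 1/c₁ of the final constant serves the pressure at large s.
  set k₁ := (1 + (B₄ + B₁ * M + B₄)) / c₂ with hk₁
  set k₂ := (1 + K + p R + (B₂ + B₃) / c₁ + B₁ + B₄) * (2 / c₀) with hk₂
  have hk₁0 : 0 ≤ k₁ := by positivity
  have hk₂0 : 0 ≤ k₂ := by positivity
  have hc₁' : 0 < 1 / c₁ := by positivity
  refine ⟨k₁ + k₂ + 1 / c₁, by linarith, fun r hr s hs => ?_⟩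
  have hr0 : 0 < r := lt_of_lt_of_le (by positivity) hr.1
  rw [haM] at hr
  have hrI : r ∈ Icc a (2 * M) := ⟨by linarith [hr.1], by linarith [hr.2]⟩
  have hH := hp.relPotential_nonneg hr0 hs
  have tay : ∀ {x y c : ℝ}, 0 < x → 0 < y → (∀ z ∈ uIcc x y, 2 * c ≤ deriv p z / z) →
      c * (y - x) ^ 2 ≤ potential p y - potential p x - deriv (potential p) x * (y - x) :=
    fun hx hy h => taylor_lower_bound
      (fun z hz => (hp.hasDerivAt_potential (uIcc_subset_Ioi hx hy hz)).1)
      (fun z hz => hp.hasDerivAt_deriv_potential (uIcc_subset_Ioi hx hy hz)) h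
  have tayI : ∀ {x y : ℝ}, x ∈ Icc a (2 * M) → y ∈ Icc a (2 * M) →
      c₀ * (y - x) ^ 2 ≤ potential p y - potential p x - deriv (potential p) x * (y - x) :=
    fun hx hy => tay (hI hx) (hI hy) fun z hz => hc₀' z (uIcc_subset_Icc hx hy hz)
  have b₁ := abs_le.1 (hB₁ r hrI)
  have b₂ := abs_le.1 (hB₂ r hrI)
  have b₃ := abs_le.1 (hB₃ r hrI)
  have b₄ := abs_le.1 (hB₄ r hrI)
  have hpr := hp.pos hr0
  have hps := hp.nonneg hs
  set H := potential p s - deriv (potential p) r * (s - r) - potential p r with hHdef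
  have hmono : ∀ {k X : ℝ}, k ≤ k₁ + k₂ + 1 / c₁ → X ≤ k * H → X ≤ (k₁ + k₂ + 1 / c₁) * H :=
    fun hk hX => hX.trans (mul_le_mul_of_nonneg_right hk hH)
  -- Convexity in two stages: P lies above its tangent at a, and P'(a) ≤ P'(r) because a < r. So H
  -- at s is at least H at a, which is at least c₀(a - r)² ≥ c₀a², since r ≥ 1/M = 2a. The point s =
  -- 0 is again separate.
  have hsmall : s ≤ a → c₂ ≤ H := by
    intro hsa
    rcases hs.eq_or_lt with h | h
    · have h1 := hp.mul_deriv_potential_sub hr0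
      have h2 := hp.strictMonoOn.monotoneOn (mem_Ici.2 ha0.le) (mem_Ici.2 hr0.le) hrI.1
      have : H = p r := by rw [hHdef, ← h, potential_zero]; linarith
      rw [this]
      exact (min_le_right _ _).trans h2
    · have h1 := hp.relPotential_nonneg ha0 hs
      have h2 := tayI hrI hamem
      have h3 := tayI hamem hrI
      have h4 : (deriv (potential p) r - deriv (potential p) a) * (r - a) ≥ 0 := by
        have e : (deriv (potential p) r - deriv (potential p) a) * (r - a)
          = -(deriv (potential p) r * (a - r)) - deriv (potential p) a * (r - a) := by ring
        rw [ge_iff_le, e]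
        linarith [mul_nonneg hc₀.le (sq_nonneg (a - r)), mul_nonneg hc₀.le (sq_nonneg (r - a))]
      have h5 : 0 ≤ deriv (potential p) r - deriv (potential p) a :=
        nonneg_of_mul_nonneg_left h4 (by linarith [hr.1])
      have h6 := mul_nonneg h5 (sub_nonneg.2 hsa)
      have h7 : c₀ * a ^ 2 ≤ c₀ * (a - r) ^ 2 := by
        refine mul_le_mul_of_nonneg_left ?_ hc₀.le
        have : a ≤ r - a := by linarith [hr.1]
        calc a ^ 2 ≤ (r - a) ^ 2 := pow_le_pow_left₀ ha0.le this 2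
          _ = (a - r) ^ 2 := by ring
      refine (min_le_left _ _).trans ?_
      rw [hHdef]
      linarith
  have hmid : a ≤ s → s ≤ 2 * M → c₀ * (s - r) ^ 2 ≤ H := by
    intro h1 h2
    have := tayI hrI ⟨h1, h2⟩
    rw [hHdef]; linarith
  -- Above 2M the potential lies over its tangent there, and adding two Taylor bounds gives P'(2M) -
  -- P'(r) ≥ 2c₀(2M - r) with 2M - r ≥ 1. Hence H ≥ c₀(s - r), and s - r ≥ s/2 because s ≥ 2r.
  have hlarge : 2 * M ≤ s → s ≤ 2 / c₀ * H := by
    intro h1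
    have hbmem : 2 * M ∈ Icc a (2 * M) := ⟨hab, le_rfl⟩
    have h2 := hp.relPotential_nonneg (by linarith : 0 < 2 * M) hs
    have h3 := tayI hrI hbmem
    have h4 := tayI hbmem hrI
    have h5 : 2 * c₀ * (2 * M - r) ≤ deriv (potential p) (2 * M) - deriv (potential p) r := by
      have : 0 < 2 * M - r := by linarith [hr.2]
      refine le_of_mul_le_mul_right ?_ this
      linarith
    have h6 := mul_le_mul_of_nonneg_right h5 (sub_nonneg.2 h1)
    have h7 : c₀ * (2 * M - r) ^ 2 + 2 * c₀ * (2 * M - r) * (s - 2 * M) ≤ H := by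
      rw [hHdef]; linarith
    have h8 : c₀ * (s - r) ≤ c₀ * (2 * M - r) ^ 2 + 2 * c₀ * (2 * M - r) * (s - 2 * M) := by
      have h9 : 1 ≤ 2 * M - r := by linarith [hr.2]
      have h10 : s - r ≤ (2 * M - r) ^ 2 + 2 * (2 * M - r) * (s - 2 * M) := by
        have h11 : 2 * M - r ≤ (2 * M - r) ^ 2 := le_self_pow₀ h9 two_ne_zero
        have h12 : s - 2 * M ≤ (2 * M - r) * (s - 2 * M) :=
          le_mul_of_one_le_left (by linarith) h9
        linarith
      have h13 := mul_le_mul_of_nonneg_left h10 hc₀.le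
      linarith
    rw [div_mul_eq_mul_div, le_div_iff₀ hc₀]
    have h11 : c₀ * (2 * r) ≤ c₀ * s := mul_le_mul_of_nonneg_left (by linarith [hr.2]) hc₀.le
    linarith
  have hk₁' : ∀ X, 0 ≤ X → X ≤ 1 + (B₄ + B₁ * M + B₄) → s ≤ a → X ≤ k₁ * H := by
    intro X hX0 hX hsa
    have := hsmall hsa
    rw [hk₁, div_mul_eq_mul_div, le_div_iff₀ hc₂0]
    exact mul_le_mul hX this hc₂0.le (by positivity)
  refine ⟨?_, fun hsa => ?_, fun h1 h2 => ?_, fun h1 => ?_⟩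
  · rcases le_or_gt s a with hsa | hsa
    · refine hmono (by linarith : k₁ ≤ _) (hk₁' _ (abs_nonneg _) ?_ hsa)
      have h1 : p s ≤ B₄ := (hp.strictMonoOn.monotoneOn (mem_Ici.2 hs) (mem_Ici.2 ha0.le) hsa).trans
        ((le_abs_self _).trans (hB₄ a hamem))
      have h2 : |deriv p r * (s - r)| ≤ B₁ * M := by
        rw [abs_mul]
        refine mul_le_mul (hB₁ r hrI) (abs_le.2 ⟨by linarith [hr.2], by linarith [hr.1]⟩)
          (abs_nonneg _) hB₁0
      have h3 := abs_le.1 h2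
      exact abs_le.2 ⟨by linarith, by linarith⟩
    rcases le_or_gt s (2 * M) with hsb | hsb
    · have h1 := hmid hsa.le hsb
      have hsub : uIcc r s ⊆ Icc a (2 * M) := uIcc_subset_Icc hrI ⟨hsa.le, hsb⟩
      -- Taylor's lower bound for p and for -p, with |p''| ≤ K, gives a two-sided quadratic bound.
      have h2 := taylor_lower_bound (c := -K) (r := r) (s := s)
        (fun z hz => hp.hasDerivAt (hI (hsub hz))) (fun z hz => hp.hasDerivAt_deriv (hI (hsub hz)))
        (fun z hz => by linarith [(abs_le.1 (hK z (hsub hz))).1])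
      have h3 := taylor_lower_bound (c := -K) (r := r) (s := s) (f := fun z => -p z)
        (f' := fun z => -deriv p z) (f'' := fun z => -deriv (deriv p) z)
        (fun z hz => (hp.hasDerivAt (hI (hsub hz))).neg)
        (fun z hz => (hp.hasDerivAt_deriv (hI (hsub hz))).neg)
        (fun z hz => by linarith [(abs_le.1 (hK z (hsub hz))).2])
      have h4 : |p s - deriv p r * (s - r) - p r| ≤ K * (s - r) ^ 2 :=
        abs_le.2 ⟨by linarith, by linarith⟩
      refine hmono (k := K / c₀) ?_ (h4.trans ?_)
      · have : K / c₀ ≤ k₂ := by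
          rw [hk₂, div_eq_mul_one_div]
          have : 1 / c₀ ≤ 2 / c₀ := by gcongr; norm_num
          refine mul_le_mul ?_ this (by positivity) (by positivity)
          have : 0 ≤ (B₂ + B₃) / c₁ := by positivity
          linarith
        linarith
      · rw [div_mul_eq_mul_div, le_div_iff₀ hc₀, mul_assoc, mul_comm _ c₀]
        exact mul_le_mul_of_nonneg_left h1 hK0
    · have hsl := hlarge hsb.le
      have hs1 : 1 ≤ s := by linarith
      have hsr0 : 0 ≤ s - r := by linarith [hr.2]
      have hsr : s - r ≤ s := by linarith
      -- For s > R one has c₁ p(s) ≤ P(s), and P(s) exceeds H only by P'(r)(s - r) + P(r), which is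
      -- at most linear in s.
      have hps' : p s ≤ (p R + (B₂ + B₃) / c₁) * s + 1 / c₁ * H := by
        have hn : 0 ≤ (B₂ + B₃) / c₁ := by positivity
        have hn' : 0 ≤ 1 / c₁ * H := by positivity
        rcases le_or_gt s R with hsR | hsR
        · have := hp.strictMonoOn.monotoneOn (mem_Ici.2 hs) (mem_Ici.2 (by linarith)) hsR
          have h2 : p R ≤ p R * s := le_mul_of_one_le_right hpR hs1
          have h3 : 0 ≤ (B₂ + B₃) / c₁ * s := mul_nonneg hn hs
          linarith
        · have h1 := hR₀ s ((le_max_left _ _).trans hsR.le)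
          have hps0 := hp.pos (by linarith : 0 < s)
          rw [le_div_iff₀ hps0] at h1
          have h2 : potential p s ≤ H + (B₂ + B₃) * s := by
            have h3 : deriv (potential p) r * (s - r) ≤ B₂ * s :=
              mul_le_mul b₂.2 hsr hsr0 hB₂0
            have h4 : B₃ ≤ B₃ * s := le_mul_of_one_le_right hB₃0 hs1
            rw [hHdef]
            linarith [b₃.2]
          have h3 : p s ≤ (H + (B₂ + B₃) * s) / c₁ := by
            rw [le_div_iff₀ hc₁]; linarith
          have h4 : (H + (B₂ + B₃) * s) / c₁ = (B₂ + B₃) / c₁ * s + 1 / c₁ * H := by ring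
          have h5 : 0 ≤ p R * s := mul_nonneg hpR hs
          linarith
      have h5 : |p s - deriv p r * (s - r) - p r|
          ≤ (p R + (B₂ + B₃) / c₁ + B₁ + B₄) * s + 1 / c₁ * H := by
        have h6 : deriv p r * (s - r) ≤ B₁ * s := mul_le_mul b₁.2 hsr hsr0 hB₁0
        have h7 : 0 ≤ deriv p r * (s - r) :=
          mul_nonneg (hp.deriv_pos r hr0).le hsr0
        have h8 : B₄ ≤ B₄ * s := le_mul_of_one_le_right hB₄0 hs1
        have h9 : 0 ≤ B₁ * s := by positivity
        have h10 : 0 ≤ (p R + (B₂ + B₃) / c₁) * s := by positivity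
        have h11 : 0 ≤ 1 / c₁ * H := by positivity
        exact abs_le.2 ⟨by linarith, by linarith⟩
      have h12 : (p R + (B₂ + B₃) / c₁ + B₁ + B₄) * s ≤ k₂ * H := by
        rw [hk₂, mul_assoc]
        refine mul_le_mul ?_ hsl hs (by positivity)
        linarith
      have h13 := mul_nonneg hk₁0 hH
      linarith
  · exact hmono (by linarith : k₁ ≤ _) (hk₁' 1 zero_le_one
      (by linarith [mul_nonneg hB₁0 hM0.le]) hsa)
  · refine hmono (k := 2 / c₀) ?_ ?_
    · have : 1 * (2 / c₀) ≤ k₂ := by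
        rw [hk₂]
        refine mul_le_mul_of_nonneg_right ?_ (by positivity)
        have : 0 ≤ (B₂ + B₃) / c₁ := by positivity
        linarith
      linarith
    · rw [div_mul_eq_mul_div, le_div_iff₀ hc₀]
      linarith [hmid h1 h2]
  · refine hmono (k := 2 / c₀) ?_ (hlarge h1)
    have : 1 * (2 / c₀) ≤ k₂ := by
      rw [hk₂]
      refine mul_le_mul_of_nonneg_right ?_ (by positivity)
      have : 0 ≤ (B₂ + B₃) / c₁ := by positivity
      linarith
    linarith

end Pressure

/-! ### Integrals over time and Grönwall's inequality -/

theorem ae_uIoc_of_ae_timeMeasure {T τ : ℝ} (hτ : τ ∈ Icc 0 T) {P : ℝ → Prop}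
    (h : ∀ᵐ t ∂timeMeasure T, P t) : ∀ᵐ t, t ∈ Ioc 0 τ → P t := by
  rw [timeMeasure, ae_restrict_iff' measurableSet_Ioo] at h
  have h2 : ∀ᵐ t : ℝ, t ≠ T := by simp [ae_iff, measure_singleton]
  filter_upwards [h, h2] with t ht hne hmem
  exact ht ⟨hmem.1, lt_of_le_of_ne (hmem.2.trans hτ.2) hne⟩

theorem restrict_Ioc_le_timeMeasure {T τ : ℝ} (hτ : τ ∈ Icc 0 T) :
    volume.restrict (Ioc 0 τ) ≤ timeMeasure T := by
  rw [timeMeasure, ← restrict_Ioo_eq_restrict_Ioc]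
  exact Measure.restrict_mono (Ioo_subset_Ioo_right hτ.2) le_rfl

theorem intervalIntegrable_of_timeMeasure {E : Type*} [NormedAddCommGroup E] {T τ : ℝ}
    (hτ : τ ∈ Icc 0 T) {f : ℝ → E} (h : Integrable f (timeMeasure T)) :
    IntervalIntegrable f volume 0 τ := by
  rw [intervalIntegrable_iff_integrableOn_Ioc_of_le hτ.1]
  exact h.mono_measure (restrict_Ioc_le_timeMeasure hτ)

theorem intervalIntegral_mono_timeMeasure {T τ : ℝ} (hτ : τ ∈ Icc 0 T) {f g : ℝ → ℝ}
    (hf : Integrable f (timeMeasure T)) (hg : Integrable g (timeMeasure T))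
    (h : ∀ᵐ t ∂timeMeasure T, f t ≤ g t) : ∫ t in (0 : ℝ)..τ, f t ≤ ∫ t in (0 : ℝ)..τ, g t := by
  rw [intervalIntegral.integral_of_le hτ.1, intervalIntegral.integral_of_le hτ.1]
  refine integral_mono_ae (hf.mono_measure (restrict_Ioc_le_timeMeasure hτ))
    (hg.mono_measure (restrict_Ioc_le_timeMeasure hτ)) ?_
  exact ae_mono (restrict_Ioc_le_timeMeasure hτ) h

/-- Composition with a 1-Lipschitz map keeps absolute continuity; the case needed is exp(-A) with A
nonnegative. -/
theorem _root_.AbsolutelyContinuousOnInterval.of_dist_le {f g : ℝ → ℝ} {a b : ℝ}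
    (hf : AbsolutelyContinuousOnInterval f a b)
    (h : ∀ x ∈ uIcc a b, ∀ y ∈ uIcc a b, dist (g x) (g y) ≤ dist (f x) (f y)) :
    AbsolutelyContinuousOnInterval g a b := by
  rw [absolutelyContinuousOnInterval_iff] at hf ⊢
  intro ε hε
  obtain ⟨δ, hδ, H⟩ := hf ε hε
  refine ⟨δ, hδ, fun E hE hlt => lt_of_le_of_lt ?_ (H E hE hlt)⟩
  exact Finset.sum_le_sum fun i hi => h _ (hE.1 i hi).1 _ (hE.1 i hi).2

theorem abs_exp_neg_sub_exp_neg_le {x y : ℝ} (hx : 0 ≤ x) (hy : 0 ≤ y) :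
    |Real.exp (-x) - Real.exp (-y)| ≤ |x - y| := by
  wlog h : x ≤ y generalizing x y
  · rw [abs_sub_comm, abs_sub_comm x]
    exact this hy hx (by linarith)
  have h1 : Real.exp (-y) = Real.exp (-x) * Real.exp (-(y - x)) := by
    rw [← Real.exp_add]; ring_nf
  have h2 := Real.add_one_le_exp (-(y - x))
  have h3 : Real.exp (-x) ≤ 1 := Real.exp_le_one_iff.2 (by linarith)
  have h4 : Real.exp (-(y - x)) ≤ 1 := Real.exp_le_one_iff.2 (by linarith)
  have h5 := Real.exp_pos (-x)
  rw [abs_of_nonneg (by rw [h1]; nlinarith), abs_of_nonpos (by linarith), h1]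
  nlinarith

/-- Grönwall's inequality with an integrable coefficient. -/
theorem gronwall_of_integrable {T E₀ : ℝ} {F h : ℝ → ℝ}
    (hh : Integrable h (timeMeasure T)) (hh0 : ∀ᵐ t ∂timeMeasure T, 0 ≤ h t)
    (hhF : Integrable (fun t => h t * F t) (timeMeasure T))
    (hF : ∀ᵐ τ ∂timeMeasure T, F τ ≤ E₀ + ∫ t in (0 : ℝ)..τ, h t * F t) :
    ∀ᵐ τ ∂timeMeasure T, F τ ≤ E₀ * Real.exp (∫ t in (0 : ℝ)..τ, h t) := by
  have hmem : ∀ᵐ τ ∂timeMeasure T, τ ∈ Ioo 0 T := ae_restrict_mem measurableSet_Ioo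
  filter_upwards [hF, hmem] with τ hFτ hτ
  have hτ' : τ ∈ Icc 0 T := Ioo_subset_Icc_self hτ
  have hτ0 : 0 ≤ τ := hτ.1.le
  have i1 := intervalIntegrable_of_timeMeasure hτ' hh
  have i2 := intervalIntegrable_of_timeMeasure hτ' hhF
  have hnn : ∀ᵐ t, t ∈ Ioc 0 τ → 0 ≤ h t := ae_uIoc_of_ae_timeMeasure hτ' hh0
  set A : ℝ → ℝ := fun t => ∫ s in (0 : ℝ)..t, h s with hA
  set G : ℝ → ℝ := fun t => E₀ + ∫ s in (0 : ℝ)..t, h s * F s with hG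
  have hA0 : ∀ t ∈ uIcc 0 τ, 0 ≤ A t := by
    intro t ht
    rw [uIcc_of_le hτ0] at ht
    refine intervalIntegral.integral_nonneg_of_ae_restrict ht.1 ?_
    rw [← restrict_Ioc_eq_restrict_Icc]
    refine (ae_restrict_iff' measurableSet_Ioc).2 ?_
    filter_upwards [hnn] with s hs hs'
    exact hs ⟨hs'.1, hs'.2.trans ht.2⟩
  have acA : AbsolutelyContinuousOnInterval A 0 τ :=
    i1.absolutelyContinuousOnInterval_intervalIntegral (by simp)
  have acW : AbsolutelyContinuousOnInterval (fun t => Real.exp (-A t)) 0 τ :=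
    acA.of_dist_le fun x hx y hy => abs_exp_neg_sub_exp_neg_le (hA0 x hx) (hA0 y hy)
  have acG : AbsolutelyContinuousOnInterval G 0 τ := by
    have hc : AbsolutelyContinuousOnInterval (fun _ : ℝ => E₀) 0 τ :=
      acA.of_dist_le fun x hx y hy => by simp
    exact hc.fun_add (i2.absolutelyContinuousOnInterval_intervalIntegral (by simp))
  -- The weight is merely integrable, so G and A are differentiable only almost everywhere. The
  -- monotonicity of G exp(-A) comes from the integrated product rule for absolutely continuous
  -- functions: its derivative is h (F - G) exp(-A) ≤ 0 a.e.
  have hsub := acG.integral_deriv_mul_eq_sub acW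
  have hle : ∫ x in (0 : ℝ)..τ, deriv G x * Real.exp (-A x)
      + G x * deriv (fun t => Real.exp (-A t)) x ≤ 0 := by
    rw [← neg_nonneg, ← intervalIntegral.integral_neg]
    refine intervalIntegral.integral_nonneg_of_ae_restrict hτ0 ?_
    rw [← restrict_Ioc_eq_restrict_Icc]
    refine (ae_restrict_iff' measurableSet_Ioc).2 ?_
    filter_upwards [hnn, i1.ae_hasDerivAt_integral, i2.ae_hasDerivAt_integral,
      ae_uIoc_of_ae_timeMeasure hτ' hF] with t h1 h2 h3 h4 ht
    have htm : t ∈ uIcc 0 τ := by rw [uIcc_of_le hτ0]; exact Ioc_subset_Icc_self ht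
    have d1 : HasDerivAt A (h t) t := h2 htm 0 (by simp)
    have d2 : HasDerivAt G (h t * F t) t := (h3 htm 0 (by simp)).const_add E₀
    have d3 : HasDerivAt (fun t => Real.exp (-A t)) (Real.exp (-A t) * -h t) t := d1.neg.exp
    rw [d2.deriv, d3.deriv]
    have h5 : F t ≤ G t := h4 ht
    have h6 := mul_nonneg (mul_nonneg (h1 ht) (Real.exp_pos (-A t)).le) (sub_nonneg.2 h5)
    simp only [Pi.zero_apply]
    linarith
  rw [hsub] at hle
  have hA0' : A 0 = 0 := by simp [hA]
  have hG0 : G 0 = E₀ := by simp [hG]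
  rw [hA0', hG0] at hle
  simp only [neg_zero, Real.exp_zero, mul_one] at hle
  have h7 : G τ ≤ E₀ * Real.exp (A τ) := by
    have h8 : G τ * Real.exp (-A τ) ≤ E₀ := by linarith
    rwa [Real.exp_neg, ← div_eq_mul_inv, div_le_iff₀ (Real.exp_pos _)] at h8
  exact hFτ.trans h7

/-! ### Steklov averages and approximation of the strong velocity -/

/-- Translations act continuously on L¹; continuity at the shift 0 is the claim. -/
theorem tendsto_lintegral_translate_sub {E : Type*} [NormedAddCommGroup E] {f : ℝ → E}
    (hf : Integrable f) : Tendsto (fun a => ∫⁻ t, ‖f (a + t) - f t‖ₑ) (𝓝 0) (𝓝 0) := by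
  have hf1 : MemLp f 1 volume := memLp_one_iff_integrable.2 hf
  have hfa : ∀ a : ℝ, MemLp (fun t => f (a + t)) 1 volume := fun a =>
    hf1.comp_measurePreserving (measurePreserving_add_left volume a)
  have : Fact ((1 : ENNReal) ≠ ⊤) := ⟨by simp⟩
  have hc : Continuous fun a : ℝ => DomAddAct.mk a +ᵥ hf1.toLp f := by
    have h1 : Continuous fun a : ℝ => (DomAddAct.mk a : ℝᵈᵃᵃ) := DomAddAct.continuous_mk
    exact h1.vadd continuous_const
  have hl : Tendsto (fun a : ℝ => (hfa a).toLp (fun t => f (a + t))) (𝓝 0)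
      (𝓝 (hf1.toLp f)) := by
    have h0 := hc.tendsto 0
    simp only [DomAddAct.mk_vadd_toLp] at h0
    convert h0 using 2
    congr 1
    ext
    simp
  have := (Lp.tendsto_Lp_iff_tendsto_eLpNorm'' _ hfa f hf1).1 hl
  simpa [eLpNorm_one_eq_lintegral_enorm] using this

/-- Steklov averages converge in `L^1`. -/
theorem tendsto_lintegral_steklov {E : Type*} [NormedAddCommGroup E] [NormedSpace ℝ E]
    [CompleteSpace E] {f : ℝ → E} (hf : Integrable f) (hm : StronglyMeasurable f) :
    Tendsto (fun h => ∫⁻ t, ‖h⁻¹ • (∫ s in t..t + h, f s) - f t‖ₑ) (𝓝[>] 0) (𝓝 0) := by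
  rw [ENNReal.tendsto_nhds_zero]
  intro ε hε
  have h1 := (ENNReal.tendsto_nhds_zero.1 (tendsto_lintegral_translate_sub hf)) ε hε
  obtain ⟨δ, hδ, hball⟩ := Metric.eventually_nhds_iff.1 h1
  filter_upwards [Ioo_mem_nhdsGT hδ] with h hh
  have hh0 : 0 < h := hh.1
  -- The error of the average is the mean of the increments f(σ + t) - f(t) over σ in (0, h).
  -- Exchanging integrals then bounds its L¹ norm by that of one small translation.
  have hpt : ∀ t, ‖h⁻¹ • (∫ s in t..t + h, f s) - f t‖ₑ
      ≤ ENNReal.ofReal h⁻¹ * ∫⁻ σ in Ioc 0 h, ‖f (σ + t) - f t‖ₑ := by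
    intro t
    have i1 : IntervalIntegrable (fun σ => f (σ + t)) volume 0 h :=
      (hf.comp_add_right t).intervalIntegrable
    have e1 : h⁻¹ • (∫ s in t..t + h, f s) - f t = h⁻¹ • ∫ σ in (0 : ℝ)..h, (f (σ + t) - f t) := by
      rw [intervalIntegral.integral_sub i1 (by simp),
        intervalIntegral.integral_comp_add_right (fun s => f s)]
      simp [smul_sub, smul_smul, inv_mul_cancel₀ hh0.ne', add_comm]
    rw [e1, enorm_smul, intervalIntegral.integral_of_le hh0.le]
    refine mul_le_mul' (le_of_eq ?_) (enorm_integral_le_lintegral_enorm _)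
    rw [Real.enorm_eq_ofReal (by positivity)]
  calc ∫⁻ t, ‖h⁻¹ • (∫ s in t..t + h, f s) - f t‖ₑ
      ≤ ∫⁻ t, ENNReal.ofReal h⁻¹ * ∫⁻ σ in Ioc 0 h, ‖f (σ + t) - f t‖ₑ := lintegral_mono hpt
    _ = ENNReal.ofReal h⁻¹ * ∫⁻ t, ∫⁻ σ in Ioc 0 h, ‖f (σ + t) - f t‖ₑ :=
        lintegral_const_mul' _ _ ENNReal.ofReal_ne_top
    _ = ENNReal.ofReal h⁻¹ * ∫⁻ σ in Ioc 0 h, ∫⁻ t, ‖f (σ + t) - f t‖ₑ := by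
        rw [lintegral_lintegral_swap]
        refine StronglyMeasurable.aestronglyMeasurable ?_ |>.enorm
        exact (hm.comp_measurable (measurable_snd.add measurable_fst)).sub
          (hm.comp_measurable measurable_fst)
    _ ≤ ENNReal.ofReal h⁻¹ * ∫⁻ σ in Ioc 0 h, ε := by
        refine mul_le_mul' le_rfl (setLIntegral_mono' measurableSet_Ioc fun σ hσ => hball ?_)
        rw [Real.dist_eq, sub_zero, abs_of_pos hσ.1]
        exact hσ.2.trans_lt hh.2
    _ = ε := by
        rw [setLIntegral_const, Real.volume_Ioc, sub_zero, mul_comm ε, ← mul_assoc,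
          ← ENNReal.ofReal_mul (by positivity), inv_mul_cancel₀ hh0.ne']
        simp

/-- The Steklov average in time of a space-time function. -/
def steklov {E : Type*} [NormedAddCommGroup E] [NormedSpace ℝ E] (h : ℝ) (Φ : ℝ → Vec N → E)
    (t : ℝ) (x : Vec N) : E := h⁻¹ • ∫ s in t..t + h, Φ s x

section Steklov

variable {E : Type*} [NormedAddCommGroup E] [NormedSpace ℝ E] {Φ : ℝ → Vec N → E}

theorem continuous_steklov (hΦ : Continuous fun q : ℝ × Vec N => Φ q.1 q.2) (h : ℝ) :
    Continuous fun q : ℝ × Vec N => steklov h Φ q.1 q.2 := by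
  have hs : ∀ x, Continuous fun s => Φ s x := fun x =>
    hΦ.comp (continuous_id.prodMk continuous_const)
  have e1 : (fun q : ℝ × Vec N => steklov h Φ q.1 q.2) = fun q : ℝ × Vec N =>
      h⁻¹ • ((∫ s in (0 : ℝ)..q.1 + h, Φ s q.2) - ∫ s in (0 : ℝ)..q.1, Φ s q.2) := by
    ext q
    rw [steklov, intervalIntegral.integral_interval_sub_left]
    · exact (hs _).intervalIntegrable _ _
    · exact (hs _).intervalIntegrable _ _
  rw [e1]
  have hf : Continuous (Function.uncurry fun (q : ℝ × Vec N) (s : ℝ) => Φ s q.2) :=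
    hΦ.comp (continuous_snd.prodMk (continuous_snd.comp continuous_fst))
  exact ((intervalIntegral.continuous_parametric_intervalIntegral_of_continuous hf
    (continuous_fst.add continuous_const)).sub
    (intervalIntegral.continuous_parametric_intervalIntegral_of_continuous hf
      continuous_fst)).const_smul _

theorem hasDerivAt_steklov [CompleteSpace E] (hΦ : Continuous fun q : ℝ × Vec N => Φ q.1 q.2)
    (h t : ℝ) (x : Vec N) :
    HasDerivAt (fun t => steklov h Φ t x) (h⁻¹ • (Φ (t + h) x - Φ t x)) t := by
  have hs : Continuous fun s => Φ s x := hΦ.comp (continuous_id.prodMk continuous_const)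
  have hd : ∀ t, HasDerivAt (fun t => ∫ s in (0 : ℝ)..t, Φ s x) (Φ t x) t := fun t =>
    intervalIntegral.integral_hasDerivAt_right (hs.intervalIntegrable _ _)
      hs.stronglyMeasurable.stronglyMeasurableAtFilter hs.continuousAt
  have e1 : (fun t => steklov h Φ t x) = fun t =>
      h⁻¹ • ((∫ s in (0 : ℝ)..t + h, Φ s x) - ∫ s in (0 : ℝ)..t, Φ s x) := by
    ext t
    rw [steklov, intervalIntegral.integral_interval_sub_left] <;>
      exact hs.intervalIntegrable _ _
  rw [e1]
  exact (((hd (t + h)).comp_add_const t h).sub (hd t)).const_smul _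

theorem norm_steklov_le {h : ℝ} (hh : 0 < h) {t : ℝ} {x : Vec N} {C : ℝ}
    (hC : ∀ s, ‖Φ s x‖ ≤ C) : ‖steklov h Φ t x‖ ≤ C := by
  have := intervalIntegral.norm_integral_le_of_norm_le_const (a := t) (b := t + h)
    (f := fun s => Φ s x) (C := C) fun s _ => hC s
  rw [add_sub_cancel_left, abs_of_pos hh] at this
  rw [steklov, norm_smul, norm_inv, Real.norm_of_nonneg hh.le, inv_mul_le_iff₀ hh]
  linarith

theorem steklov_eq_zero {h t : ℝ} {x : Vec N} (h0 : ∀ s, Φ s x = 0) : steklov h Φ t x = 0 := by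
  simp [steklov, h0]

theorem tendsto_steklov [CompleteSpace E] (hΦ : Continuous fun q : ℝ × Vec N => Φ q.1 q.2)
    (t : ℝ) (x : Vec N) : Tendsto (fun h => steklov h Φ t x) (𝓝[>] 0) (𝓝 (Φ t x)) := by
  have hs : Continuous fun s => Φ s x := hΦ.comp (continuous_id.prodMk continuous_const)
  have hd : HasDerivAt (fun b => ∫ s in t..b, Φ s x) (Φ t x) t :=
    intervalIntegral.integral_hasDerivAt_right (hs.intervalIntegrable _ _)
      hs.stronglyMeasurable.stronglyMeasurableAtFilter hs.continuousAt
  have := hd.tendsto_slope_zero_right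
  simpa [steklov] using this

theorem hasFDerivAt_steklov [CompleteSpace E] {Γ : ℝ → Vec N → (Vec N →L[ℝ] E)}
    (hΦ : Continuous fun q : ℝ × Vec N => Φ q.1 q.2)
    (hΓ : Continuous fun q : ℝ × Vec N => Γ q.1 q.2) {Ω : Set (Vec N)} (hΩ : IsOpen Ω)
    (hd : ∀ s, ∀ x ∈ Ω, HasFDerivAt (Φ s) (Γ s x) x) {h : ℝ} {t : ℝ} {x : Vec N} (hx : x ∈ Ω) :
    HasFDerivAt (steklov h Φ t) (steklov h Γ t x) x := by
  obtain ⟨δ, hδ, hball⟩ := Metric.nhds_basis_closedBall.mem_iff.1 (hΩ.mem_nhds hx)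
  obtain ⟨C, hC⟩ := (isCompact_uIcc.prod (isCompact_closedBall x δ)).exists_bound_of_continuousOn
    (f := fun q : ℝ × Vec N => Γ q.1 q.2) (s := uIcc t (t + h) ×ˢ Metric.closedBall x δ)
    hΓ.continuousOn
  have hs : ∀ x, Continuous fun s => Φ s x := fun x =>
    hΦ.comp (continuous_id.prodMk continuous_const)
  have hsΓ : ∀ x, Continuous fun s => Γ s x := fun x =>
    hΓ.comp (continuous_id.prodMk continuous_const)
  have key := intervalIntegral.hasFDerivAt_integral_of_dominated_of_fderiv_le (𝕜 := ℝ)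
    (μ := volume) (a := t) (b := t + h) (F := fun x s => Φ s x) (F' := fun x s => Γ s x) (x₀ := x)
    (bound := fun _ => C) (Metric.closedBall_mem_nhds x hδ)
    (Eventually.of_forall fun y => (hs y).aestronglyMeasurable)
    ((hs x).intervalIntegrable _ _) (hsΓ x).aestronglyMeasurable
    (Eventually.of_forall fun s hs y hy => hC (s, y) ⟨uIoc_subset_uIcc hs, hy⟩)
    (by simp) (Eventually.of_forall fun s _ y hy => hd s y (hball hy))
  exact key.const_smul _

/-- A continuous function on `[0,T] × K`, with `K` closed, extends to a continuous function that is
constant in time outside of `[0,T]` over `K`. -/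
theorem exists_clamped_extension [FiniteDimensional ℝ E] {T : ℝ} (hT : 0 ≤ T) {K : Set (Vec N)}
    (hK : IsClosed K) (hΦ : ContinuousOn (fun q : ℝ × Vec N => Φ q.1 q.2) (Icc 0 T ×ˢ K)) :
    ∃ Ψ : ℝ → Vec N → E, Continuous (fun q : ℝ × Vec N => Ψ q.1 q.2) ∧
      ∀ t, ∀ x ∈ K, Ψ t x = Φ (projIcc 0 T hT t) x := by
  have := RCLike.instTietzeExtensionTVS (𝕜 := ℝ) (E := E)
  obtain ⟨g, hg⟩ := ContinuousMap.exists_restrict_eq (isClosed_Icc.prod hK)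
    ⟨_, continuousOn_iff_continuous_domRestrict.1 hΦ⟩
  refine ⟨fun t x => g ((projIcc 0 T hT t : ℝ), x), ?_, fun t x hx => ?_⟩
  · exact g.continuous.comp
      ((continuous_subtype_val.comp (continuous_projIcc.comp continuous_fst)).prodMk continuous_snd)
  · have := congrArg (fun k => k ⟨((projIcc 0 T hT t : ℝ), x), (projIcc 0 T hT t).2, hx⟩) hg
    simpa using this

end Steklov

theorem integrable_indicator_Ioo {E : Type*} [NormedAddCommGroup E] {f : ℝ → E} {a b : ℝ}
    (h : IntegrableOn f (Ioo a b)) : Integrable ((Ioo a b).indicator f) :=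
  h.integrable_indicator measurableSet_Ioo

theorem measurable_enorm_steklov_sub {E : Type*} [NormedAddCommGroup E] [NormedSpace ℝ E]
    {d : ℝ → E} (hd : Integrable d) (hm : StronglyMeasurable d) (h : ℝ) :
    Measurable fun t => ‖h⁻¹ • (∫ s in t..t + h, d s) - d t‖ₑ := by
  have hp := intervalIntegral.continuous_primitive
    (fun a b => hd.intervalIntegrable (a := a) (b := b)) 0
  have hc : Continuous fun t => h⁻¹ • ∫ s in t..t + h, d s := by
    have e1 : (fun t => h⁻¹ • ∫ s in t..t + h, d s)
        = fun t => h⁻¹ • ((∫ s in (0 : ℝ)..t + h, d s) - ∫ s in (0 : ℝ)..t, d s) := by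
      ext1 t
      rw [intervalIntegral.integral_interval_sub_left] <;> exact hd.intervalIntegrable
    rw [e1]
    exact ((hp.comp (continuous_add_const h)).sub hp).const_smul h⁻¹
  exact (hc.stronglyMeasurable.sub hm).enorm

set_option maxHeartbeats 1000000 in
/-- The velocity of a strong solution is approximated by admissible test fields. -/
theorem IsStrongSolution.exists_test_approx {T : ℝ} (hT : 0 < T) {Ω : Set (Vec N)}
    (hΩ : IsOpen Ω) {p : ℝ → ℝ} {μ η : ℝ} {r : ℝ → Vec N → ℝ}
    {gradr : ℝ → Vec N → (Vec N →L[ℝ] ℝ)} {U : ℝ → Vec N → Vec N} {gradU : ℝ → Vec N → Mat N}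
    {dtU : ℝ → (closure Ω →ᵇ Vec N)} (hS : IsStrongSolution T Ω p μ η r gradr U gradU dtU)
    {M : ℝ} (hU : ∀ t ∈ Icc 0 T, ∀ x ∈ closure Ω, ‖U t x‖ ≤ M)
    (hgU : ∀ t ∈ Icc 0 T, ∀ x ∈ closure Ω, ‖gradU t x‖ ≤ M) :
    ∃ (d : ℝ → (closure Ω →ᵇ Vec N)) (V Vt : ℕ → ℝ → Vec N → Vec N)
      (Vx : ℕ → ℝ → Vec N → Mat N) (κ : ℕ → ℝ → ENNReal),
      StronglyMeasurable d ∧ Integrable d ∧ d =ᵐ[timeMeasure T] dtU ∧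
      (∀ n, IsC1 T Ω (V n) (Vt n) (Vx n)) ∧
      (∀ n, ∀ t ∈ Icc 0 T, ∀ x ∈ frontier Ω, V n t x = 0) ∧
      (∀ n, ∀ t ∈ Icc 0 T, ∀ x ∈ closure Ω, ‖V n t x‖ ≤ M ∧ ‖Vx n t x‖ ≤ M) ∧
      (∀ t ∈ Icc 0 T, ∀ x ∈ closure Ω, Tendsto (fun n => V n t x) atTop (𝓝 (U t x)) ∧
        Tendsto (fun n => Vx n t x) atTop (𝓝 (gradU t x))) ∧
      (∀ n, Measurable (κ n)) ∧ Tendsto (fun n => ∫⁻ t, κ n t) atTop (𝓝 0) ∧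
      (∀ n, ∀ t ∈ Icc 0 T, ∀ x : closure Ω, ‖Vt n t x - d t x‖ₑ ≤ κ n t) := by
  have hT' : (0 : ℝ) ≤ T := hT.le
  obtain ⟨Ψ, hΨc, hΨ⟩ := exists_clamped_extension hT' isClosed_closure hS.cont_U
  obtain ⟨Γ, hΓc, hΓ⟩ := exists_clamped_extension hT' isClosed_closure hS.cont_gradU
  have hmemT : ∀ t, ((projIcc 0 T hT' t : Icc (0 : ℝ) T) : ℝ) ∈ Icc 0 T := fun t =>
    (projIcc 0 T hT' t).2
  have hproj : ∀ {t : ℝ}, t ∈ Icc 0 T → ((projIcc 0 T hT' t : Icc (0 : ℝ) T) : ℝ) = t :=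
    fun ht => by rw [projIcc_of_mem hT' ht]
  have hΨd : ∀ s, ∀ x ∈ Ω, HasFDerivAt (Ψ s) (Γ s x) x := by
    intro s x hx
    rw [hΓ s x (subset_closure hx)]
    refine (hS.hasGrad_U _ (hmemT s) x hx).congr_of_eventuallyEq ?_
    filter_upwards [hΩ.mem_nhds hx] with y hy using hΨ s y (subset_closure hy)
  have hdm := hS.dtU_memLp
  set d₀ := hdm.1.mk dtU with hd₀
  have hd₀m : StronglyMeasurable d₀ := hdm.1.stronglyMeasurable_mk
  have hd₀e : dtU =ᵐ[timeMeasure T] d₀ := hdm.1.ae_eq_mk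
  have hfin : IsFiniteMeasure (timeMeasure T) := ⟨by simp [timeMeasure]⟩
  have hd₀i : Integrable d₀ (timeMeasure T) :=
    ((hdm.integrable (by norm_num)).congr hd₀e)
  -- Extending ∂_t U by zero corresponds to freezing U after time T. The averaging windows [t, t +
  -- h] may then leave [0, T] while Ψ stays the primitive of d on [0, ∞).
  set d : ℝ → (closure Ω →ᵇ Vec N) := (Ioo 0 T).indicator d₀ with hd
  have hdmeas : StronglyMeasurable d := hd₀m.indicator measurableSet_Ioo
  have hd₀i' : IntegrableOn d₀ (Ioo 0 T) := hd₀i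
  have hdint : Integrable d := integrable_indicator_Ioo hd₀i'
  have hdae : d =ᵐ[timeMeasure T] dtU := by
    have hmem : ∀ᵐ t ∂timeMeasure T, t ∈ Ioo 0 T := ae_restrict_mem measurableSet_Ioo
    filter_upwards [hd₀e, hmem] with t h1 h2
    rw [hd, indicator_of_mem h2, h1]
  have hev : ∀ (x : closure Ω) (a b : ℝ),
      (∫ s in a..b, d s) x = ∫ s in a..b, d s x := fun x a b =>
    ((BoundedContinuousFunction.evalCLM ℝ x).intervalIntegral_comp_comm
      (hdint.intervalIntegrable (a := a) (b := b))).symm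
  have hdi : ∀ (x : closure Ω) (a b : ℝ), IntervalIntegrable (fun s => d s x) volume a b :=
    fun x a b => ((BoundedContinuousFunction.evalCLM ℝ x).integrable_comp hdint).intervalIntegrable
  have hΨi : ∀ (x : closure Ω) (b : ℝ), 0 ≤ b → Ψ b x = U 0 x + ∫ s in (0 : ℝ)..b, d s x := by
    intro x b hb
    rw [hΨ b x x.2, hS.U_eq _ (hmemT b) x]
    congr 1
    have e1 : ∫ s in (0 : ℝ)..(projIcc 0 T hT' b : Icc (0 : ℝ) T), dtU s x
        = ∫ s in (0 : ℝ)..(projIcc 0 T hT' b : Icc (0 : ℝ) T), d s x := by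
      refine intervalIntegral.integral_congr_ae ?_
      filter_upwards [ae_uIoc_of_ae_timeMeasure (hmemT b) hdae] with s hs hs'
      rw [uIoc_of_le (hmemT b).1] at hs'
      rw [hs hs']
    rw [e1]
    rcases le_or_gt b T with hbT | hbT
    · rw [hproj ⟨hb, hbT⟩]
    · rw [projIcc_of_right_le hT' hbT.le]
      have e2 : ∫ s in T..b, d s x = 0 := by
        rw [intervalIntegral.integral_congr (g := fun _ => (0 : Vec N))]
        · simp
        · intro s hs
          rw [uIcc_of_le hbT.le] at hs
          have : s ∉ Ioo 0 T := fun h => absurd h.2 (not_lt.2 hs.1)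
          simp [hd, indicator_of_notMem this]
      rw [← intervalIntegral.integral_add_adjacent_intervals (hdi x 0 T) (hdi x T b), e2, add_zero]
  set h : ℕ → ℝ := fun n => 1 / ((n : ℝ) + 1) with hh
  have hh0 : ∀ n, 0 < h n := fun n => by positivity
  have hhl : Tendsto h atTop (𝓝[>] 0) :=
    tendsto_nhdsWithin_iff.2 ⟨tendsto_one_div_add_atTop_nhds_zero_nat, Eventually.of_forall hh0⟩
  -- The error κ is measured in the norm of the Banach space of continuous functions on `closure Ω`.
  -- It is thus uniform in x, and the L¹ convergence of averages of Banach-valued functions applies.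
  refine ⟨d, fun n => steklov (h n) Ψ,
    fun n t x => (h n)⁻¹ • (Ψ (t + h n) x - Ψ t x), fun n => steklov (h n) Γ,
    fun n t => ‖(h n)⁻¹ • (∫ s in t..t + h n, d s) - d t‖ₑ, hdmeas, hdint, hdae,
    fun n => ⟨?_, ?_, ?_, ?_, ?_⟩, ?_, ?_, ?_, ?_, ?_, ?_⟩
  · exact (continuous_steklov hΨc _).continuousOn
  · have h1 : Continuous fun q : ℝ × Vec N => Ψ (q.1 + h n) q.2 :=
      hΨc.comp ((continuous_fst.add continuous_const).prodMk continuous_snd)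
    exact ((h1.sub hΨc).const_smul (h n)⁻¹).continuousOn
  · exact (continuous_steklov hΓc _).continuousOn
  · exact fun t _ x _ => hasDerivAt_steklov hΨc _ _ _
  · exact fun t _ x hx => hasFDerivAt_steklov hΨc hΓc hΩ hΨd hx
  · intro n t _ x hx
    refine steklov_eq_zero fun s => ?_
    rw [hΨ s x (frontier_subset_closure hx)]
    exact hS.no_slip _ (hmemT s) x hx
  · intro n t _ x hx
    refine ⟨norm_steklov_le (hh0 n) fun s => ?_, norm_steklov_le (hh0 n) fun s => ?_⟩
    · rw [hΨ s x hx]; exact hU _ (hmemT s) x hx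
    · rw [hΓ s x hx]; exact hgU _ (hmemT s) x hx
  · intro t ht x hx
    have h1 := (tendsto_steklov hΨc t x).comp hhl
    have h2 := (tendsto_steklov hΓc t x).comp hhl
    rw [hΨ t x hx, hproj ht] at h1
    rw [hΓ t x hx, hproj ht] at h2
    exact ⟨h1, h2⟩
  · exact fun n => measurable_enorm_steklov_sub hdint hdmeas _
  · exact (tendsto_lintegral_steklov hdint hdmeas).comp hhl
  · intro n t ht x
    -- The time derivative of the averaged field is a difference quotient of Ψ, that is, the Steklov
    -- average of d.
    have e1 : Ψ (t + h n) x - Ψ t x = (∫ s in t..t + h n, d s) x := by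
      rw [hΨi x _ (by linarith [ht.1, hh0 n]), hΨi x t ht.1, hev, add_sub_add_left_eq_sub,
        intervalIntegral.integral_interval_sub_left (hdi x _ _) (hdi x _ _)]
    beta_reduce
    rw [e1, ← ofReal_norm, ← ofReal_norm]
    refine ENNReal.ofReal_le_ofReal ?_
    exact ((h n)⁻¹ • (∫ s in t..t + h n, d s) - d t).norm_coe_le_norm x

/-! ### Integration over the space-time cylinder -/

/-- The integral over `(0,τ) × Ω`. -/
def cylInt (Ω : Set (Vec N)) (τ : ℝ) (f : ℝ × Vec N → ℝ) : ℝ :=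
  ∫ t in (0 : ℝ)..τ, ∫ x in Ω, f (t, x)

instance (T : ℝ) : IsFiniteMeasure (timeMeasure T) := ⟨by simp [timeMeasure]⟩

section Cylinder

variable {T : ℝ} {Ω : Set (Vec N)}

theorem cylMeasure_eq_prod : cylMeasure T Ω = (timeMeasure T).prod (volume.restrict Ω) := by
  rw [cylMeasure, timeMeasure, Measure.prod_restrict]; rfl

theorem ae_ae_of_ae_cylMeasure {P : ℝ × Vec N → Prop} (h : ∀ᵐ q ∂cylMeasure T Ω, P q) :
    ∀ᵐ t ∂timeMeasure T, ∀ᵐ x ∂volume.restrict Ω, P (t, x) := by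
  rw [cylMeasure_eq_prod] at h
  exact Measure.ae_ae_of_ae_prod h

theorem ae_integrable_slice {E : Type*} [NormedAddCommGroup E] {f : ℝ × Vec N → E}
    (h : Integrable f (cylMeasure T Ω)) :
    ∀ᵐ t ∂timeMeasure T, Integrable (fun x => f (t, x)) (volume.restrict Ω) := by
  rw [cylMeasure_eq_prod] at h
  exact h.prod_right_ae

theorem integrable_integral_slice {f : ℝ × Vec N → ℝ} (h : Integrable f (cylMeasure T Ω)) :
    Integrable (fun t => ∫ x in Ω, f (t, x)) (timeMeasure T) := by
  rw [cylMeasure_eq_prod] at h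
  exact h.integral_prod_left

theorem cylInt_add {τ : ℝ} (hτ : τ ∈ Icc 0 T) {f g : ℝ × Vec N → ℝ}
    (hf : Integrable f (cylMeasure T Ω)) (hg : Integrable g (cylMeasure T Ω)) :
    cylInt Ω τ (fun q => f q + g q) = cylInt Ω τ f + cylInt Ω τ g := by
  unfold cylInt
  rw [← intervalIntegral.integral_add
    (intervalIntegrable_of_timeMeasure hτ (integrable_integral_slice hf))
    (intervalIntegrable_of_timeMeasure hτ (integrable_integral_slice hg))]
  refine intervalIntegral.integral_congr_ae ?_
  filter_upwards [ae_uIoc_of_ae_timeMeasure hτ (ae_integrable_slice hf),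
    ae_uIoc_of_ae_timeMeasure hτ (ae_integrable_slice hg)] with t h1 h2 ht
  rw [uIoc_of_le hτ.1] at ht
  exact integral_add (h1 ht) (h2 ht)

theorem cylInt_const_mul {τ : ℝ} (c : ℝ) (f : ℝ × Vec N → ℝ) :
    cylInt Ω τ (fun q => c * f q) = c * cylInt Ω τ f := by
  simp only [cylInt, integral_const_mul, intervalIntegral.integral_const_mul]

theorem cylInt_sub {τ : ℝ} (hτ : τ ∈ Icc 0 T) {f g : ℝ × Vec N → ℝ}
    (hf : Integrable f (cylMeasure T Ω)) (hg : Integrable g (cylMeasure T Ω)) :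
    cylInt Ω τ (fun q => f q - g q) = cylInt Ω τ f - cylInt Ω τ g := by
  have := cylInt_add hτ hf (hg.const_mul (-1))
  rw [cylInt_const_mul] at this
  simpa [sub_eq_add_neg] using this

theorem cylInt_eq_integral {τ : ℝ} (hτ : τ ∈ Icc 0 T) {f : ℝ × Vec N → ℝ}
    (hf : Integrable f (cylMeasure T Ω)) : cylInt Ω τ f = ∫ q, f q ∂cylMeasure τ Ω := by
  have hle : cylMeasure τ Ω ≤ cylMeasure T Ω :=
    Measure.restrict_mono (prod_mono (Ioo_subset_Ioo_right hτ.2) le_rfl) le_rfl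
  have h := hf.mono_measure hle
  rw [cylMeasure_eq_prod] at h ⊢
  rw [integral_prod f h, cylInt, intervalIntegral.integral_of_le hτ.1, timeMeasure,
    restrict_Ioo_eq_restrict_Ioc]

theorem ae_mem_cyl (hΩ : IsOpen Ω) : ∀ᵐ q ∂cylMeasure T Ω, q.1 ∈ Ioo 0 T ∧ q.2 ∈ Ω := by
  have := ae_restrict_mem (μ := (volume : Measure (ℝ × Vec N)))
    (measurableSet_Ioo.prod hΩ.measurableSet : MeasurableSet (Ioo 0 T ×ˢ Ω))
  exact this

theorem aestronglyMeasurable_cyl (hΩ : IsOpen Ω) {E : Type*} [NormedAddCommGroup E]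
    [SecondCountableTopology E] {g : ℝ → Vec N → E}
    (hg : ContinuousOn (fun q : ℝ × Vec N => g q.1 q.2) (Icc 0 T ×ˢ closure Ω)) :
    AEStronglyMeasurable (fun q : ℝ × Vec N => g q.1 q.2) (cylMeasure T Ω) :=
  (hg.mono (prod_mono Ioo_subset_Icc_self subset_closure)).aestronglyMeasurable
    (measurableSet_Ioo.prod hΩ.measurableSet)

theorem exists_bound_cyl (hb : Bornology.IsBounded Ω) {E : Type*} [NormedAddCommGroup E]
    {g : ℝ → Vec N → E}
    (hg : ContinuousOn (fun q : ℝ × Vec N => g q.1 q.2) (Icc 0 T ×ˢ closure Ω)) :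
    ∃ C, ∀ t ∈ Icc 0 T, ∀ x ∈ closure Ω, ‖g t x‖ ≤ C := by
  obtain ⟨C, hC⟩ := (isCompact_Icc.prod hb.isCompact_closure).exists_bound_of_continuousOn hg
  exact ⟨C, fun t ht x hx => hC (t, x) ⟨ht, hx⟩⟩

/-- Products of integrable functions with functions continuous up to the boundary. -/
theorem integrable_bilin_cyl (hΩ : IsOpen Ω) (hb : Bornology.IsBounded Ω) {E F : Type*}
    [NormedAddCommGroup E] [NormedSpace ℝ E] [NormedAddCommGroup F] [NormedSpace ℝ F]
    [SecondCountableTopology F] (B : E →L[ℝ] F →L[ℝ] ℝ) {f : ℝ × Vec N → E} {g : ℝ → Vec N → F}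
    (hf : Integrable f (cylMeasure T Ω))
    (hg : ContinuousOn (fun q : ℝ × Vec N => g q.1 q.2) (Icc 0 T ×ˢ closure Ω)) :
    Integrable (fun q => B (f q) (g q.1 q.2)) (cylMeasure T Ω) := by
  obtain ⟨C, hC⟩ := exists_bound_cyl hb hg
  refine (hf.norm.const_mul (‖B‖ * C)).mono'
    (B.aestronglyMeasurable_comp₂ hf.1 (aestronglyMeasurable_cyl hΩ hg)) ?_
  filter_upwards [ae_mem_cyl hΩ] with q hq
  have h1 := B.le_opNorm₂ (f q) (g q.1 q.2)
  have h2 := hC q.1 (Ioo_subset_Icc_self hq.1) q.2 (subset_closure hq.2)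
  calc ‖B (f q) (g q.1 q.2)‖ ≤ ‖B‖ * ‖f q‖ * ‖g q.1 q.2‖ := h1
    _ ≤ ‖B‖ * ‖f q‖ * C := by gcongr
    _ = ‖B‖ * C * ‖f q‖ := by ring

theorem isFiniteMeasure_cyl (hb : Bornology.IsBounded Ω) : IsFiniteMeasure (cylMeasure T Ω) := by
  have : IsFiniteMeasure (volume.restrict Ω) := ⟨by simpa using hb.measure_lt_top⟩
  rw [cylMeasure_eq_prod]
  infer_instance

theorem integrable_cyl_of_continuousOn (hΩ : IsOpen Ω) (hb : Bornology.IsBounded Ω)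
    {g : ℝ → Vec N → ℝ}
    (hg : ContinuousOn (fun q : ℝ × Vec N => g q.1 q.2) (Icc 0 T ×ˢ closure Ω)) :
    Integrable (fun q => g q.1 q.2) (cylMeasure T Ω) := by
  have := isFiniteMeasure_cyl (T := T) hb
  simpa using integrable_bilin_cyl hΩ hb (ContinuousLinearMap.mul ℝ ℝ)
    (integrable_const (1 : ℝ)) hg

/-- The same on `Ω`. -/
theorem integrable_bilin_slice (hΩ : IsOpen Ω) (hb : Bornology.IsBounded Ω) {E F : Type*}
    [NormedAddCommGroup E] [NormedSpace ℝ E] [NormedAddCommGroup F] [NormedSpace ℝ F]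
    [SecondCountableTopology F] (B : E →L[ℝ] F →L[ℝ] ℝ) {f : Vec N → E} {g : Vec N → F}
    (hf : Integrable f (volume.restrict Ω)) (hg : ContinuousOn g (closure Ω)) :
    Integrable (fun x => B (f x) (g x)) (volume.restrict Ω) := by
  obtain ⟨C, hC⟩ := hb.isCompact_closure.exists_bound_of_continuousOn hg
  refine (hf.norm.const_mul (‖B‖ * C)).mono' (B.aestronglyMeasurable_comp₂ hf.1
    ((hg.mono subset_closure).aestronglyMeasurable hΩ.measurableSet)) ?_
  filter_upwards [ae_restrict_mem hΩ.measurableSet] with x hx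
  calc ‖B (f x) (g x)‖ ≤ ‖B‖ * ‖f x‖ * ‖g x‖ := B.le_opNorm₂ _ _
    _ ≤ ‖B‖ * ‖f x‖ * C := by gcongr; exact hC x (subset_closure hx)
    _ = ‖B‖ * C * ‖f x‖ := by ring

theorem integrable_slice_of_continuousOn (hΩ : IsOpen Ω) (hb : Bornology.IsBounded Ω)
    {g : Vec N → ℝ} (hg : ContinuousOn g (closure Ω)) : Integrable g (volume.restrict Ω) := by
  have : IsFiniteMeasure (volume.restrict Ω) := ⟨by simpa using hb.measure_lt_top⟩
  simpa using integrable_bilin_slice hΩ hb (ContinuousLinearMap.mul ℝ ℝ)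
    (integrable_const (1 : ℝ)) hg

theorem ContinuousOn.slice {E : Type*} [TopologicalSpace E] {g : ℝ → Vec N → E} {K : Set (Vec N)}
    (hg : ContinuousOn (fun q : ℝ × Vec N => g q.1 q.2) (Icc 0 T ×ˢ K)) {t : ℝ}
    (ht : t ∈ Icc 0 T) : ContinuousOn (g t) K :=
  hg.comp (by fun_prop : Continuous fun x : Vec N => (t, x)).continuousOn fun _ hx => ⟨ht, hx⟩

end Cylinder

/-! ### Relative energy in terms of moments -/

section Moments

variable {p : ℝ → ℝ} {ν : Measure (ℝ × Vec N)}

/-- Expanding the square leaves only the energy, the momentum and the density, exactly the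
quantities whose evolution is prescribed. -/
theorem relEnergy_eq (r : ℝ) (U : Vec N) (z : ℝ × Vec N) :
    relEnergy p r U z = energy p z - inner ℝ (z.1 • z.2) U
      + z.1 * (1 / 2 * ‖U‖ ^ 2 - deriv (potential p) r)
      + (r * deriv (potential p) r - potential p r) := by
  rw [relEnergy, energy, norm_sub_sq_real, real_inner_smul_left]
  ring

theorem integrable_relEnergy [IsProbabilityMeasure ν] (h1 : Integrable (fun z => z.1) ν)
    (h2 : Integrable (fun z => z.1 • z.2) ν) (h3 : Integrable (energy p) ν) (r : ℝ) (U : Vec N) :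
    Integrable (relEnergy p r U) ν := by
  have : relEnergy p r U = fun z => _ := funext (relEnergy_eq r U)
  rw [this]
  exact ((h3.sub (h2.inner_const U)).add (h1.mul_const _)).add (integrable_const _)

theorem integral_relEnergy [IsProbabilityMeasure ν] (hp : IsPressure p)
    (h1 : Integrable (fun z => z.1) ν)
    (h2 : Integrable (fun z => z.1 • z.2) ν) (h3 : Integrable (energy p) ν) {r : ℝ} (hr : 0 < r)
    (U : Vec N) :
    ∫ z, relEnergy p r U z ∂ν = (∫ z, energy p z ∂ν) - inner ℝ (∫ z, z.1 • z.2 ∂ν) U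
      + (∫ z, z.1 ∂ν) * (1 / 2 * ‖U‖ ^ 2 - deriv (potential p) r) + p r := by
  simp only [relEnergy_eq]
  have i1 : Integrable (fun z => inner ℝ (z.1 • z.2) U) ν := h2.inner_const U
  have i2 : Integrable (fun z => energy p z - inner ℝ (z.1 • z.2) U) ν := h3.sub i1
  have i3 : Integrable (fun z => z.1 * (1 / 2 * ‖U‖ ^ 2 - deriv (potential p) r)) ν :=
    h1.mul_const _
  have i4 : Integrable (fun z => energy p z - inner ℝ (z.1 • z.2) U
    + z.1 * (1 / 2 * ‖U‖ ^ 2 - deriv (potential p) r)) ν := i2.add i3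
  rw [integral_add i4 (integrable_const _), integral_add i2 i3, integral_sub h3 i1, integral_mul_const, integral_const,
    hp.mul_deriv_potential_sub hr]
  have : ∫ z, inner ℝ (z.1 • z.2) U ∂ν = inner ℝ (∫ z, z.1 • z.2 ∂ν) U := by
    rw [real_inner_comm, ← integral_inner h2]
    simp only [real_inner_comm]
  rw [this]
  simp

theorem relEnergy_nonneg (hp : IsPressure p) {r : ℝ} (hr : 0 < r) (U : Vec N) {z : ℝ × Vec N}
    (hz : 0 ≤ z.1) : 0 ≤ relEnergy p r U z := by
  have := hp.relPotential_nonneg hr hz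
  have h2 : 0 ≤ 1 / 2 * z.1 * ‖z.2 - U‖ ^ 2 := by positivity
  unfold relEnergy
  linarith

/-- The tangent of P at 1 gives p(1)(s - 1) ≤ P(s), because P(1) = 0 and P'(1) = p(1). The momentum
is handled by s|v| ≤ ½ s + ½ s|v|². -/
theorem density_momentum_le_energy (hp : IsPressure p) {z : ℝ × Vec N} (hz : 0 ≤ z.1) :
    |z.1| + ‖z.1 • z.2‖ ≤ (1 + 3 / 2 / p 1) * (energy p z + p 1) := by
  have h1 := hp.relPotential_nonneg one_pos hz
  have h2 : potential p 1 = 0 := by simp [potential]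
  have h3 := hp.mul_deriv_potential_sub one_pos
  rw [h2] at h1 h3
  have hd : deriv (potential p) 1 = p 1 := by linarith
  rw [hd] at h1
  have hp1 := hp.pos one_pos
  rw [norm_smul, Real.norm_eq_abs, abs_of_nonneg hz, energy]
  have h4 : z.1 * ‖z.2‖ ≤ 1 / 2 * z.1 + 1 / 2 * z.1 * ‖z.2‖ ^ 2 := by
    have := mul_nonneg hz (sq_nonneg (‖z.2‖ - 1))
    linarith
  have h5 : 0 ≤ 1 / 2 * z.1 * ‖z.2‖ ^ 2 := by positivity
  have h6 : 3 / 2 * z.1 ≤ 3 / 2 / p 1 * (1 / 2 * z.1 * ‖z.2‖ ^ 2 + potential p z.1 + p 1) := by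
    rw [div_mul_eq_mul_div (3 / 2), le_div_iff₀ hp1]
    linarith
  have h7 : 0 ≤ p 1 * z.1 := by positivity
  linarith

theorem moments_le_energy [IsProbabilityMeasure ν] (hp : IsPressure p)
    (h0 : ν {z | z.1 < 0} = 0) (h1 : Integrable (fun z => z.1) ν)
    (h2 : Integrable (fun z => z.1 • z.2) ν) (h3 : Integrable (energy p) ν) :
    |∫ z, z.1 ∂ν| + ‖∫ z, z.1 • z.2 ∂ν‖
      ≤ (1 + 3 / 2 / p 1) * ((∫ z, energy p z ∂ν) + p 1) := by
  have hz : ∀ᵐ z ∂ν, 0 ≤ z.1 := by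
    rw [ae_iff]; simpa using h0
  calc |∫ z, z.1 ∂ν| + ‖∫ z, z.1 • z.2 ∂ν‖ ≤ (∫ z, |z.1| ∂ν) + ∫ z, ‖z.1 • z.2‖ ∂ν :=
        add_le_add (abs_integral_le_integral_abs) (norm_integral_le_integral_norm _)
    _ = ∫ z, (|z.1| + ‖z.1 • z.2‖) ∂ν := (integral_add h1.abs h2.norm).symm
    _ ≤ ∫ z, (1 + 3 / 2 / p 1) * (energy p z + p 1) ∂ν := by
        refine integral_mono_ae (h1.abs.add h2.norm)
          ((h3.add (integrable_const _)).const_mul _) ?_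
        filter_upwards [hz] with z hz using density_momentum_le_energy hp hz
    _ = (1 + 3 / 2 / p 1) * ((∫ z, energy p z ∂ν) + p 1) := by
        rw [integral_const_mul, integral_add h3 (integrable_const _)]
        simp

end Moments

/-! ### Relative energy inequality for C¹ test velocities -/

/-- The time derivative of the density prescribed by the equation of continuity. -/
def dtDensity (r : ℝ → Vec N → ℝ) (gradr : ℝ → Vec N → (Vec N →L[ℝ] ℝ))
    (U : ℝ → Vec N → Vec N) (gradU : ℝ → Vec N → Mat N) (t : ℝ) (x : Vec N) : ℝ :=
  -(gradr t x (U t x) + r t x * tr (gradU t x))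

/-- The mean of the relative energy, expressed by moments. -/
def relMean (p : ℝ → ℝ) (ν : Measure (ℝ × Vec N)) (r : ℝ) (V : Vec N) : ℝ :=
  (∫ z, energy p z ∂ν) - inner ℝ (∫ z, z.1 • z.2 ∂ν) V
      + (∫ z, z.1 ∂ν) * (1 / 2 * ‖V‖ ^ 2 - deriv (potential p) r) + p r

/-- The integrand of the momentum equation without viscosity. -/
def momentumIntegrand (p : ℝ → ℝ) (ν : Measure (ℝ × Vec N)) (Vt : Vec N) (Vx : Mat N) : ℝ :=
  inner ℝ (∫ z, z.1 • z.2 ∂ν) Vt + contr (∫ z, z.1 • tensorSq z.2 ∂ν) Vx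
    + (∫ z, p z.1 ∂ν) * tr Vx

/-- The integrand of the equation of continuity tested with `½ |V|² - P'(r)`. -/
def continuityIntegrand (p : ℝ → ℝ) (ν : Measure (ℝ × Vec N)) (r dtr : ℝ) (gradr : Vec N →L[ℝ] ℝ)
    (V Vt : Vec N) (Vx : Mat N) : ℝ :=
  (∫ z, z.1 ∂ν) * (inner ℝ V Vt - deriv p r / r * dtr)
    + ((innerSL ℝ V).comp Vx - (deriv p r / r) • gradr) (∫ z, z.1 • z.2 ∂ν)

theorem c1Norm_le {F : Type*} [NormedAddCommGroup F] [NormedSpace ℝ F] {Ω : Set (Vec N)}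
    (hne : Ω.Nonempty) {f : Vec N → F} {df : Vec N → (Vec N →L[ℝ] F)} {C : ℝ}
    (h1 : ∀ x ∈ closure Ω, ‖f x‖ ≤ C) (h2 : ∀ x ∈ closure Ω, ‖df x‖ ≤ C) :
    c1Norm Ω f df ≤ 2 * C := by
  have hne' : (closure Ω).Nonempty := hne.closure
  have e1 : sSup ((fun x => ‖f x‖) '' closure Ω) ≤ C :=
    csSup_le (hne'.image _) (by rintro _ ⟨x, hx, rfl⟩; exact h1 x hx)
  have e2 : sSup ((fun x => ‖df x‖) '' closure Ω) ≤ C :=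
    csSup_le (hne'.image _) (by rintro _ ⟨x, hx, rfl⟩; exact h2 x hx)
  unfold c1Norm
  linarith

section StrongSolution

variable {T : ℝ} {Ω : Set (Vec N)} {p : ℝ → ℝ} {μ η : ℝ} {r : ℝ → Vec N → ℝ}
  {gradr : ℝ → Vec N → (Vec N →L[ℝ] ℝ)} {U : ℝ → Vec N → Vec N} {gradU : ℝ → Vec N → Mat N}
  {dtU : ℝ → (closure Ω →ᵇ Vec N)}

theorem IsStrongSolution.continuousOn_comp_density
    (hS : IsStrongSolution T Ω p μ η r gradr U gradU dtU) {f : ℝ → ℝ}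
    (hf : ContinuousOn f (Ioi 0)) :
    ContinuousOn (fun q : ℝ × Vec N => f (r q.1 q.2)) (Icc 0 T ×ˢ closure Ω) :=
  hf.comp hS.cont_r fun q hq => hS.r_pos q.1 hq.1 q.2 hq.2

theorem IsStrongSolution.continuousOn_dtDensity
    (hS : IsStrongSolution T Ω p μ η r gradr U gradU dtU) :
    ContinuousOn (fun q : ℝ × Vec N => dtDensity r gradr U gradU q.1 q.2)
      (Icc 0 T ×ˢ closure Ω) :=
  ((hS.cont_gradr.clm_apply hS.cont_U).add
    (hS.cont_r.mul (continuous_tr.comp_continuousOn hS.cont_gradU))).neg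

theorem IsStrongSolution.continuousOn_deriv_div
    (hS : IsStrongSolution T Ω p μ η r gradr U gradU dtU) (hp : IsPressure p) :
    ContinuousOn (fun q : ℝ × Vec N => deriv p (r q.1 q.2) / r q.1 q.2)
      (Icc 0 T ×ˢ closure Ω) :=
  (hS.continuousOn_comp_density hp.continuousOn_deriv).div hS.cont_r
    fun q hq => (hS.r_pos q.1 hq.1 q.2 hq.2).ne'

/-- The function `½ |V|² - P'(r)` is an admissible test function. -/
theorem IsStrongSolution.isC1_test (hS : IsStrongSolution T Ω p μ η r gradr U gradU dtU)
    (hp : IsPressure p) {V Vt : ℝ → Vec N → Vec N} {Vx : ℝ → Vec N → Mat N}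
    (hV : IsC1 T Ω V Vt Vx) :
    IsC1 T Ω (fun t x => 1 / 2 * ‖V t x‖ ^ 2 - deriv (potential p) (r t x))
      (fun t x => inner ℝ (V t x) (Vt t x)
        - deriv p (r t x) / r t x * dtDensity r gradr U gradU t x)
      (fun t x => (innerSL ℝ (V t x)).comp (Vx t x) - (deriv p (r t x) / r t x) • gradr t x) where
  cont := ((hV.cont.norm.pow 2).const_smul (1 / 2 : ℝ)).sub
    (hS.continuousOn_comp_density hp.continuousOn_deriv_potential)
  cont_t := (hV.cont.inner hV.cont_t).sub
    ((hS.continuousOn_deriv_div hp).mul hS.continuousOn_dtDensity)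
  cont_x := (((innerSL ℝ).continuous.comp_continuousOn hV.cont).clm_comp hV.cont_x).sub
    ((hS.continuousOn_deriv_div hp).smul hS.cont_gradr)
  deriv_t := by
    intro t ht x hx
    have hr := hS.r_pos t (Ioo_subset_Icc_self ht) x (subset_closure hx)
    have h1 := ((hV.deriv_t t ht x hx).norm_sq).const_mul (1 / 2 : ℝ)
    have h2 := (hp.hasDerivAt_deriv_potential hr).comp t (hS.continuity t ht x hx)
    refine (h1.sub h2).congr_deriv ?_
    rw [dtDensity]
    ring
  deriv_x := by
    intro t ht x hx
    have hr := hS.r_pos t ht x (subset_closure hx)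
    have h1 := ((hV.deriv_x t ht x hx).norm_sq).const_mul (1 / 2 : ℝ)
    have h2 := (hp.hasDerivAt_deriv_potential hr).comp_hasFDerivAt x (hS.hasGrad_r t ht x hx)
    refine (h1.sub h2).congr_fderiv ?_
    rw [two_smul, smul_add, ← add_smul]
    norm_num

/-- The fundamental theorem of calculus in time at each fixed x, followed by Fubini. It accounts for
the part of the relative energy that depends on r alone. -/
theorem IsStrongSolution.integral_pressure_sub (hS : IsStrongSolution T Ω p μ η r gradr U gradU dtU)
    (hΩ : IsOpen Ω) (hb : Bornology.IsBounded Ω) (hp : IsPressure p) {τ : ℝ} (hτ : τ ∈ Ioo 0 T) :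
    (∫ x in Ω, p (r τ x)) - (∫ x in Ω, p (r 0 x))
      = cylInt Ω τ (fun q => deriv p (r q.1 q.2) * dtDensity r gradr U gradU q.1 q.2) := by
  have hτ' : τ ∈ Icc 0 T := Ioo_subset_Icc_self hτ
  have h0 : (0 : ℝ) ∈ Icc 0 T := ⟨le_rfl, hτ.1.le.trans hτ.2.le⟩
  have hpc : ContinuousOn (fun q : ℝ × Vec N => p (r q.1 q.2)) (Icc 0 T ×ˢ closure Ω) :=
    hS.continuousOn_comp_density (hp.continuousOn.mono Ioi_subset_Ici_self)
  have hdc : ContinuousOn (fun q : ℝ × Vec N => deriv p (r q.1 q.2)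
      * dtDensity r gradr U gradU q.1 q.2) (Icc 0 T ×ˢ closure Ω) :=
    (hS.continuousOn_comp_density hp.continuousOn_deriv).mul hS.continuousOn_dtDensity
  have hint := integrable_cyl_of_continuousOn hΩ hb hdc (g := fun t x => deriv p (r t x)
      * dtDensity r gradr U gradU t x)
  have hle : cylMeasure τ Ω ≤ cylMeasure T Ω :=
    Measure.restrict_mono (prod_mono (Ioo_subset_Ioo_right hτ.2.le) le_rfl) le_rfl
  have hint' := hint.mono_measure hle
  rw [cylInt_eq_integral hτ' hint]
  rw [cylMeasure_eq_prod] at hint' ⊢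
  rw [integral_prod_symm _ hint', ← integral_sub
    (integrable_slice_of_continuousOn hΩ hb (ContinuousOn.slice (g := fun t x => p (r t x)) hpc hτ'))
    (integrable_slice_of_continuousOn hΩ hb (ContinuousOn.slice (g := fun t x => p (r t x)) hpc h0))]
  refine setIntegral_congr_fun hΩ.measurableSet fun x hx => ?_
  have hxc := subset_closure hx
  have hline : ContinuousOn (fun t : ℝ => (t, x)) (Icc 0 τ) := by fun_prop
  have hmaps : MapsTo (fun t : ℝ => (t, x)) (Icc 0 τ) (Icc 0 T ×ˢ closure Ω) :=
    fun t ht => ⟨⟨ht.1, ht.2.trans hτ.2.le⟩, hxc⟩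
  have hdl := hdc.comp hline hmaps
  have := intervalIntegral.integral_eq_sub_of_hasDerivAt_of_le hτ.1.le
    (f := fun t => p (r t x)) (f' := fun t => deriv p (r t x) * dtDensity r gradr U gradU t x)
    (hpc.comp hline hmaps) (fun t ht => ?_) (hdl.intervalIntegrable_of_Icc hτ.1.le)
  · rw [intervalIntegral.integral_of_le hτ.1.le] at this
    rw [timeMeasure, restrict_Ioo_eq_restrict_Ioc]
    exact this.symm
  · have htT : t ∈ Ioo 0 T := ⟨ht.1, ht.2.trans hτ.2⟩
    exact (hp.hasDerivAt (hS.r_pos t (Ioo_subset_Icc_self htT) x hxc)).comp t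
      (hS.continuity t htT x hx)

end StrongSolution

section TestInequality

variable {T : ℝ} {Ω : Set (Vec N)} {p : ℝ → ℝ} {μ η cP : ℝ}
  {ν : ℝ × Vec N → Measure (ℝ × Vec N)} {ν₀ : Vec N → Measure (ℝ × Vec N)} {D : ℝ → ℝ}
  {gradu : ℝ × Vec N → Mat N} {χ ξ : ℝ → ℝ}
  {r : ℝ → Vec N → ℝ}
  {gradr : ℝ → Vec N → (Vec N →L[ℝ] ℝ)} {U : ℝ → Vec N → Vec N} {gradU : ℝ → Vec N → Mat N}
  {dtU : ℝ → (closure Ω →ᵇ Vec N)}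

/-- The defect is essentially bounded in time, so it may multiply the merely integrable functions χ
and ξ. -/
theorem IsDissipativeMVSolution.integrable_mul_defect
    (hD : IsDissipativeMVSolution T Ω p μ η cP ν ν₀ D gradu χ ξ) {f : ℝ → ℝ}
    (hf : Integrable f (timeMeasure T)) :
    Integrable (fun t => |f t| * D t) (timeMeasure T) := by
  have h := hD.defect_memLp
  have := hf.abs.essSup_smul h.1 (f := fun t => |f t|) (g := D) (by
    simpa [eLpNorm_exponent_top, eLpNormEssSup] using h.2.ne)
  refine this.congr (Eventually.of_forall fun t => ?_)
  simp [mul_comm]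

theorem abs_integral_pairing_le {τ : ℝ} (hτ : τ ∈ Icc 0 T) {f b : ℝ → ℝ} {C : ℝ}
    (hb : Integrable b (timeMeasure T)) (h : ∀ᵐ t ∂timeMeasure T, |f t| ≤ C * b t) :
    |∫ t in (0 : ℝ)..τ, f t| ≤ C * ∫ t in (0 : ℝ)..τ, b t := by
  rw [← intervalIntegral.integral_const_mul, ← Real.norm_eq_abs]
  refine intervalIntegral.norm_integral_le_of_norm_le hτ.1 ?_
    (intervalIntegrable_of_timeMeasure hτ (hb.const_mul C))
  exact ae_uIoc_of_ae_timeMeasure hτ h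

theorem cylInt_sub_add_add {τ : ℝ} (hτ : τ ∈ Icc 0 T) {a b c d : ℝ × Vec N → ℝ}
    (ha : Integrable a (cylMeasure T Ω)) (hb : Integrable b (cylMeasure T Ω))
    (hc : Integrable c (cylMeasure T Ω)) (hd : Integrable d (cylMeasure T Ω)) :
    cylInt Ω τ (fun q => a q - b q + c q + d q)
      = cylInt Ω τ a - cylInt Ω τ b + cylInt Ω τ c + cylInt Ω τ d := by
  have h1 : Integrable (fun q => a q - b q) (cylMeasure T Ω) := ha.sub hb
  have h2 : Integrable (fun q => a q - b q + c q) (cylMeasure T Ω) := h1.add hc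
  rw [cylInt_add hτ h2 hd, cylInt_add hτ h1 hc, cylInt_sub hτ ha hb]

theorem c1Norm_nonneg {F : Type*} [NormedAddCommGroup F] [NormedSpace ℝ F] (Ω : Set (Vec N))
    (f : Vec N → F) (df : Vec N → (Vec N →L[ℝ] F)) : 0 ≤ c1Norm Ω f df :=
  add_nonneg (Real.sSup_nonneg (by rintro _ ⟨x, -, rfl⟩; exact norm_nonneg _))
    (Real.sSup_nonneg (by rintro _ ⟨x, -, rfl⟩; exact norm_nonneg _))

/-- χ and ξ carry no sign, hence the absolute value. The C¹ norm is a sum of two suprema, hence the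
factor 2. -/
theorem abs_le_of_pairing {a c d n C : ℝ} (hd : 0 ≤ d) (hn : 0 ≤ n) (hnC : n ≤ 2 * C)
    (h : |a| ≤ c * d * n) : |a| ≤ 2 * C * (|c| * d) := by
  calc |a| ≤ c * d * n := h
    _ ≤ |c| * d * n := by gcongr; exact le_abs_self c
    _ ≤ |c| * d * (2 * C) := by gcongr
    _ = 2 * C * (|c| * d) := by ring

theorem integrable_momentumIntegrand (hD : IsDissipativeMVSolution T Ω p μ η cP ν ν₀ D gradu χ ξ)
    (hΩ : IsOpen Ω) (hb : Bornology.IsBounded Ω) {Vt : ℝ → Vec N → Vec N}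
    {Vx : ℝ → Vec N → Mat N}
    (hVt : ContinuousOn (fun q : ℝ × Vec N => Vt q.1 q.2) (Icc 0 T ×ˢ closure Ω))
    (hVx : ContinuousOn (fun q : ℝ × Vec N => Vx q.1 q.2) (Icc 0 T ×ˢ closure Ω)) :
    Integrable (fun q => momentumIntegrand p (ν q) (Vt q.1 q.2) (Vx q.1 q.2)) (cylMeasure T Ω) :=
  ((integrable_bilin_cyl hΩ hb innerBilin hD.int_momentum.2 hVt).add
    (integrable_bilin_cyl hΩ hb contrBilin hD.int_convective.2 hVx)).add
    (integrable_bilin_cyl hΩ hb (ContinuousLinearMap.mul ℝ ℝ) hD.int_pressure.2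
      (g := fun t x => tr (Vx t x)) (continuous_tr.comp_continuousOn hVx))

theorem integrable_viscousIntegrand (hD : IsDissipativeMVSolution T Ω p μ η cP ν ν₀ D gradu χ ξ)
    (hΩ : IsOpen Ω) (hb : Bornology.IsBounded Ω) {Vx : ℝ → Vec N → Mat N}
    (hVx : ContinuousOn (fun q : ℝ × Vec N => Vx q.1 q.2) (Icc 0 T ×ˢ closure Ω)) :
    Integrable (fun q => contr (stress μ η (gradu q)) (Vx q.1 q.2)) (cylMeasure T Ω) := by
  have := isFiniteMeasure_cyl (T := T) hb
  exact integrable_bilin_cyl hΩ hb (contrBilin.comp (stressCLM μ η))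
    (hD.velocity_mem.2.1.integrable (by norm_num)) hVx

theorem integrable_dissipation (hD : IsDissipativeMVSolution T Ω p μ η cP ν ν₀ D gradu χ ξ) :
    Integrable (fun q => contr (stress μ η (gradu q)) (gradu q)) (cylMeasure T Ω) :=
  integrable_bilin (contrBilin.comp (stressCLM μ η)) hD.velocity_mem.2.1 hD.velocity_mem.2.1

/-- The exceptional null set of times is chosen before V, so the four terms may be separated for a
whole sequence of test velocities at the same τ. -/
theorem ae_integrable_relMean (hD : IsDissipativeMVSolution T Ω p μ η cP ν ν₀ D gradu χ ξ)
    (hS : IsStrongSolution T Ω p μ η r gradr U gradU dtU)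
    (hΩ : IsOpen Ω) (hb : Bornology.IsBounded Ω) (hp : IsPressure p) :
    ∀ᵐ τ ∂timeMeasure T, ∀ V : Vec N → Vec N, ContinuousOn V (closure Ω) →
      Integrable (fun x => ∫ z, energy p z ∂ν (τ, x)) (volume.restrict Ω) ∧
      Integrable (fun x => inner ℝ (∫ z, z.1 • z.2 ∂ν (τ, x)) (V x)) (volume.restrict Ω) ∧
      Integrable (fun x => (∫ z, z.1 ∂ν (τ, x)) *
        (1 / 2 * ‖V x‖ ^ 2 - deriv (potential p) (r τ x))) (volume.restrict Ω) ∧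
      Integrable (fun x => p (r τ x)) (volume.restrict Ω) := by
  have hmem : ∀ᵐ τ ∂timeMeasure T, τ ∈ Ioo 0 T := ae_restrict_mem measurableSet_Ioo
  filter_upwards [hmem, ae_integrable_slice hD.int_energy.2, ae_integrable_slice hD.int_momentum.2,
    ae_integrable_slice hD.int_density.2] with τ hτ h1 h2 h3 V hV
  have hτ' := Ioo_subset_Icc_self hτ
  refine ⟨h1, integrable_bilin_slice hΩ hb innerBilin h2 hV,
    integrable_bilin_slice hΩ hb (ContinuousLinearMap.mul ℝ ℝ) h3
      (((hV.norm.pow 2).const_smul (1 / 2 : ℝ)).sub ?_),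
    integrable_slice_of_continuousOn hΩ hb ?_⟩
  · exact ContinuousOn.slice (g := fun t x => deriv (potential p) (r t x))
      (hS.continuousOn_comp_density hp.continuousOn_deriv_potential) hτ'
  · exact ContinuousOn.slice (g := fun t x => p (r t x))
      (hS.continuousOn_comp_density (hp.continuousOn.mono Ioi_subset_Ici_self)) hτ'

theorem integrable_relMean_init (hD : IsDissipativeMVSolution T Ω p μ η cP ν ν₀ D gradu χ ξ)
    (hS : IsStrongSolution T Ω p μ η r gradr U gradU dtU) (hT : 0 ≤ T)
    (hΩ : IsOpen Ω) (hb : Bornology.IsBounded Ω) (hp : IsPressure p) {V : Vec N → Vec N}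
    (hV : ContinuousOn V (closure Ω)) :
      Integrable (fun x => inner ℝ (∫ z, z.1 • z.2 ∂ν₀ x) (V x)) (volume.restrict Ω) ∧
      Integrable (fun x => (∫ z, z.1 ∂ν₀ x) *
        (1 / 2 * ‖V x‖ ^ 2 - deriv (potential p) (r 0 x))) (volume.restrict Ω) ∧
      Integrable (fun x => p (r 0 x)) (volume.restrict Ω) := by
  have h0 : (0 : ℝ) ∈ Icc 0 T := ⟨le_rfl, hT⟩
  refine ⟨integrable_bilin_slice hΩ hb innerBilin hD.int_init_momentum.2 hV,
    integrable_bilin_slice hΩ hb (ContinuousLinearMap.mul ℝ ℝ) hD.int_init_density.2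
      (((hV.norm.pow 2).const_smul (1 / 2 : ℝ)).sub ?_),
    integrable_slice_of_continuousOn hΩ hb ?_⟩
  · exact ContinuousOn.slice (g := fun t x => deriv (potential p) (r t x))
      (hS.continuousOn_comp_density hp.continuousOn_deriv_potential) h0
  · exact ContinuousOn.slice (g := fun t x => p (r t x))
      (hS.continuousOn_comp_density (hp.continuousOn.mono Ioi_subset_Ici_self)) h0

theorem integral_relMean_split {ν' : Vec N → Measure (ℝ × Vec N)} {r' : Vec N → ℝ}
    {V : Vec N → Vec N}
    (h1 : Integrable (fun x => ∫ z, energy p z ∂ν' x) (volume.restrict Ω))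
    (h2 : Integrable (fun x => inner ℝ (∫ z, z.1 • z.2 ∂ν' x) (V x)) (volume.restrict Ω))
    (h3 : Integrable (fun x => (∫ z, z.1 ∂ν' x) *
        (1 / 2 * ‖V x‖ ^ 2 - deriv (potential p) (r' x))) (volume.restrict Ω))
    (h4 : Integrable (fun x => p (r' x)) (volume.restrict Ω)) :
    ∫ x in Ω, relMean p (ν' x) (r' x) (V x)
      = (∫ x in Ω, ∫ z, energy p z ∂ν' x) - (∫ x in Ω, inner ℝ (∫ z, z.1 • z.2 ∂ν' x) (V x))
        + (∫ x in Ω, (∫ z, z.1 ∂ν' x) * (1 / 2 * ‖V x‖ ^ 2 - deriv (potential p) (r' x)))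
        + ∫ x in Ω, p (r' x) := by
  have h12 : Integrable (fun x => (∫ z, energy p z ∂ν' x)
    - inner ℝ (∫ z, z.1 • z.2 ∂ν' x) (V x)) (volume.restrict Ω) := h1.sub h2
  have h123 : Integrable (fun x => (∫ z, energy p z ∂ν' x)
    - inner ℝ (∫ z, z.1 • z.2 ∂ν' x) (V x) + (∫ z, z.1 ∂ν' x) *
        (1 / 2 * ‖V x‖ ^ 2 - deriv (potential p) (r' x))) (volume.restrict Ω) := h12.add h3
  unfold relMean
  rw [integral_add h123 h4, integral_add h12 h3, integral_sub h1 h2]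

/-- The relative energy inequality with a smooth test velocity. -/
theorem ae_relEnergy_test (hD : IsDissipativeMVSolution T Ω p μ η cP ν ν₀ D gradu χ ξ)
    (hS : IsStrongSolution T Ω p μ η r gradr U gradU dtU) (hT : 0 ≤ T)
    (hΩ : IsOpen Ω) (hb : Bornology.IsBounded Ω) (hne : Ω.Nonempty) (hp : IsPressure p) (C : ℝ) :
    ∀ᵐ τ ∂timeMeasure T, ∀ (V Vt : ℝ → Vec N → Vec N) (Vx : ℝ → Vec N → Mat N),
      IsC1 T Ω V Vt Vx → (∀ t ∈ Icc 0 T, ∀ x ∈ frontier Ω, V t x = 0) →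
      (∀ t ∈ Icc 0 T, ∀ x ∈ closure Ω, ‖V t x‖ ≤ C ∧ ‖Vx t x‖ ≤ C ∧
        ‖1 / 2 * ‖V t x‖ ^ 2 - deriv (potential p) (r t x)‖ ≤ C ∧
        ‖(innerSL ℝ (V t x)).comp (Vx t x) - (deriv p (r t x) / r t x) • gradr t x‖ ≤ C) →
      (∫ x in Ω, relMean p (ν (τ, x)) (r τ x) (V τ x))
        + cylInt Ω τ (fun q => contr (stress μ η (gradu q)) (gradu q)) + D τ
      ≤ (∫ x in Ω, relMean p (ν₀ x) (r 0 x) (V 0 x))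
        + cylInt Ω τ (fun q =>
          continuityIntegrand p (ν q) (r q.1 q.2) (dtDensity r gradr U gradU q.1 q.2)
              (gradr q.1 q.2) (V q.1 q.2) (Vt q.1 q.2) (Vx q.1 q.2)
            - momentumIntegrand p (ν q) (Vt q.1 q.2) (Vx q.1 q.2)
            + contr (stress μ η (gradu q)) (Vx q.1 q.2)
            + deriv p (r q.1 q.2) * dtDensity r gradr U gradU q.1 q.2)
        + 2 * C * ∫ t in (0 : ℝ)..τ, (|χ t| + |ξ t|) * D t := by
  obtain ⟨rC, -, hC⟩ := hD.continuity
  obtain ⟨rM, -, hM⟩ := hD.momentum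
  have hmem : ∀ᵐ τ ∂timeMeasure T, τ ∈ Ioo 0 T := ae_restrict_mem measurableSet_Ioo
  filter_upwards [hmem, hC, hM, hD.energy_ineq, ae_integrable_relMean hD hS hΩ hb hp]
    with τ hτ hCτ hMτ hE hint V Vt Vx hV hV0 hbd
  have hτ' : τ ∈ Icc 0 T := Ioo_subset_Icc_self hτ
  have h0 : (0 : ℝ) ∈ Icc 0 T := ⟨le_rfl, hT⟩
  have hψ := hS.isC1_test hp hV
  have c1 := (hCτ _ _ _ hψ).2
  have m1 := (hMτ V Vt Vx hV hV0).2
  have ic := hD.integrable_mul_defect hD.chi_integrable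
  have ix := hD.integrable_mul_defect hD.xi_integrable
  set ψx : ℝ → Vec N → (Vec N →L[ℝ] ℝ) := fun t x =>
    (innerSL ℝ (V t x)).comp (Vx t x) - (deriv p (r t x) / r t x) • gradr t x with hψx
  -- The bound on the concentration measure holds for almost every t with an exceptional set
  -- independent of the test function, so it can be used under the time integral.
  have b1 : |∫ t in (0 : ℝ)..τ, pairVec (rC t) (ψx t)|
      ≤ 2 * C * ∫ t in (0 : ℝ)..τ, |χ t| * D t := by
    refine abs_integral_pairing_le hτ' ic ?_
    filter_upwards [hC, hD.defect_nonneg, hmem] with t h1 h2 ht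
    have ht' := Ioo_subset_Icc_self ht
    have hn := c1Norm_le hne (fun x hx => (hbd t ht' x hx).2.2.1)
      (fun x hx => (hbd t ht' x hx).2.2.2)
    exact abs_le_of_pairing h2 (c1Norm_nonneg _ _ _) hn (h1 _ _ _ hψ).1
  have b2 : |∫ t in (0 : ℝ)..τ, pairMat (rM t) (Vx t)|
      ≤ 2 * C * ∫ t in (0 : ℝ)..τ, |ξ t| * D t := by
    refine abs_integral_pairing_le hτ' ix ?_
    filter_upwards [hM, hD.defect_nonneg, hmem] with t h1 h2 ht
    have ht' := Ioo_subset_Icc_self ht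
    have hn := c1Norm_le hne (fun x hx => (hbd t ht' x hx).1)
      (fun x hx => (hbd t ht' x hx).2.1)
    exact abs_le_of_pairing h2 (c1Norm_nonneg _ _ _) hn (h1 _ _ _ hV hV0).1
  have e3 : ∫ t in (0 : ℝ)..τ, (|χ t| + |ξ t|) * D t
      = (∫ t in (0 : ℝ)..τ, |χ t| * D t) + ∫ t in (0 : ℝ)..τ, |ξ t| * D t := by
    rw [← intervalIntegral.integral_add (intervalIntegrable_of_timeMeasure hτ' ic)
      (intervalIntegrable_of_timeMeasure hτ' ix)]
    simp only [add_mul]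
  have i1 : Integrable (fun q : ℝ × Vec N =>
      continuityIntegrand p (ν q) (r q.1 q.2) (dtDensity r gradr U gradU q.1 q.2)
        (gradr q.1 q.2) (V q.1 q.2) (Vt q.1 q.2) (Vx q.1 q.2)) (cylMeasure T Ω) :=
    (integrable_bilin_cyl hΩ hb (ContinuousLinearMap.mul ℝ ℝ) hD.int_density.2
      (g := fun t x => inner ℝ (V t x) (Vt t x)
        - deriv p (r t x) / r t x * dtDensity r gradr U gradU t x) hψ.cont_t).add
      (integrable_bilin_cyl hΩ hb (ContinuousLinearMap.id ℝ (Vec N →L[ℝ] ℝ)).flip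
        hD.int_momentum.2 (g := ψx) hψ.cont_x)
  have i2 := integrable_momentumIntegrand hD hΩ hb hV.cont_t hV.cont_x
  have i3 := integrable_viscousIntegrand hD hΩ hb hV.cont_x
  have i4 := integrable_cyl_of_continuousOn hΩ hb (T := T) (g := fun t x => deriv p (r t x)
      * dtDensity r gradr U gradU t x)
    ((hS.continuousOn_comp_density hp.continuousOn_deriv).mul hS.continuousOn_dtDensity)
  have hsum : cylInt Ω τ (fun q =>
          continuityIntegrand p (ν q) (r q.1 q.2) (dtDensity r gradr U gradU q.1 q.2)
              (gradr q.1 q.2) (V q.1 q.2) (Vt q.1 q.2) (Vx q.1 q.2)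
            - momentumIntegrand p (ν q) (Vt q.1 q.2) (Vx q.1 q.2)
            + contr (stress μ η (gradu q)) (Vx q.1 q.2)
            + deriv p (r q.1 q.2) * dtDensity r gradr U gradU q.1 q.2)
      = cylInt Ω τ (fun q =>
          continuityIntegrand p (ν q) (r q.1 q.2) (dtDensity r gradr U gradU q.1 q.2)
              (gradr q.1 q.2) (V q.1 q.2) (Vt q.1 q.2) (Vx q.1 q.2))
        - cylInt Ω τ (fun q => momentumIntegrand p (ν q) (Vt q.1 q.2) (Vx q.1 q.2))
        + cylInt Ω τ (fun q => contr (stress μ η (gradu q)) (Vx q.1 q.2))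
        + cylInt Ω τ (fun q => deriv p (r q.1 q.2) * dtDensity r gradr U gradU q.1 q.2) :=
    cylInt_sub_add_add hτ' i1 i2 i3 i4
  have hP := hS.integral_pressure_sub hΩ hb hp hτ
  obtain ⟨j1, j2, j3, j4⟩ := hint (V τ) (ContinuousOn.slice hV.cont hτ')
  obtain ⟨k2, k3, k4⟩ := integrable_relMean_init hD hS hT hΩ hb hp (ContinuousOn.slice hV.cont h0)
  rw [integral_relMean_split j1 j2 j3 j4,
    integral_relMean_split hD.int_init_energy.2 k2 k3 k4, hsum, e3]
  have b1' := (abs_le.1 b1).2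
  have b2' := (abs_le.1 b2).1
  -- The result is the combination: energy inequality, minus momentum equation, plus equation of
  -- continuity, plus the identity for p(r).
  change _ = cylInt Ω τ (fun q =>
          continuityIntegrand p (ν q) (r q.1 q.2) (dtDensity r gradr U gradU q.1 q.2)
              (gradr q.1 q.2) (V q.1 q.2) (Vt q.1 q.2) (Vx q.1 q.2)) + _ at c1
  change _ = cylInt Ω τ (fun q => momentumIntegrand p (ν q) (Vt q.1 q.2) (Vx q.1 q.2))
    - cylInt Ω τ (fun q => contr (stress μ η (gradu q)) (Vx q.1 q.2)) + _ at m1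
  change _ + cylInt Ω τ (fun q => contr (stress μ η (gradu q)) (gradu q)) + _ ≤ _ at hE
  linarith

end TestInequality

/-! ### Passage to the limit to the strong velocity -/

/-- Convergence almost everywhere with an integrable majorant. -/
structure DominatedTendsto {α : Type*} [MeasurableSpace α] (m : Measure α) (F : ℕ → α → ℝ)
    (f : α → ℝ) : Prop where
  meas : ∀ n, AEStronglyMeasurable (F n) m
  bound : ∃ b : α → ℝ, Integrable b m ∧ ∀ n, ∀ᵐ x ∂m, ‖F n x‖ ≤ b x
  lim : ∀ᵐ x ∂m, Tendsto (fun n => F n x) atTop (𝓝 (f x))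

namespace DominatedTendsto

variable {α : Type*} [MeasurableSpace α] {m : Measure α} {F G : ℕ → α → ℝ} {f g : α → ℝ}

theorem tendsto_integral (h : DominatedTendsto m F f) :
    Tendsto (fun n => ∫ x, F n x ∂m) atTop (𝓝 (∫ x, f x ∂m)) := by
  obtain ⟨b, hb, hb'⟩ := h.bound
  exact tendsto_integral_of_dominated_convergence b h.meas hb hb' h.lim

theorem integrable (h : DominatedTendsto m F f) : Integrable f m := by
  obtain ⟨b, hb, hb'⟩ := h.bound
  refine hb.mono' (aestronglyMeasurable_of_tendsto_ae atTop h.meas h.lim) ?_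
  filter_upwards [h.lim, ae_all_iff.2 hb'] with x h1 h2
  exact le_of_tendsto' h1.norm h2

theorem integrable_seq (h : DominatedTendsto m F f) (n : ℕ) : Integrable (F n) m := by
  obtain ⟨b, hb, hb'⟩ := h.bound
  exact hb.mono' (h.meas n) (hb' n)

theorem mono_measure {m' : Measure α} (h : DominatedTendsto m F f) (hm : m' ≤ m) :
    DominatedTendsto m' F f := by
  obtain ⟨b, hb, hb'⟩ := h.bound
  exact ⟨fun n => (h.meas n).mono_measure hm,
    ⟨b, hb.mono_measure hm, fun n => ae_mono hm (hb' n)⟩, ae_mono hm h.lim⟩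

theorem const (hf : Integrable f m) : DominatedTendsto m (fun _ => f) f :=
  ⟨fun _ => hf.1, ⟨_, hf.norm, fun _ => Eventually.of_forall fun _ => le_rfl⟩,
    Eventually.of_forall fun _ => tendsto_const_nhds⟩

theorem add (hF : DominatedTendsto m F f) (hG : DominatedTendsto m G g) :
    DominatedTendsto m (fun n x => F n x + G n x) (fun x => f x + g x) := by
  obtain ⟨b, hb, hb'⟩ := hF.bound
  obtain ⟨c, hc, hc'⟩ := hG.bound
  refine ⟨fun n => (hF.meas n).add (hG.meas n), ⟨_, hb.add hc, fun n => ?_⟩, ?_⟩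
  · filter_upwards [hb' n, hc' n] with x h1 h2
    exact (norm_add_le _ _).trans (add_le_add h1 h2)
  · filter_upwards [hF.lim, hG.lim] with x h1 h2 using h1.add h2

theorem sub (hF : DominatedTendsto m F f) (hG : DominatedTendsto m G g) :
    DominatedTendsto m (fun n x => F n x - G n x) (fun x => f x - g x) := by
  obtain ⟨b, hb, hb'⟩ := hF.bound
  obtain ⟨c, hc, hc'⟩ := hG.bound
  refine ⟨fun n => (hF.meas n).sub (hG.meas n), ⟨_, hb.add hc, fun n => ?_⟩, ?_⟩
  · filter_upwards [hb' n, hc' n] with x h1 h2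
    exact (norm_sub_le _ _).trans (add_le_add h1 h2)
  · filter_upwards [hF.lim, hG.lim] with x h1 h2 using h1.sub h2

theorem bilin {E E' : Type*} [NormedAddCommGroup E] [NormedSpace ℝ E] [NormedAddCommGroup E']
    [NormedSpace ℝ E'] (B : E →L[ℝ] E' →L[ℝ] ℝ) {a : α → E} {w : ℕ → α → E'} {w₀ : α → E'} {C : ℝ}
    (ha : Integrable a m) (hw : ∀ n, AEStronglyMeasurable (w n) m)
    (hC : ∀ n, ∀ᵐ x ∂m, ‖w n x‖ ≤ C)
    (hl : ∀ᵐ x ∂m, Tendsto (fun n => w n x) atTop (𝓝 (w₀ x))) :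
    DominatedTendsto m (fun n x => B (a x) (w n x)) (fun x => B (a x) (w₀ x)) := by
  refine ⟨fun n => B.aestronglyMeasurable_comp₂ ha.1 (hw n),
    ⟨fun x => ‖B‖ * C * ‖a x‖, ha.norm.const_mul _, fun n => ?_⟩, ?_⟩
  · filter_upwards [hC n] with x hx
    calc ‖B (a x) (w n x)‖ ≤ ‖B‖ * ‖a x‖ * ‖w n x‖ := B.le_opNorm₂ _ _
      _ ≤ ‖B‖ * ‖a x‖ * C := by gcongr
      _ = ‖B‖ * C * ‖a x‖ := by ring
  · filter_upwards [hl] with x hx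
    exact ((B (a x)).continuous.tendsto _).comp hx

end DominatedTendsto

/-- The extension by zero of a time-dependent continuous function on `closure Ω`. -/
def extendZero {Ω : Set (Vec N)} (d : ℝ → (closure Ω →ᵇ Vec N)) (t : ℝ) (x : Vec N) : Vec N :=
  open Classical in if hx : x ∈ closure Ω then d t ⟨x, hx⟩ else 0

theorem extendZero_of_mem {Ω : Set (Vec N)} (d : ℝ → (closure Ω →ᵇ Vec N)) (t : ℝ) {x : Vec N}
    (hx : x ∈ closure Ω) : extendZero d t x = d t ⟨x, hx⟩ := by
  simp [extendZero, hx]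

theorem norm_extendZero_le {Ω : Set (Vec N)} (d : ℝ → (closure Ω →ᵇ Vec N)) (t : ℝ) (x : Vec N) :
    ‖extendZero d t x‖ ≤ ‖d t‖ := by
  by_cases hx : x ∈ closure Ω
  · rw [extendZero_of_mem d t hx]; exact (d t).norm_coe_le_norm _
  · simp [extendZero, hx]

theorem continuousOn_extendZero {Ω : Set (Vec N)} (d : ℝ → (closure Ω →ᵇ Vec N)) (t : ℝ) :
    ContinuousOn (extendZero d t) (closure Ω) := by
  rw [continuousOn_iff_continuous_domRestrict]
  have : (closure Ω).domRestrict (extendZero d t) = d t := by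
    ext1 x
    exact extendZero_of_mem d t x.2
  rw [this]
  exact (d t).continuous

/-- Evaluation (f, x) ↦ f(x) is jointly continuous, so a strongly measurable curve of continuous
functions is jointly measurable in (t, x). This is why a strongly measurable representative of ∂_t U
is used. -/
theorem measurable_extendZero {Ω : Set (Vec N)} {d : ℝ → (closure Ω →ᵇ Vec N)}
    (hd : StronglyMeasurable d) : Measurable fun q : ℝ × Vec N => extendZero d q.1 q.2 := by
  have h1 : StronglyMeasurable fun q : ℝ × closure Ω => (d q.1, q.2) :=
    (hd.comp_measurable measurable_fst).prodMk measurable_snd.stronglyMeasurable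
  have h2 : Measurable fun q : ℝ × closure Ω => d q.1 q.2 :=
    (ContinuousEval.continuous_eval.comp_stronglyMeasurable h1).measurable
  have hs : MeasurableSet {q : ℝ × Vec N | q.2 ∈ closure Ω} :=
    measurable_snd isClosed_closure.measurableSet
  classical
  have h3 : Measurable fun q : {q : ℝ × Vec N | q.2 ∈ closure Ω} => d q.1.1 ⟨q.1.2, q.2⟩ :=
    h2.comp ((measurable_fst.comp measurable_subtype_coe).prodMk
      ((measurable_snd.comp measurable_subtype_coe).subtype_mk))
  exact Measurable.dite h3 (measurable_const (a := (0 : Vec N))) hs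

/-- Density and momentum are controlled in L^∞(0,T; L¹(Ω)), while ∂_t U and its approximation errors
are controlled in L¹ of time, uniformly in x. Tonelli pairs the two. -/
theorem lintegral_time_mul_le {T : ℝ} {Ω : Set (Vec N)} {w : ℝ × Vec N → ℝ} {K : ℝ}
    {a : ℝ → ENNReal} (ha : Measurable a) (hw : Integrable w (cylMeasure T Ω))
    (hw0 : ∀ᵐ q ∂cylMeasure T Ω, 0 ≤ w q)
    (hK : ∀ᵐ t ∂timeMeasure T, ∫ x in Ω, w (t, x) ≤ K) :
    ∫⁻ q, a q.1 * ENNReal.ofReal (w q) ∂cylMeasure T Ω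
      ≤ ENNReal.ofReal K * ∫⁻ t, a t ∂timeMeasure T := by
  have hm : AEMeasurable (fun q : ℝ × Vec N => a q.1 * ENNReal.ofReal (w q))
      ((timeMeasure T).prod (volume.restrict Ω)) := by
    rw [← cylMeasure_eq_prod]
    exact (ha.comp measurable_fst).aemeasurable.mul hw.1.aemeasurable.ennreal_ofReal
  rw [cylMeasure_eq_prod, lintegral_prod _ hm, ← lintegral_const_mul _ ha]
  refine lintegral_mono_ae ?_
  filter_upwards [hK, ae_ae_of_ae_cylMeasure hw0, ae_integrable_slice hw] with t h1 h2 h3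
  rw [lintegral_const_mul'' _ h3.1.aemeasurable.ennreal_ofReal, mul_comm,
    ← ofReal_integral_eq_lintegral_ofReal h3 h2]
  gcongr

section Limit

variable {T : ℝ} {Ω : Set (Vec N)} {p : ℝ → ℝ} {μ η cP : ℝ}
  {ν : ℝ × Vec N → Measure (ℝ × Vec N)} {ν₀ : Vec N → Measure (ℝ × Vec N)} {D : ℝ → ℝ}
  {gradu : ℝ × Vec N → Mat N} {χ ξ : ℝ → ℝ}

theorem IsDissipativeMVSolution.ae_dissipation_nonneg
    (hD : IsDissipativeMVSolution T Ω p μ η cP ν ν₀ D gradu χ ξ) (hμ : 0 ≤ μ) (hη : 0 ≤ η) :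
    ∀ᵐ t ∂timeMeasure T, 0 ≤ ∫ x in Ω, contr (stress μ η (gradu (t, x))) (gradu (t, x)) := by
  filter_upwards [hD.velocity_mem.2.2] with t ht
  exact (mul_nonneg hμ (integral_nonneg fun x => contr_self_nonneg _)).trans (ht.korn hμ hη)

/-- Korn's inequality makes the viscous dissipation nonnegative on almost every time slice, and the
defect is nonnegative, so both may be dropped from the energy inequality. -/
theorem IsDissipativeMVSolution.ae_integral_energy_le
    (hD : IsDissipativeMVSolution T Ω p μ η cP ν ν₀ D gradu χ ξ) (hμ : 0 ≤ μ) (hη : 0 ≤ η) :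
    ∀ᵐ t ∂timeMeasure T, ∫ x in Ω, ∫ z, energy p z ∂ν (t, x) ≤ ∫ x in Ω, ∫ z, energy p z ∂ν₀ x := by
  have hmem : ∀ᵐ τ ∂timeMeasure T, τ ∈ Ioo 0 T := ae_restrict_mem measurableSet_Ioo
  filter_upwards [hD.energy_ineq, hD.defect_nonneg, hmem] with t h1 h2 h4
  have h5 : 0 ≤ ∫ s in (0 : ℝ)..t, ∫ x in Ω, contr (stress μ η (gradu (s, x))) (gradu (s, x)) := by
    have := intervalIntegral_mono_timeMeasure (Ioo_subset_Icc_self h4)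
      (integrable_zero ℝ ℝ (timeMeasure T)) (integrable_integral_slice (integrable_dissipation hD))
      (hD.ae_dissipation_nonneg hμ hη)
    simpa using this
  linarith

/-- An integrable majorant of density and momentum with bounded integrals over `Ω`. -/
theorem IsDissipativeMVSolution.exists_majorant
    (hD : IsDissipativeMVSolution T Ω p μ η cP ν ν₀ D gradu χ ξ) (hb : Bornology.IsBounded Ω)
    (hp : IsPressure p) (hμ : 0 ≤ μ) (hη : 0 ≤ η) :
    ∃ (w : ℝ × Vec N → ℝ) (K : ℝ), Integrable w (cylMeasure T Ω) ∧
      (∀ᵐ q ∂cylMeasure T Ω, |∫ z, z.1 ∂ν q| + ‖∫ z, z.1 • z.2 ∂ν q‖ ≤ w q) ∧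
      ∀ᵐ t ∂timeMeasure T, ∫ x in Ω, w (t, x) ≤ K := by
  have := isFiniteMeasure_cyl (T := T) hb
  have hfin : IsFiniteMeasure (volume.restrict Ω) := ⟨by simpa using hb.measure_lt_top⟩
  have hp1 := hp.pos one_pos
  refine ⟨fun q => (1 + 3 / 2 / p 1) * ((∫ z, energy p z ∂ν q) + p 1),
    (1 + 3 / 2 / p 1) * ((∫ x in Ω, ∫ z, energy p z ∂ν₀ x) + ∫ _ in Ω, p 1),
    (hD.int_energy.2.add (integrable_const _)).const_mul _, ?_, ?_⟩
  · filter_upwards [hD.young.prob, hD.young.density_nonneg, hD.int_density.1, hD.int_momentum.1,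
      hD.int_energy.1] with q h1 h2 h3 h4 h5
    exact moments_le_energy hp h2 h3 h4 h5
  · filter_upwards [hD.ae_integral_energy_le hμ hη, ae_integrable_slice hD.int_energy.2]
      with t h1 h3
    rw [integral_const_mul, integral_add h3 (integrable_const _)]
    exact mul_le_mul_of_nonneg_left (add_le_add h1 le_rfl) (by positivity)

end Limit

/-- The integrand on the right-hand side of the relative energy inequality. -/
def testIntegrand (p : ℝ → ℝ) (μ η : ℝ) (ν : Measure (ℝ × Vec N)) (G : Mat N) (r dtr : ℝ)
    (gradr : Vec N →L[ℝ] ℝ) (V Vt : Vec N) (Vx : Mat N) : ℝ :=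
  continuityIntegrand p ν r dtr gradr V Vt Vx - momentumIntegrand p ν Vt Vx
    + contr (stress μ η G) Vx + deriv p r * dtr

/-- The integrand is affine in the time derivative. Only this slot converges in an L¹ sense rather
than boundedly, so its error is split off. -/
theorem testIntegrand_eq_add (p : ℝ → ℝ) (μ η : ℝ) (ν : Measure (ℝ × Vec N)) (G : Mat N)
    (r dtr : ℝ) (gradr : Vec N →L[ℝ] ℝ) (V Vt Vt' : Vec N) (Vx : Mat N) :
    testIntegrand p μ η ν G r dtr gradr V Vt Vx
      = testIntegrand p μ η ν G r dtr gradr V Vt' Vx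
        + ((∫ z, z.1 ∂ν) * inner ℝ V (Vt - Vt') - inner ℝ (∫ z, z.1 • z.2 ∂ν) (Vt - Vt')) := by
  simp only [testIntegrand, continuityIntegrand, momentumIntegrand, inner_sub_right]
  ring

/-- Each term pairs a fixed integrable moment with a quantity built from V and its gradient, which
converges boundedly; dominated convergence then applies term by term. The time derivative is grouped
with the density, since it is not bounded. -/
theorem testIntegrand_eq_bilin (p : ℝ → ℝ) (μ η : ℝ) (ν : Measure (ℝ × Vec N)) (G : Mat N)
    (r dtr : ℝ) (gradr : Vec N →L[ℝ] ℝ) (V Vt : Vec N) (Vx : Mat N) :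
    testIntegrand p μ η ν G r dtr gradr V Vt Vx
      = innerBilin ((∫ z, z.1 ∂ν) • Vt) V
        + (ContinuousLinearMap.id ℝ (Vec N →L[ℝ] ℝ)).flip (∫ z, z.1 • z.2 ∂ν)
          ((innerSL ℝ V).comp Vx - (deriv p r / r) • gradr)
        - contrBilin (∫ z, z.1 • tensorSq z.2 ∂ν) Vx
        - ContinuousLinearMap.mul ℝ ℝ (∫ z, p z.1 ∂ν) (tr Vx)
        + (contrBilin.comp (stressCLM μ η)) G Vx
        + (deriv p r * dtr - inner ℝ (∫ z, z.1 • z.2 ∂ν) Vt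
          - ContinuousLinearMap.mul ℝ ℝ (∫ z, z.1 ∂ν) (deriv p r / r * dtr)) := by
  simp only [testIntegrand, continuityIntegrand, momentumIntegrand, innerBilin_apply,
    inner_smul_left, contrBilin_apply, ContinuousLinearMap.mul_apply', stressCLM_apply,
    ContinuousLinearMap.comp_apply, ContinuousLinearMap.flip_apply, ContinuousLinearMap.id_apply,
    real_inner_comm V Vt]
  simp
  ring

/-- Integrability of functions dominated by a product of a function of time with a density whose
integrals over `Ω` are bounded. -/
theorem integrable_of_time_majorant {T : ℝ} {Ω : Set (Vec N)} {E : Type*} [NormedAddCommGroup E]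
    {f : ℝ × Vec N → E} {w : ℝ × Vec N → ℝ} {K : ℝ} {a : ℝ → ENNReal}
    (hf : AEStronglyMeasurable f (cylMeasure T Ω)) (ha : Measurable a)
    (ha' : ∫⁻ t, a t ∂timeMeasure T < ⊤) (hw : Integrable w (cylMeasure T Ω))
    (hw0 : ∀ᵐ q ∂cylMeasure T Ω, 0 ≤ w q)
    (hK : ∀ᵐ t ∂timeMeasure T, ∫ x in Ω, w (t, x) ≤ K)
    (hle : ∀ᵐ q ∂cylMeasure T Ω, ‖f q‖ₑ ≤ a q.1 * ENNReal.ofReal (w q)) :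
    Integrable f (cylMeasure T Ω) :=
  ⟨hf, (lintegral_mono_ae hle).trans_lt ((lintegral_time_mul_le ha hw hw0 hK).trans_lt
    (ENNReal.mul_lt_top ENNReal.ofReal_lt_top ha'))⟩

section Limit

variable {T : ℝ} {Ω : Set (Vec N)} {p : ℝ → ℝ} {μ η cP : ℝ}
  {ν : ℝ × Vec N → Measure (ℝ × Vec N)} {ν₀ : Vec N → Measure (ℝ × Vec N)} {D : ℝ → ℝ}
  {gradu : ℝ × Vec N → Mat N} {χ ξ : ℝ → ℝ} {r : ℝ → Vec N → ℝ}
  {gradr : ℝ → Vec N → (Vec N →L[ℝ] ℝ)} {U : ℝ → Vec N → Vec N} {gradU : ℝ → Vec N → Mat N}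
  {dtU : ℝ → (closure Ω →ᵇ Vec N)}

/-- As a function of the velocity, `relMean` is a quadratic polynomial with integrable coefficients,
so bounded pointwise convergence suffices. -/
theorem tendsto_integral_relMean {ν' : Vec N → Measure (ℝ × Vec N)} {r' : Vec N → ℝ}
    {V : ℕ → Vec N → Vec N} {V₀ : Vec N → Vec N} {M : ℝ}
    (h1 : Integrable (fun x => ∫ z, energy p z ∂ν' x) (volume.restrict Ω))
    (h2 : Integrable (fun x => ∫ z, z.1 • z.2 ∂ν' x) (volume.restrict Ω))
    (h3 : Integrable (fun x => ∫ z, z.1 ∂ν' x) (volume.restrict Ω))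
    (h4 : Integrable (fun x => (∫ z, z.1 ∂ν' x) * deriv (potential p) (r' x)) (volume.restrict Ω))
    (h5 : Integrable (fun x => p (r' x)) (volume.restrict Ω))
    (hV : ∀ n, AEStronglyMeasurable (V n) (volume.restrict Ω))
    (hM : ∀ n, ∀ᵐ x ∂volume.restrict Ω, ‖V n x‖ ≤ M)
    (hl : ∀ᵐ x ∂volume.restrict Ω, Tendsto (fun n => V n x) atTop (𝓝 (V₀ x))) :
    Tendsto (fun n => ∫ x in Ω, relMean p (ν' x) (r' x) (V n x)) atTop
      (𝓝 (∫ x in Ω, relMean p (ν' x) (r' x) (V₀ x))) := by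
  have k1 := DominatedTendsto.bilin innerBilin h2 hV hM hl
  have k2 := DominatedTendsto.bilin (ContinuousLinearMap.mul ℝ ℝ) h3 (C := 1 / 2 * M ^ 2)
    (w := fun n x => 1 / 2 * ‖V n x‖ ^ 2) (w₀ := fun x => 1 / 2 * ‖V₀ x‖ ^ 2)
    (fun n => ((hV n).norm.pow 2).const_mul _) (fun n => by
      filter_upwards [hM n] with x hx
      rw [Real.norm_of_nonneg (by positivity)]
      gcongr) (by
      filter_upwards [hl] with x hx
      exact (hx.norm.pow 2).const_mul _)
  have k3 := (((DominatedTendsto.const h1).sub k1).add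
    (k2.sub (DominatedTendsto.const h4))).add (DominatedTendsto.const h5)
  have e : ∀ (x : Vec N) (W : Vec N), relMean p (ν' x) (r' x) W
      = (∫ z, energy p z ∂ν' x) - innerBilin (∫ z, z.1 • z.2 ∂ν' x) W
      + (ContinuousLinearMap.mul ℝ ℝ (∫ z, z.1 ∂ν' x) (1 / 2 * ‖W‖ ^ 2)
        - (∫ z, z.1 ∂ν' x) * deriv (potential p) (r' x)) + p (r' x) := by
    intro x W
    rw [relMean, innerBilin_apply, ContinuousLinearMap.mul_apply']
    ring
  simp only [e]
  exact k3.tendsto_integral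

/-- The relative energy inequality with the velocity of a strong solution. -/
theorem ae_relEnergy_strong (hD : IsDissipativeMVSolution T Ω p μ η cP ν ν₀ D gradu χ ξ)
    (hS : IsStrongSolution T Ω p μ η r gradr U gradU dtU) (hT : 0 < T)
    (hΩ : IsOpen Ω) (hb : Bornology.IsBounded Ω) (hne : Ω.Nonempty) (hp : IsPressure p)
    (hμ : 0 ≤ μ) (hη : 0 ≤ η) {M K : ℝ}
    (hU : ∀ t ∈ Icc 0 T, ∀ x ∈ closure Ω, ‖U t x‖ ≤ M)
    (hgU : ∀ t ∈ Icc 0 T, ∀ x ∈ closure Ω, ‖gradU t x‖ ≤ M)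
    (hP : ∀ t ∈ Icc 0 T, ∀ x ∈ closure Ω, |deriv (potential p) (r t x)| ≤ K)
    (hP' : ∀ t ∈ Icc 0 T, ∀ x ∈ closure Ω, ‖(deriv p (r t x) / r t x) • gradr t x‖ ≤ K) :
    ∃ d : ℝ → (closure Ω →ᵇ Vec N), StronglyMeasurable d ∧ d =ᵐ[timeMeasure T] dtU ∧
      Integrable (fun q => testIntegrand p μ η (ν q) (gradu q) (r q.1 q.2)
        (dtDensity r gradr U gradU q.1 q.2) (gradr q.1 q.2) (U q.1 q.2) (extendZero d q.1 q.2)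
        (gradU q.1 q.2)) (cylMeasure T Ω) ∧
      ∀ᵐ τ ∂timeMeasure T,
        (∫ x in Ω, relMean p (ν (τ, x)) (r τ x) (U τ x))
          + cylInt Ω τ (fun q => contr (stress μ η (gradu q)) (gradu q)) + D τ
        ≤ (∫ x in Ω, relMean p (ν₀ x) (r 0 x) (U 0 x))
          + cylInt Ω τ (fun q => testIntegrand p μ η (ν q) (gradu q) (r q.1 q.2)
              (dtDensity r gradr U gradU q.1 q.2) (gradr q.1 q.2) (U q.1 q.2)
              (extendZero d q.1 q.2) (gradU q.1 q.2))
          + 2 * (M + M ^ 2 + K) * ∫ t in (0 : ℝ)..τ, (|χ t| + |ξ t|) * D t := by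
  obtain ⟨d, V, Vt, Vx, κ, hdm, hdi, hdU, hC1, hV0, hVM, hlim, hκm, hκ0, hκ⟩ :=
    hS.exists_test_approx hT hΩ hU hgU
  obtain ⟨w, Kw, hwi, hw, hwK⟩ := hD.exists_majorant hb hp hμ hη
  have hfin := isFiniteMeasure_cyl (T := T) hb
  have h0 : (0 : ℝ) ∈ Icc 0 T := ⟨le_rfl, hT.le⟩
  obtain ⟨x₀, hx₀⟩ := hne
  have hM0 : 0 ≤ M := (norm_nonneg _).trans (hU 0 h0 x₀ (subset_closure hx₀))
  have hK0 : 0 ≤ K := (abs_nonneg _).trans (hP 0 h0 x₀ (subset_closure hx₀))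
  have hw0 : ∀ᵐ q ∂cylMeasure T Ω, 0 ≤ w q := by
    filter_upwards [hw] with q hq
    exact (by positivity : (0 : ℝ) ≤ |∫ z, z.1 ∂ν q| + ‖∫ z, z.1 • z.2 ∂ν q‖).trans hq
  have hdU' := measurable_extendZero hdm
  have hdae : ∫⁻ t, ‖d t‖ₑ ∂timeMeasure T < ⊤ := (hdi.mono_measure Measure.restrict_le_self).2
  have hden : Measurable fun t => ‖d t‖ₑ := hdm.enorm
  have hdn : ∀ q : ℝ × Vec N, ‖extendZero d q.1 q.2‖ₑ ≤ ‖d q.1‖ₑ := fun q =>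
    enorm_le_iff_norm_le.2 (norm_extendZero_le d q.1 q.2)
  -- the terms with the time derivative
  have iρ : Integrable (fun q => (∫ z, z.1 ∂ν q) • extendZero d q.1 q.2) (cylMeasure T Ω) := by
    refine integrable_of_time_majorant
      (hD.int_density.2.1.smul hdU'.aestronglyMeasurable) hden hdae hwi hw0 hwK ?_
    filter_upwards [hw] with q hq
    rw [enorm_smul, mul_comm]
    refine mul_le_mul' (hdn q) ?_
    rw [← ofReal_norm, Real.norm_eq_abs]
    exact ENNReal.ofReal_le_ofReal (by linarith [norm_nonneg (∫ z, z.1 • z.2 ∂ν q)])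
  have im : Integrable (fun q => inner ℝ (∫ z, z.1 • z.2 ∂ν q) (extendZero d q.1 q.2))
      (cylMeasure T Ω) := by
    refine integrable_of_time_majorant
      (hD.int_momentum.2.1.inner hdU'.aestronglyMeasurable) hden hdae hwi hw0 hwK ?_
    filter_upwards [hw] with q hq
    have h1 : ‖inner ℝ (∫ z, z.1 • z.2 ∂ν q) (extendZero d q.1 q.2)‖ₑ
        ≤ ‖∫ z, z.1 • z.2 ∂ν q‖ₑ * ‖extendZero d q.1 q.2‖ₑ := by
      simp only [← ofReal_norm]
      rw [← ENNReal.ofReal_mul (norm_nonneg _)]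
      exact ENNReal.ofReal_le_ofReal (norm_inner_le_norm _ _)
    refine h1.trans ?_
    rw [mul_comm]
    refine mul_le_mul' (hdn q) ?_
    rw [← ofReal_norm]
    exact ENNReal.ofReal_le_ofReal (by linarith [abs_nonneg (∫ z, z.1 ∂ν q)])
  -- A single constant for both test functions and their gradients: the four quantities are at most
  -- M, M, ½M² + K and M² + K.
  have hbd : ∀ n, ∀ t ∈ Icc 0 T, ∀ x ∈ closure Ω, ‖V n t x‖ ≤ M + M ^ 2 + K ∧
      ‖Vx n t x‖ ≤ M + M ^ 2 + K ∧
      ‖1 / 2 * ‖V n t x‖ ^ 2 - deriv (potential p) (r t x)‖ ≤ M + M ^ 2 + K ∧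
      ‖(innerSL ℝ (V n t x)).comp (Vx n t x) - (deriv p (r t x) / r t x) • gradr t x‖
        ≤ M + M ^ 2 + K := by
    intro n t ht x hx
    obtain ⟨h1, h2⟩ := hVM n t ht x hx
    have h3 := hP t ht x hx
    have h4 := hP' t ht x hx
    have h5 : ‖V n t x‖ ^ 2 ≤ M ^ 2 := by gcongr
    refine ⟨by nlinarith, by nlinarith, ?_, ?_⟩
    · refine (norm_sub_le _ _).trans ?_
      rw [Real.norm_of_nonneg (by positivity), Real.norm_eq_abs]
      nlinarith
    · refine (norm_sub_le _ _).trans ?_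
      have h6 : ‖(innerSL ℝ (V n t x)).comp (Vx n t x)‖ ≤ M * M := by
        refine (ContinuousLinearMap.opNorm_comp_le _ _).trans ?_
        rw [innerSL_apply_norm]
        gcongr
      nlinarith
  have hmem : ∀ᵐ q ∂cylMeasure T Ω, q.1 ∈ Icc 0 T ∧ q.2 ∈ closure Ω := by
    filter_upwards [ae_mem_cyl hΩ] with q hq
    exact ⟨Ioo_subset_Icc_self hq.1, subset_closure hq.2⟩
  have mV : ∀ n, AEStronglyMeasurable (fun q : ℝ × Vec N => V n q.1 q.2) (cylMeasure T Ω) :=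
    fun n => aestronglyMeasurable_cyl hΩ (hC1 n).cont
  have mVx : ∀ n, AEStronglyMeasurable (fun q : ℝ × Vec N => Vx n q.1 q.2) (cylMeasure T Ω) :=
    fun n => aestronglyMeasurable_cyl hΩ (hC1 n).cont_x
  have bVx : ∀ n, ∀ᵐ q ∂cylMeasure T Ω, ‖Vx n q.1 q.2‖ ≤ M := fun n => by
    filter_upwards [hmem] with q hq using (hVM n q.1 hq.1 q.2 hq.2).2
  have lVx : ∀ᵐ q ∂cylMeasure T Ω, Tendsto (fun n => Vx n q.1 q.2) atTop (𝓝 (gradU q.1 q.2)) := by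
    filter_upwards [hmem] with q hq using (hlim q.1 hq.1 q.2 hq.2).2
  have lV : ∀ᵐ q ∂cylMeasure T Ω, Tendsto (fun n => V n q.1 q.2) atTop (𝓝 (U q.1 q.2)) := by
    filter_upwards [hmem] with q hq using (hlim q.1 hq.1 q.2 hq.2).1
  have d1 := DominatedTendsto.bilin innerBilin iρ mV (fun n => by
    filter_upwards [hmem] with q hq using (hVM n q.1 hq.1 q.2 hq.2).1) lV
  have d2 := DominatedTendsto.bilin (ContinuousLinearMap.id ℝ (Vec N →L[ℝ] ℝ)).flip
    hD.int_momentum.2 (w := fun n q => (innerSL ℝ (V n q.1 q.2)).comp (Vx n q.1 q.2)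
      - (deriv p (r q.1 q.2) / r q.1 q.2) • gradr q.1 q.2)
    (w₀ := fun q => (innerSL ℝ (U q.1 q.2)).comp (gradU q.1 q.2)
      - (deriv p (r q.1 q.2) / r q.1 q.2) • gradr q.1 q.2)
    (fun n => aestronglyMeasurable_cyl hΩ (g := fun t x => (innerSL ℝ (V n t x)).comp (Vx n t x)
      - (deriv p (r t x) / r t x) • gradr t x) (hS.isC1_test hp (hC1 n)).cont_x)
    (fun n => by
      filter_upwards [hmem] with q hq using (hbd n q.1 hq.1 q.2 hq.2).2.2.2) (by
      filter_upwards [lV, lVx] with q h1 h2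
      have hc : Continuous fun y : Vec N × Mat N => (innerSL ℝ y.1).comp y.2 :=
        ((innerSL ℝ).continuous.comp continuous_fst).clm_comp continuous_snd
      exact ((hc.tendsto _).comp (h1.prodMk_nhds h2)).sub_const _)
  have d3 := DominatedTendsto.bilin contrBilin hD.int_convective.2 mVx bVx lVx
  have d4 := DominatedTendsto.bilin (ContinuousLinearMap.mul ℝ ℝ) hD.int_pressure.2
    (w := fun n q => tr (Vx n q.1 q.2)) (w₀ := fun q => tr (gradU q.1 q.2)) (C := N * M)
    (fun n => continuous_tr.comp_aestronglyMeasurable (mVx n)) (fun n => by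
      filter_upwards [bVx n] with q hq
      refine (abs_tr_le _).trans ?_
      gcongr) (by
      filter_upwards [lVx] with q h1
      exact (continuous_tr.tendsto _).comp h1)
  have d5 := DominatedTendsto.bilin (contrBilin.comp (stressCLM μ η))
    (hD.velocity_mem.2.1.integrable (by norm_num)) mVx bVx lVx
  have i6 := integrable_cyl_of_continuousOn hΩ hb (T := T) (g := fun t x => deriv p (r t x)
      * dtDensity r gradr U gradU t x)
    ((hS.continuousOn_comp_density hp.continuousOn_deriv).mul hS.continuousOn_dtDensity)
  have i7 := integrable_bilin_cyl hΩ hb (ContinuousLinearMap.mul ℝ ℝ) hD.int_density.2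
      (g := fun t x => deriv p (r t x) / r t x * dtDensity r gradr U gradU t x)
      ((hS.continuousOn_deriv_div hp).mul hS.continuousOn_dtDensity)
  have dJ : DominatedTendsto (cylMeasure T Ω)
      (fun n q => testIntegrand p μ η (ν q) (gradu q) (r q.1 q.2)
        (dtDensity r gradr U gradU q.1 q.2) (gradr q.1 q.2) (V n q.1 q.2) (extendZero d q.1 q.2)
        (Vx n q.1 q.2))
      (fun q => testIntegrand p μ η (ν q) (gradu q) (r q.1 q.2)
        (dtDensity r gradr U gradU q.1 q.2) (gradr q.1 q.2) (U q.1 q.2) (extendZero d q.1 q.2)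
        (gradU q.1 q.2)) := by
    simp only [testIntegrand_eq_bilin]
    exact ((((d1.add d2).sub d3).sub d4).add d5).add
      (DominatedTendsto.const ((i6.sub im).sub i7))
  -- the error of the time derivative
  set err : ℕ → ℝ × Vec N → ℝ := fun n q =>
    (∫ z, z.1 ∂ν q) * inner ℝ (V n q.1 q.2) (Vt n q.1 q.2 - extendZero d q.1 q.2)
      - inner ℝ (∫ z, z.1 • z.2 ∂ν q) (Vt n q.1 q.2 - extendZero d q.1 q.2) with herr
  have ierr : ∀ n, Integrable (err n) (cylMeasure T Ω) := by
    intro n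
    have e1 := integrable_bilin_cyl hΩ hb (ContinuousLinearMap.mul ℝ ℝ) hD.int_density.2
      (g := fun t x => inner ℝ (V n t x) (Vt n t x)) ((hC1 n).cont.inner (hC1 n).cont_t)
    have e2 := integrable_bilin_cyl hΩ hb innerBilin hD.int_momentum.2
      (g := Vt n) (hC1 n).cont_t
    have e3 := d1.integrable_seq n
    refine ((e1.sub e3).sub (e2.sub im)).congr (Eventually.of_forall fun q => ?_)
    simp only [herr, Pi.sub_apply, ContinuousLinearMap.mul_apply', innerBilin_apply,
      inner_smul_left, inner_sub_right, real_inner_comm (V n q.1 q.2) (extendZero d q.1 q.2)]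
    simp
    ring
  -- Pointwise the error is at most (M|ρ| + |m|) κ_n(t), where ρ and m are the means of density and
  -- momentum; both are dominated by w.
  have hle : ∀ n, ∫⁻ q, ‖err n q‖ₑ ∂cylMeasure T Ω
      ≤ ENNReal.ofReal ((M + 1) * Kw) * ∫⁻ t, κ n t := by
    intro n
    have h1 := lintegral_time_mul_le (w := fun q => (M + 1) * w q) (K := (M + 1) * Kw) (hκm n)
      (hwi.const_mul (M + 1)) (by
        filter_upwards [hw0] with q hq
        positivity) (by
        filter_upwards [hwK] with t ht
        rw [integral_const_mul]
        gcongr)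
    refine (lintegral_mono_ae ?_).trans (h1.trans ?_)
    · filter_upwards [hw, hmem] with q hq hqm
      have h2 := hκ n q.1 hqm.1 ⟨q.2, hqm.2⟩
      rw [← extendZero_of_mem d q.1 hqm.2] at h2
      refine le_trans ?_ (mul_le_mul_left h2 _)
      rw [← ofReal_norm, ← ofReal_norm, ← ENNReal.ofReal_mul (norm_nonneg _)]
      refine ENNReal.ofReal_le_ofReal ?_
      simp only [herr]
      set δ := Vt n q.1 q.2 - extendZero d q.1 q.2
      have h3 := (hVM n q.1 hqm.1 q.2 hqm.2).1
      have h4 : |inner ℝ (V n q.1 q.2) δ| ≤ M * ‖δ‖ :=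
        (abs_real_inner_le_norm _ _).trans (by gcongr)
      have h5 := abs_real_inner_le_norm (∫ z, z.1 • z.2 ∂ν q) δ
      refine (norm_sub_le _ _).trans ?_
      rw [Real.norm_eq_abs, Real.norm_eq_abs, abs_mul]
      have h6 : |∫ z, z.1 ∂ν q| * |inner ℝ (V n q.1 q.2) δ| ≤ |∫ z, z.1 ∂ν q| * (M * ‖δ‖) := by
        gcongr
      have a1 := abs_nonneg (∫ z, z.1 ∂ν q)
      have a2 := norm_nonneg (∫ z, z.1 • z.2 ∂ν q)
      have a3 := norm_nonneg δ
      have h7 : ‖δ‖ * (M + 1) * (|∫ z, z.1 ∂ν q| + ‖∫ z, z.1 • z.2 ∂ν q‖)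
          ≤ ‖δ‖ * (M + 1) * w q := by gcongr
      have b1 := mul_nonneg a1 a3
      have b2 := mul_nonneg hM0 (mul_nonneg a2 a3)
      nlinarith
    · gcongr
      exact Measure.restrict_le_self
  have herr0 : Tendsto (fun n => ∫⁻ q, ‖err n q‖ₑ ∂cylMeasure T Ω) atTop (𝓝 0) := by
    have h1 : Tendsto (fun n => ENNReal.ofReal ((M + 1) * Kw) * ∫⁻ t, κ n t) atTop (𝓝 0) := by
      have := ENNReal.Tendsto.const_mul (a := ENNReal.ofReal ((M + 1) * Kw)) hκ0
        (Or.inr ENNReal.ofReal_ne_top)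
      simpa using this
    exact tendsto_of_tendsto_of_tendsto_of_le_of_le tendsto_const_nhds h1
      (fun n => zero_le) hle
  refine ⟨d, hdm, hdU, dJ.integrable, ?_⟩
  have hmemT : ∀ᵐ τ ∂timeMeasure T, τ ∈ Ioo 0 T := ae_restrict_mem measurableSet_Ioo
  have hmemΩ : ∀ᵐ x ∂volume.restrict Ω, x ∈ closure Ω := by
    filter_upwards [ae_restrict_mem hΩ.measurableSet] with x hx using subset_closure hx
  have mslice : ∀ n, ∀ t ∈ Icc 0 T, AEStronglyMeasurable (V n t) (volume.restrict Ω) :=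
    fun n t ht => ((ContinuousOn.slice (hC1 n).cont ht).mono subset_closure).aestronglyMeasurable
      hΩ.measurableSet
  have cP' : ContinuousOn (fun q : ℝ × Vec N => deriv (potential p) (r q.1 q.2))
      (Icc 0 T ×ˢ closure Ω) := hS.continuousOn_comp_density hp.continuousOn_deriv_potential
  have cp : ContinuousOn (fun q : ℝ × Vec N => p (r q.1 q.2)) (Icc 0 T ×ˢ closure Ω) :=
    hS.continuousOn_comp_density (hp.continuousOn.mono Ioi_subset_Ici_self)
  filter_upwards [ae_relEnergy_test hD hS hT.le hΩ hb ⟨x₀, hx₀⟩ hp (M + M ^ 2 + K), hmemT,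
    ae_integrable_slice hD.int_energy.2, ae_integrable_slice hD.int_momentum.2,
    ae_integrable_slice hD.int_density.2] with τ hτ hτT s1 s2 s3
  have hτI := Ioo_subset_Icc_self hτT
  have L1 := tendsto_integral_relMean (p := p) (r' := r τ) s1 s2 s3
    (integrable_bilin_slice hΩ hb (ContinuousLinearMap.mul ℝ ℝ) s3
      (ContinuousOn.slice (g := fun t x => deriv (potential p) (r t x)) cP' hτI))
    (integrable_slice_of_continuousOn hΩ hb (ContinuousOn.slice (g := fun t x => p (r t x)) cp hτI))
    (fun n => mslice n τ hτI) (fun n => by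
      filter_upwards [hmemΩ] with x hx using (hVM n τ hτI x hx).1) (by
      filter_upwards [hmemΩ] with x hx using (hlim τ hτI x hx).1)
  have L0 := tendsto_integral_relMean (p := p) (r' := r 0) hD.int_init_energy.2
    hD.int_init_momentum.2 hD.int_init_density.2
    (integrable_bilin_slice hΩ hb (ContinuousLinearMap.mul ℝ ℝ) hD.int_init_density.2
      (ContinuousOn.slice (g := fun t x => deriv (potential p) (r t x)) cP' h0))
    (integrable_slice_of_continuousOn hΩ hb (ContinuousOn.slice (g := fun t x => p (r t x)) cp h0))
    (fun n => mslice n 0 h0) (fun n => by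
      filter_upwards [hmemΩ] with x hx using (hVM n 0 h0 x hx).1) (by
      filter_upwards [hmemΩ] with x hx using (hlim 0 h0 x hx).1)
  have hmono : cylMeasure τ Ω ≤ cylMeasure T Ω :=
    Measure.restrict_mono (prod_mono (Ioo_subset_Ioo_right hτI.2) le_rfl) le_rfl
  have LJ : Tendsto (fun n => cylInt Ω τ (fun q => testIntegrand p μ η (ν q) (gradu q) (r q.1 q.2)
        (dtDensity r gradr U gradU q.1 q.2) (gradr q.1 q.2) (V n q.1 q.2) (Vt n q.1 q.2)
        (Vx n q.1 q.2))) atTop (𝓝 (cylInt Ω τ (fun q => testIntegrand p μ η (ν q) (gradu q)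
        (r q.1 q.2) (dtDensity r gradr U gradU q.1 q.2) (gradr q.1 q.2) (U q.1 q.2)
        (extendZero d q.1 q.2) (gradU q.1 q.2)))) := by
    have k1 := (dJ.mono_measure hmono).tendsto_integral
    have k2 := tendsto_integral_of_L1 (μ := cylMeasure τ Ω) (l := atTop) (F := err) 0
      aestronglyMeasurable_zero (Eventually.of_forall fun n => (ierr n).mono_measure hmono) (by
        simp only [Pi.zero_apply, sub_zero]
        exact tendsto_of_tendsto_of_tendsto_of_le_of_le tendsto_const_nhds herr0
          (fun n => zero_le) (fun n => lintegral_mono' hmono le_rfl))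
    rw [cylInt_eq_integral hτI dJ.integrable]
    have k3 := k1.add k2
    simp only [Pi.zero_apply, integral_zero, add_zero] at k3
    refine k3.congr fun n => ?_
    simp only [fun q : ℝ × Vec N => testIntegrand_eq_add p μ η (ν q) (gradu q) (r q.1 q.2)
        (dtDensity r gradr U gradU q.1 q.2) (gradr q.1 q.2) (V n q.1 q.2) (Vt n q.1 q.2)
        (extendZero d q.1 q.2) (Vx n q.1 q.2)]
    rw [cylInt_add hτI (dJ.integrable_seq n) (ierr n), cylInt_eq_integral hτI (dJ.integrable_seq n),
      cylInt_eq_integral hτI (ierr n)]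
  -- The inequality holds at this τ for all n at once, because its null set does not depend on the
  -- test velocity.
  exact le_of_tendsto_of_tendsto' ((L1.add_const _).add_const _) ((L0.add LJ).add_const _)
    fun n => hτ (V n) (Vt n) (Vx n) (hC1 n) (hV0 n) (hbd n)

end Limit

/-! ### The relative energy identity -/

/-- The vector `∂_t U + U · ∇U + p'(r) / r ∇r`. -/
def forcing (p : ℝ → ℝ) (r : ℝ) (gradr : Vec N →L[ℝ] ℝ) (U a : Vec N) (A : Mat N) : Vec N :=
  a + A U + (deriv p r / r) • (InnerProductSpace.toDual ℝ (Vec N)).symm gradr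

/-- The remainder of the relative energy inequality for a strong solution. -/
def remainder (p : ℝ → ℝ) (r : ℝ) (gradr : Vec N →L[ℝ] ℝ) (U a : Vec N) (A : Mat N)
    (z : ℝ × Vec N) : ℝ :=
  (z.1 - r) * inner ℝ (U - z.2) (forcing p r gradr U a A) + z.1 * inner ℝ (U - z.2) (A (z.2 - U))
    - tr A * (p z.1 - deriv p r * (z.1 - r) - p r)

/-- Written as an affine function of s, s v, v, s v⊗v and p(s), all of which are integrable, the
remainder can be averaged over the Young measure. -/
theorem remainder_eq (p : ℝ → ℝ) (r : ℝ) (gradr : Vec N →L[ℝ] ℝ) (U a : Vec N) (A : Mat N)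
    (z : ℝ × Vec N) :
    remainder p r gradr U a A z
      = (inner ℝ U (forcing p r gradr U a A) - inner ℝ U (A U) + tr A * deriv p r) * z.1
        + ((innerSL ℝ U).comp A - innerSL ℝ (forcing p r gradr U a A) + innerSL ℝ (A U))
          (z.1 • z.2)
        + r * innerSL ℝ (forcing p r gradr U a A) z.2
        - contrCLM A (z.1 • tensorSq z.2) - tr A * p z.1
        + (tr A * (p r - deriv p r * r) - r * inner ℝ U (forcing p r gradr U a A)) := by
  simp only [remainder, contrCLM_apply, contr_tensorSq, map_sub, map_smul,
    inner_sub_left, inner_sub_right, add_apply, sub_apply,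
    ContinuousLinearMap.comp_apply, innerSL_apply_apply, smul_eq_mul,
    real_inner_comm z.2 (forcing p r gradr U a A), real_inner_comm z.2 (A U)]
  ring

section Moments

variable {p : ℝ → ℝ} {ν : Measure (ℝ × Vec N)} [IsProbabilityMeasure ν]

theorem integrable_remainder (h1 : Integrable (fun z => z.1) ν)
    (h2 : Integrable (fun z => z.2) ν) (h3 : Integrable (fun z => z.1 • z.2) ν)
    (h4 : Integrable (fun z => z.1 • tensorSq z.2) ν) (h5 : Integrable (fun z => p z.1) ν)
    (r : ℝ) (gradr : Vec N →L[ℝ] ℝ) (U a : Vec N) (A : Mat N) :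
    Integrable (remainder p r gradr U a A) ν := by
  have : remainder p r gradr U a A = fun z => _ := funext (remainder_eq p r gradr U a A)
  rw [this]
  exact (((((h1.const_mul _).add (ContinuousLinearMap.integrable_comp _ h3)).add
    ((ContinuousLinearMap.integrable_comp _ h2).const_mul r)).sub
    (ContinuousLinearMap.integrable_comp _ h4)).sub (h5.const_mul _)).add (integrable_const _)

theorem integral_remainder (h1 : Integrable (fun z => z.1) ν)
    (h2 : Integrable (fun z => z.2) ν) (h3 : Integrable (fun z => z.1 • z.2) ν)
    (h4 : Integrable (fun z => z.1 • tensorSq z.2) ν) (h5 : Integrable (fun z => p z.1) ν)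
    (r : ℝ) (gradr : Vec N →L[ℝ] ℝ) (U a : Vec N) (A : Mat N) :
    ∫ z, remainder p r gradr U a A z ∂ν
      = (inner ℝ U (forcing p r gradr U a A) - inner ℝ U (A U) + tr A * deriv p r) * (∫ z, z.1 ∂ν)
        + ((innerSL ℝ U).comp A - innerSL ℝ (forcing p r gradr U a A) + innerSL ℝ (A U))
          (∫ z, z.1 • z.2 ∂ν)
        + r * innerSL ℝ (forcing p r gradr U a A) (∫ z, z.2 ∂ν)
        - contrCLM A (∫ z, z.1 • tensorSq z.2 ∂ν) - tr A * (∫ z, p z.1 ∂ν)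
        + (tr A * (p r - deriv p r * r) - r * inner ℝ U (forcing p r gradr U a A)) := by
  simp only [remainder_eq]
  set ℓ := (innerSL ℝ U).comp A - innerSL ℝ (forcing p r gradr U a A) + innerSL ℝ (A U)
  set c := forcing p r gradr U a A
  have i1 := h1.const_mul (inner ℝ U c - inner ℝ U (A U) + tr A * deriv p r)
  have i2 := ℓ.integrable_comp h3
  have i3 := ((innerSL ℝ c).integrable_comp h2).const_mul r
  have i4 := (contrCLM A).integrable_comp h4
  have i5 := h5.const_mul (tr A)
  rw [integral_add (by exact (((i1.add i2).add i3).sub i4).sub i5) (integrable_const _),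
    integral_sub (by exact ((i1.add i2).add i3).sub i4) i5,
    integral_sub (by exact (i1.add i2).add i3) i4, integral_add (by exact i1.add i2) i3,
    integral_add i1 i2, integral_const_mul, integral_const_mul, integral_const_mul,
    ContinuousLinearMap.integral_comp_comm _ h3, ContinuousLinearMap.integral_comp_comm _ h2,
    ContinuousLinearMap.integral_comp_comm _ h4]
  simp

/-- The pointwise form of the relative energy identity. -/
theorem testIntegrand_eq_remainder (h1 : Integrable (fun z => z.1) ν)
    (h2 : Integrable (fun z => z.2) ν) (h3 : Integrable (fun z => z.1 • z.2) ν)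
    (h4 : Integrable (fun z => z.1 • tensorSq z.2) ν) (h5 : Integrable (fun z => p z.1) ν)
    {r : ℝ} (hr : r ≠ 0) (gradr : Vec N →L[ℝ] ℝ) (U a : Vec N) (A G : Mat N) (μ η : ℝ) :
    ∫ z, remainder p r gradr U a A z ∂ν
      = testIntegrand p μ η ν G r (-(gradr U + r * tr A)) gradr U a A
        - contr (stress μ η G) G + contr (stress μ η (G - A)) (G - A)
        + (contr (stress μ η A) (G - A) + inner ℝ (r • (a + A U)
          + deriv p r • (InnerProductSpace.toDual ℝ (Vec N)).symm gradr) ((∫ z, z.2 ∂ν) - U))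
        + tr (p r • A + (deriv p r • gradr).smulRight U) := by
  rw [integral_remainder h1 h2 h3 h4 h5]
  have hgr : ∀ v : Vec N, inner ℝ ((InnerProductSpace.toDual ℝ (Vec N)).symm gradr) v = gradr v :=
    fun v => InnerProductSpace.toDual_symm_apply
  have hgr' : inner ℝ U ((InnerProductSpace.toDual ℝ (Vec N)).symm gradr) = gradr U := by
    rw [real_inner_comm, hgr]
  have htr : tr (p r • A + (deriv p r • gradr).smulRight U) = p r * tr A + deriv p r * gradr U := by
    rw [← trCLM_apply, map_add, trCLM_apply, trCLM_apply, tr_smul, tr_rankOne_comp]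
    simp
  have hst : stress μ η (G - A) = stress μ η G - stress μ η A := by
    simp only [← stressCLM_apply, map_sub]
  rw [htr, hst]
  simp only [testIntegrand, continuityIntegrand, momentumIntegrand, forcing, contrCLM_apply,
    contr_sub_left, contr_sub_right, add_apply, sub_apply,
    ContinuousLinearMap.comp_apply, smul_apply, innerSL_apply_apply,
    inner_add_left, inner_add_right, inner_sub_right, real_inner_smul_left, real_inner_smul_right,
    hgr, smul_eq_mul, real_inner_comm U a, real_inner_comm U (A U),
    hgr',
    real_inner_comm (∫ z, z.1 • z.2 ∂ν) a]
  field_simp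
  ring

end Moments

/-! ### Estimate of the remainder -/

/-- The remainder is controlled by the relative energy. -/
theorem IsPressure.exists_remainder_le {p : ℝ → ℝ} (hp : IsPressure p) {M : ℝ} (hM : 1 ≤ M) {δ : ℝ}
    (hδ : 0 < δ) : ∃ C : ℝ, 0 ≤ C ∧ ∀ r ∈ Icc M⁻¹ M, ∀ (gradr : Vec N →L[ℝ] ℝ) (U a : Vec N)
      (A : Mat N), ‖gradr‖ ≤ M → ‖U‖ ≤ M → ‖A‖ ≤ M → ∀ z : ℝ × Vec N, 0 ≤ z.1 →
      remainder p r gradr U a A z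
        ≤ C * (1 + ‖a‖ ^ 2) * relEnergy p r U z + δ * ‖z.2 - U‖ ^ 2 := by
  obtain ⟨C, hC, hco⟩ := hp.coercive hM
  have hM0 : 0 < M := by linarith
  have hMi : 0 < M⁻¹ := inv_pos.2 hM0
  have hI : Icc M⁻¹ M ⊆ Ioi 0 := fun r hr => hMi.trans_le hr.1
  obtain ⟨K, hK⟩ := isCompact_Icc.exists_bound_of_continuousOn
    (f := fun r => deriv p r / r) ((hp.continuousOn_deriv.mono hI).div continuousOn_id
      fun r hr => (hI hr).ne')
  have hK0 : 0 ≤ K := (norm_nonneg _).trans (hK M ⟨by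
    exact (inv_le_one_of_one_le₀ hM).trans hM, le_rfl⟩)
  -- Bounds U·∇U + p'(r)/r ∇r, so that the forcing is at most ‖a‖ + c₀.
  set c₀ := M * M + K * M with hc₀
  have hc₀0 : 0 ≤ c₀ := by positivity
  set L := C * (M ^ 2 / (4 * δ) + 1 / (4 * δ) + 1 / 2) with hL
  have hL0 : 0 ≤ L := by positivity
  -- The convective term is at most 2M times the kinetic density, and one further kinetic density is
  -- spent in `key`. The pressure term costs N·M·C, and the forcing term costs L times the bound for
  -- its square, 2(1 + c₀²)(1 + ‖a‖²).
  refine ⟨1 + 2 * M + N * M * C + L * (2 * (1 + c₀ ^ 2)), by positivity, ?_⟩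
  intro r hr gradr U a A hg hU hA z hz
  have hr0 : 0 < r := hI hr
  obtain ⟨k1, k2, k3, k4⟩ := hco r hr z.1 hz
  have hH := hp.relPotential_nonneg hr0 hz
  set H := potential p z.1 - deriv (potential p) r * (z.1 - r) - potential p r with hHdef
  set y := ‖z.2 - U‖ with hy
  have hy0 : 0 ≤ y := norm_nonneg _
  set B := ‖forcing p r gradr U a A‖ with hB
  have hB0 : 0 ≤ B := norm_nonneg _
  have hBle : B ≤ ‖a‖ + c₀ := by
    have e1 : ‖A U‖ ≤ M * M := (A.le_opNorm U).trans (by gcongr)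
    have e2 : ‖(deriv p r / r) • (InnerProductSpace.toDual ℝ (Vec N)).symm gradr‖ ≤ K * M := by
      rw [norm_smul, LinearIsometryEquiv.norm_map]
      exact mul_le_mul (hK r hr) hg (norm_nonneg _) hK0
    have := norm_add₃_le (a := a) (b := A U)
      (c := (deriv p r / r) • (InnerProductSpace.toDual ℝ (Vec N)).symm gradr)
    rw [hB, forcing]
    linarith
  have hB2 : B ^ 2 ≤ 2 * (1 + c₀ ^ 2) * (1 + ‖a‖ ^ 2) := by
    have e1 : B ^ 2 ≤ (‖a‖ + c₀) ^ 2 := by gcongr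
    have e2 := sq_nonneg (‖a‖ - c₀)
    have e3 : 0 ≤ c₀ ^ 2 * ‖a‖ ^ 2 := by positivity
    linarith
  have hE : relEnergy p r U z = 1 / 2 * z.1 * y ^ 2 + H := by
    rw [relEnergy, hHdef, hy]; ring
  have hE0 : 0 ≤ 1 / 2 * z.1 * y ^ 2 := by positivity
  have hyU : ‖U - z.2‖ = y := norm_sub_rev _ _
  -- the three terms
  have t1 : (z.1 - r) * inner ℝ (U - z.2) (forcing p r gradr U a A) ≤ |z.1 - r| * (y * B) := by
    refine (le_abs_self _).trans ?_
    rw [abs_mul]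
    have := abs_real_inner_le_norm (U - z.2) (forcing p r gradr U a A)
    rw [hyU] at this
    gcongr
  have t2 : z.1 * inner ℝ (U - z.2) (A (z.2 - U)) ≤ z.1 * (M * y ^ 2) := by
    refine mul_le_mul_of_nonneg_left ?_ hz
    refine (real_inner_le_norm _ _).trans ?_
    have e1 : ‖A (z.2 - U)‖ ≤ M * y := (A.le_opNorm _).trans (by gcongr)
    rw [hyU]
    calc y * ‖A (z.2 - U)‖ ≤ y * (M * y) := by gcongr
      _ = M * y ^ 2 := by ring
  have t3 : -(tr A * (p z.1 - deriv p r * (z.1 - r) - p r)) ≤ N * M * (C * H) := by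
    refine (neg_le_abs _).trans ?_
    rw [abs_mul]
    have e1 : |tr A| ≤ N * M := (abs_tr_le A).trans (by gcongr)
    exact mul_le_mul e1 k1 (abs_nonneg _) (by positivity)
  have young : ∀ q : ℝ, q * (y * B) ≤ δ * y ^ 2 + q ^ 2 * B ^ 2 / (4 * δ) := by
    intro q
    have e1 : 0 ≤ (2 * δ * y - q * B) ^ 2 / (4 * δ) := by positivity
    have e2 : (2 * δ * y - q * B) ^ 2 / (4 * δ)
        = δ * y ^ 2 + q ^ 2 * B ^ 2 / (4 * δ) - q * (y * B) := by
      field_simp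
      ring
    linarith
  have hCH : 0 ≤ C * H := mul_nonneg hC.le hH
  -- Three ranges of s. For s ≤ 1/(2M), |s - r| ≤ M and 1 ≤ C·H; in the middle range (s - r)² ≤ C·H;
  -- in both, Young's inequality spends δy². For s ≥ 2M, |s - r| ≤ s ≤ C·H, and the kinetic density
  -- ½ s y² takes the velocity instead.
  have key : |z.1 - r| * (y * B) ≤ δ * y ^ 2 + 1 / 2 * z.1 * y ^ 2 + L * B ^ 2 * H := by
    have p1 : 0 ≤ C * (M ^ 2 / (4 * δ)) * B ^ 2 * H := by positivity
    have p2 : 0 ≤ C * (1 / (4 * δ)) * B ^ 2 * H := by positivity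
    have p3 : 0 ≤ C * (1 / 2) * B ^ 2 * H := by positivity
    have hsplit : L * B ^ 2 * H = C * (M ^ 2 / (4 * δ)) * B ^ 2 * H
      + C * (1 / (4 * δ)) * B ^ 2 * H + C * (1 / 2) * B ^ 2 * H := by rw [hL]; ring
    have hy2 : 0 ≤ δ * y ^ 2 := by positivity
    rcases le_total z.1 (2 * M)⁻¹ with h | h
    · have e0 : (2 * M)⁻¹ ≤ M := by
        have : (2 * M)⁻¹ ≤ 1 := inv_le_one_of_one_le₀ (by linarith)
        linarith
      have e1 : |z.1 - r| ≤ M := by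
        rw [abs_le]; constructor <;> linarith [hr.2]
      have e2 := young M
      have e3 : |z.1 - r| * (y * B) ≤ M * (y * B) := by gcongr
      have e4 : M ^ 2 * B ^ 2 / (4 * δ) ≤ C * (M ^ 2 / (4 * δ)) * B ^ 2 * H := by
        calc M ^ 2 * B ^ 2 / (4 * δ) = M ^ 2 * B ^ 2 / (4 * δ) * 1 := by ring
          _ ≤ M ^ 2 * B ^ 2 / (4 * δ) * (C * H) := by gcongr; exact k2 h
          _ = _ := by ring
      linarith
    · rcases le_total z.1 (2 * M) with h' | h'
      · have e2 := young |z.1 - r|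
        rw [sq_abs] at e2
        have e4 : (z.1 - r) ^ 2 * B ^ 2 / (4 * δ) ≤ C * (1 / (4 * δ)) * B ^ 2 * H := by
          calc (z.1 - r) ^ 2 * B ^ 2 / (4 * δ) ≤ (C * H) * B ^ 2 / (4 * δ) := by
                gcongr; exact k3 h h'
            _ = _ := by ring
        linarith
      · have e1 : |z.1 - r| ≤ z.1 := by
          rw [abs_le]; constructor <;> linarith [hr.2]
        have e3 : |z.1 - r| * (y * B) ≤ z.1 * (y * B) := by gcongr
        have e5 : z.1 * (y * B) ≤ 1 / 2 * z.1 * y ^ 2 + 1 / 2 * z.1 * B ^ 2 := by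
          linarith [mul_nonneg hz (sq_nonneg (y - B))]
        have e6 : 1 / 2 * z.1 * B ^ 2 ≤ 1 / 2 * (C * H) * B ^ 2 := by
          gcongr; exact k4 h'
        linarith
  have hLB : L * B ^ 2 * H ≤ L * (2 * (1 + c₀ ^ 2)) * (1 + ‖a‖ ^ 2) * H := by
    calc L * B ^ 2 * H ≤ L * (2 * (1 + c₀ ^ 2) * (1 + ‖a‖ ^ 2)) * H := by gcongr
      _ = _ := by ring
  rw [hE]
  set e := 1 / 2 * z.1 * y ^ 2 with he
  have f1 : (1 + 2 * M) * e ≤ (1 + 2 * M) * (1 + ‖a‖ ^ 2) * e := by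
    have : 0 ≤ (1 + 2 * M) * e * ‖a‖ ^ 2 := by positivity
    linarith
  have f2 : N * M * (C * H) ≤ N * M * C * (1 + ‖a‖ ^ 2) * H := by
    have : 0 ≤ N * M * C * H * ‖a‖ ^ 2 := by positivity
    linarith
  have f3 : 0 ≤ (N * M * C + L * (2 * (1 + c₀ ^ 2))) * (1 + ‖a‖ ^ 2) * e := by positivity
  have f4 : 0 ≤ (1 + 2 * M) * (1 + ‖a‖ ^ 2) * H := by positivity
  have f5 : z.1 * (M * y ^ 2) = 2 * M * e := by rw [he]; ring
  have f6 : (1 + 2 * M + N * M * C + L * (2 * (1 + c₀ ^ 2))) * (1 + ‖a‖ ^ 2) * (e + H)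
      = (1 + 2 * M) * (1 + ‖a‖ ^ 2) * e + N * M * C * (1 + ‖a‖ ^ 2) * H
        + L * (2 * (1 + c₀ ^ 2)) * (1 + ‖a‖ ^ 2) * H
        + (N * M * C + L * (2 * (1 + c₀ ^ 2))) * (1 + ‖a‖ ^ 2) * e
        + (1 + 2 * M) * (1 + ‖a‖ ^ 2) * H := by ring
  rw [f6, remainder]
  linarith

/-! ### The identity and the estimate on time slices -/

section Slice

variable {T : ℝ} {Ω : Set (Vec N)} {p : ℝ → ℝ} {μ η cP : ℝ}
  {ν : ℝ × Vec N → Measure (ℝ × Vec N)} {ν₀ : Vec N → Measure (ℝ × Vec N)} {D : ℝ → ℝ}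
  {gradu : ℝ × Vec N → Mat N} {χ ξ : ℝ → ℝ} {r : ℝ → Vec N → ℝ}
  {gradr : ℝ → Vec N → (Vec N →L[ℝ] ℝ)} {U : ℝ → Vec N → Vec N} {gradU : ℝ → Vec N → Mat N}
  {dtU d : ℝ → (closure Ω →ᵇ Vec N)}

theorem IsStrongSolution.memW012 (hS : IsStrongSolution T Ω p μ η r gradr U gradU dtU)
    (hΩ : IsOpen Ω) (hb : Bornology.IsBounded Ω) {t : ℝ} (ht : t ∈ Icc 0 T) :
    MemW012 Ω (U t) (gradU t) :=
  memW012_of_continuousOn_closure hΩ hb (ContinuousOn.slice hS.cont_U ht)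
    (ContinuousOn.slice hS.cont_gradU ht) (hS.hasGrad_U t ht) (hS.no_slip t ht)

/-- The integral of `div (p(r) U)` vanishes. -/
theorem IsStrongSolution.integral_div_pressure
    (hS : IsStrongSolution T Ω p μ η r gradr U gradU dtU) (hp : IsPressure p)
    (hΩ : IsOpen Ω) (hb : Bornology.IsBounded Ω) {t : ℝ} (ht : t ∈ Icc 0 T) :
    Integrable (fun x => tr (p (r t x) • gradU t x + (deriv p (r t x) • gradr t x).smulRight (U t x)))
      (volume.restrict Ω) ∧
    ∫ x in Ω, tr (p (r t x) • gradU t x + (deriv p (r t x) • gradr t x).smulRight (U t x)) = 0 := by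
  have hfin : IsFiniteMeasure (volume.restrict Ω) := ⟨by simpa using hb.measure_lt_top⟩
  have cU := ContinuousOn.slice hS.cont_U ht
  have cp : ContinuousOn (fun x => p (r t x)) (closure Ω) :=
    ContinuousOn.slice (g := fun t x => p (r t x))
      (hS.continuousOn_comp_density (hp.continuousOn.mono Ioi_subset_Ici_self)) ht
  have cp' : ContinuousOn (fun x => deriv p (r t x)) (closure Ω) :=
    ContinuousOn.slice (g := fun t x => deriv p (r t x))
      (hS.continuousOn_comp_density hp.continuousOn_deriv) ht
  have cg : ContinuousOn (fun x => p (r t x) • gradU t x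
      + (deriv p (r t x) • gradr t x).smulRight (U t x)) (closure Ω) := by
    refine (cp.smul (ContinuousOn.slice hS.cont_gradU ht)).add ?_
    have hc : Continuous fun y : (Vec N →L[ℝ] ℝ) × Vec N => y.1.smulRight y.2 :=
      (ContinuousLinearMap.smulRightL ℝ (Vec N) (Vec N)).continuous₂
    exact hc.comp_continuousOn ((cp'.smul (ContinuousOn.slice hS.cont_gradr ht)).prodMk cU)
  refine ⟨integrable_slice_of_continuousOn hΩ hb (continuous_tr.comp_continuousOn cg), ?_⟩
  -- The field p(r)U is C¹ up to the boundary and vanishes there with U, so its divergence has zero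
  -- mean.
  have hmem : MemW012 Ω (fun x => p (r t x) • U t x) (fun x => p (r t x) • gradU t x
      + (deriv p (r t x) • gradr t x).smulRight (U t x)) := by
    refine memW012_of_continuousOn_closure hΩ hb (cp.smul cU) cg (fun x hx => ?_) fun x hx => ?_
    · have hr := hS.r_pos t ht x (subset_closure hx)
      exact ((hp.hasDerivAt hr).comp_hasFDerivAt x (hS.hasGrad_r t ht x hx)).smul
        (hS.hasGrad_U t ht x hx)
    · rw [hS.no_slip t ht x hx, smul_zero]
  exact hmem.integral_tr

/-- The relative energy identity on almost every time slice. -/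
theorem ae_integral_testIntegrand (hD : IsDissipativeMVSolution T Ω p μ η cP ν ν₀ D gradu χ ξ)
    (hS : IsStrongSolution T Ω p μ η r gradr U gradU dtU)
    (hΩ : IsOpen Ω) (hb : Bornology.IsBounded Ω) (hp : IsPressure p) (hd : d =ᵐ[timeMeasure T] dtU)
    (hJ : Integrable (fun q => testIntegrand p μ η (ν q) (gradu q) (r q.1 q.2)
        (dtDensity r gradr U gradU q.1 q.2) (gradr q.1 q.2) (U q.1 q.2) (extendZero d q.1 q.2)
        (gradU q.1 q.2)) (cylMeasure T Ω)) :
    ∀ᵐ t ∂timeMeasure T,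
      Integrable (fun x => ∫ z, remainder p (r t x) (gradr t x) (U t x) (extendZero d t x)
        (gradU t x) z ∂ν (t, x)) (volume.restrict Ω) ∧
      ∫ x in Ω, testIntegrand p μ η (ν (t, x)) (gradu (t, x)) (r t x)
        (dtDensity r gradr U gradU t x) (gradr t x) (U t x) (extendZero d t x) (gradU t x)
      = (∫ x in Ω, ∫ z, remainder p (r t x) (gradr t x) (U t x) (extendZero d t x)
          (gradU t x) z ∂ν (t, x))
        + (∫ x in Ω, contr (stress μ η (gradu (t, x))) (gradu (t, x)))
        - ∫ x in Ω, contr (stress μ η (gradu (t, x) - gradU t x)) (gradu (t, x) - gradU t x) := by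
  obtain ⟨divS, hdivS⟩ := hS.momentum
  have hmem : ∀ᵐ t ∂timeMeasure T, t ∈ Ioo 0 T := ae_restrict_mem measurableSet_Ioo
  have hmom : ∀ᵐ q ∂cylMeasure T Ω, IsProbabilityMeasure (ν q) ∧ Integrable (fun z => z.1) (ν q) ∧
      Integrable (fun z => z.2) (ν q) ∧ Integrable (fun z => z.1 • z.2) (ν q) ∧
      Integrable (fun z => z.1 • tensorSq z.2) (ν q) ∧ Integrable (fun z => p z.1) (ν q) := by
    filter_upwards [hD.young.prob, hD.int_density.1, hD.int_velocity.1, hD.int_momentum.1,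
      hD.int_convective.1, hD.int_pressure.1] with q h1 h2 h3 h4 h5 h6
    exact ⟨h1, h2, h3, h4, h5, h6⟩
  filter_upwards [hdivS, hmem, hd, ae_ae_of_ae_cylMeasure hmom, ae_integrable_slice hJ,
    hD.velocity_mem.2.2] with t ⟨hw, hmo⟩ htT hdt hm hJt hu
  have ht := Ioo_subset_Icc_self htT
  have hUW := hS.memW012 hΩ hb ht
  have hwW := hu.sub hUW
  set b : Vec N → Vec N := fun x => r t x • (extendZero d t x + gradU t x (U t x))
    + deriv p (r t x) • (InnerProductSpace.toDual ℝ (Vec N)).symm (gradr t x) with hbdef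
  have cgU := ContinuousOn.slice hS.cont_gradU ht
  have cb : ContinuousOn b (closure Ω) := by
    refine ((ContinuousOn.slice hS.cont_r ht).smul ((continuousOn_extendZero d t).add
      (cgU.clm_apply (ContinuousOn.slice hS.cont_U ht)))).add ((ContinuousOn.slice
      (g := fun t x => deriv p (r t x)) (hS.continuousOn_comp_density hp.continuousOn_deriv)
      ht).smul ?_)
    exact (LinearIsometryEquiv.continuous _).comp_continuousOn (ContinuousOn.slice hS.cont_gradr ht)
  have hbS : ∀ x ∈ Ω, b x = divS t x := by
    intro x hx
    rw [← hmo x hx]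
    simp only [hbdef]
    rw [extendZero_of_mem d t (subset_closure hx), hdt]
  -- The equation replaces the distributional divergence by b, which is continuous on `closure Ω`
  -- and hence in L²(Ω). This allows u - U as a test field.
  have hwb : IsWeakDiv Ω (fun x => stress μ η (gradU t x)) b := by
    intro φ hφ
    rw [hw φ hφ]
    congr 1
    refine setIntegral_congr_fun hΩ.measurableSet fun x hx => ?_
    simp only [hbS x hx]
  have mA : MemLp (fun x => stress μ η (gradU t x)) 2 (volume.restrict Ω) :=
    ContinuousOn.memLp_restrict hΩ hb ((stressCLM μ η).continuous.comp_continuousOn cgU)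
  have mb : MemLp b 2 (volume.restrict Ω) := ContinuousOn.memLp_restrict hΩ hb cb
  have z1 := hwW.integral_contr_of_isWeakDiv mA mb hwb
  obtain ⟨i2, z2⟩ := hS.integral_div_pressure hp hΩ hb ht
  have i3 := integrable_bilin contrBilin mA hwW.2.1
  have i4 := integrable_bilin innerBilin mb hwW.1
  have i5 := integrable_bilin (contrBilin.comp (stressCLM μ η)) hu.2.1 hu.2.1
  have i6 := integrable_bilin (contrBilin.comp (stressCLM μ η)) hwW.2.1 hwW.2.1
  simp only [contrBilin_apply, innerBilin_apply, ContinuousLinearMap.comp_apply,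
    stressCLM_apply] at i3 i4 i5 i6
  have key : (fun x => ∫ z, remainder p (r t x) (gradr t x) (U t x) (extendZero d t x)
        (gradU t x) z ∂ν (t, x)) =ᵐ[volume.restrict Ω] fun x =>
      testIntegrand p μ η (ν (t, x)) (gradu (t, x)) (r t x)
        (dtDensity r gradr U gradU t x) (gradr t x) (U t x) (extendZero d t x) (gradU t x)
      - contr (stress μ η (gradu (t, x))) (gradu (t, x))
      + contr (stress μ η (gradu (t, x) - gradU t x)) (gradu (t, x) - gradU t x)
      + (contr (stress μ η (gradU t x)) (gradu (t, x) - gradU t x)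
        + inner ℝ (b x) (meanVelocity ν (t, x) - U t x))
      + tr (p (r t x) • gradU t x + (deriv p (r t x) • gradr t x).smulRight (U t x)) := by
    filter_upwards [hm, ae_restrict_mem hΩ.measurableSet] with x ⟨h0, h1, h2, h3, h4, h5⟩ hx
    exact testIntegrand_eq_remainder h1 h2 h3 h4 h5 (hS.r_pos t ht x (subset_closure hx)).ne'
      (gradr t x) (U t x) (extendZero d t x) (gradU t x) (gradu (t, x)) μ η
  have j1 := hJt.sub i5
  have j2 := j1.add i6
  have j3 := i3.add i4
  have j4 := j2.add j3
  refine ⟨(j4.add i2).congr key.symm, ?_⟩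
  rw [integral_congr_ae key, integral_add (by exact j4) i2, integral_add (by exact j2) (by exact j3),
    integral_add (by exact j1) i6, integral_sub hJt i5, integral_add i3 i4, z1, z2]
  ring

/-- The relative energy estimate on almost every time slice. -/
theorem ae_integral_testIntegrand_le (hD : IsDissipativeMVSolution T Ω p μ η cP ν ν₀ D gradu χ ξ)
    (hS : IsStrongSolution T Ω p μ η r gradr U gradU dtU)
    (hΩ : IsOpen Ω) (hb : Bornology.IsBounded Ω) (hp : IsPressure p) (hd : d =ᵐ[timeMeasure T] dtU)
    (hμ : 0 ≤ μ) (hη : 0 ≤ η) (i : Fin N) {R : ℝ} (hR : ∀ x ∈ Ω, ‖x‖ ≤ R)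
    (hJ : Integrable (fun q => testIntegrand p μ η (ν q) (gradu q) (r q.1 q.2)
        (dtDensity r gradr U gradU q.1 q.2) (gradr q.1 q.2) (U q.1 q.2) (extendZero d q.1 q.2)
        (gradU q.1 q.2)) (cylMeasure T Ω)) {C δ : ℝ} (hC : 0 ≤ C) (hδ : 0 ≤ δ)
    (hrem : ∀ t ∈ Icc 0 T, ∀ x ∈ closure Ω, ∀ (a : Vec N) (z : ℝ × Vec N), 0 ≤ z.1 →
      remainder p (r t x) (gradr t x) (U t x) a (gradU t x) z
        ≤ C * (1 + ‖a‖ ^ 2) * relEnergy p (r t x) (U t x) z + δ * ‖z.2 - U t x‖ ^ 2) :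
    ∀ᵐ t ∂timeMeasure T,
      ∫ x in Ω, testIntegrand p μ η (ν (t, x)) (gradu (t, x)) (r t x)
        (dtDensity r gradr U gradU t x) (gradr t x) (U t x) (extendZero d t x) (gradU t x)
      ≤ C * (1 + ‖dtU t‖ ^ 2) * (∫ x in Ω, relMean p (ν (t, x)) (r t x) (U t x))
        + (∫ x in Ω, contr (stress μ η (gradu (t, x))) (gradu (t, x)))
        + 2 * δ * (∫ x in Ω, ∫ z, ‖z.2 - meanVelocity ν (t, x)‖ ^ 2 ∂ν (t, x))
        - (μ - 8 * δ * R ^ 2)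
          * ∫ x in Ω, contr (gradu (t, x) - gradU t x) (gradu (t, x) - gradU t x) := by
  have hmem : ∀ᵐ t ∂timeMeasure T, t ∈ Ioo 0 T := ae_restrict_mem measurableSet_Ioo
  have hmom : ∀ᵐ q ∂cylMeasure T Ω, (IsProbabilityMeasure (ν q) ∧
      Integrable (fun z => z.1) (ν q) ∧
      Integrable (fun z => z.2) (ν q) ∧ Integrable (fun z => z.1 • z.2) (ν q) ∧
      Integrable (fun z => z.1 • tensorSq z.2) (ν q) ∧ Integrable (fun z => p z.1) (ν q)) ∧
      Integrable (energy p) (ν q) ∧ Integrable (fun z => ‖z.2 - meanVelocity ν q‖ ^ 2) (ν q) ∧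
      ∀ᵐ z ∂ν q, 0 ≤ z.1 := by
    filter_upwards [hD.young.prob, hD.int_density.1, hD.int_velocity.1, hD.int_momentum.1,
      hD.int_convective.1, hD.int_pressure.1, hD.int_energy.1, hD.int_fluctuation.1,
      hD.young.density_nonneg] with q h1 h2 h3 h4 h5 h6 h7 h8 h9
    refine ⟨⟨h1, h2, h3, h4, h5, h6⟩, h7, h8, ?_⟩
    rw [ae_iff]; simpa using h9
  filter_upwards [ae_integral_testIntegrand hD hS hΩ hb hp hd hJ, hmem, hd,
    ae_ae_of_ae_cylMeasure hmom, hD.velocity_mem.2.2, ae_integrable_slice hD.int_fluctuation.2,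
    ae_integrable_relMean hD hS hΩ hb hp]
    with t ⟨iR, hid⟩ htT hdt hm hu hfl hrm
  have ht := Ioo_subset_Icc_self htT
  have hwW := hu.sub (hS.memW012 hΩ hb ht)
  have hk := hwW.korn hμ hη
  have hpo := hwW.poincare i hR
  obtain ⟨m1, m2, m3, m4⟩ := hrm (U t) (ContinuousOn.slice hS.cont_U ht)
  have iE : Integrable (fun x => relMean p (ν (t, x)) (r t x) (U t x)) (volume.restrict Ω) :=
    ((m1.sub m2).add m3).add m4
  have iw : Integrable (fun x => ‖meanVelocity ν (t, x) - U t x‖ ^ 2) (volume.restrict Ω) :=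
    hwW.1.integrable_norm_pow (by norm_num)
  have hle : ∫ x in Ω, ∫ z, remainder p (r t x) (gradr t x) (U t x) (extendZero d t x)
        (gradU t x) z ∂ν (t, x)
      ≤ ∫ x in Ω, (C * (1 + ‖dtU t‖ ^ 2) * relMean p (ν (t, x)) (r t x) (U t x)
        + 2 * δ * (∫ z, ‖z.2 - meanVelocity ν (t, x)‖ ^ 2 ∂ν (t, x))
        + 2 * δ * ‖meanVelocity ν (t, x) - U t x‖ ^ 2) := by
    refine integral_mono_ae iR (((iE.const_mul _).add (hfl.const_mul _)).add (iw.const_mul _)) ?_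
    filter_upwards [hm, ae_restrict_mem hΩ.measurableSet]
      with x ⟨⟨h0, h1, h2, h3, h4, h5⟩, h6, h7, h8⟩ hx
    have hxc := subset_closure hx
    have hr := hS.r_pos t ht x hxc
    have k1 := integrable_relEnergy h1 h3 h6 (r t x) (U t x)
    have k2 : Integrable (fun z => C * (1 + ‖dtU t‖ ^ 2) * relEnergy p (r t x) (U t x) z
        + 2 * δ * ‖z.2 - meanVelocity ν (t, x)‖ ^ 2) (ν (t, x)) :=
      (k1.const_mul _).add (h7.const_mul _)
    have e1 : relMean p (ν (t, x)) (r t x) (U t x)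
        = ∫ z, relEnergy p (r t x) (U t x) z ∂ν (t, x) := (integral_relEnergy hp h1 h3 h6 hr _).symm
    have e2 : ∫ z, (C * (1 + ‖dtU t‖ ^ 2) * relEnergy p (r t x) (U t x) z
        + 2 * δ * ‖z.2 - meanVelocity ν (t, x)‖ ^ 2
        + 2 * δ * ‖meanVelocity ν (t, x) - U t x‖ ^ 2) ∂ν (t, x)
        = C * (1 + ‖dtU t‖ ^ 2) * relMean p (ν (t, x)) (r t x) (U t x)
        + 2 * δ * (∫ z, ‖z.2 - meanVelocity ν (t, x)‖ ^ 2 ∂ν (t, x))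
        + 2 * δ * ‖meanVelocity ν (t, x) - U t x‖ ^ 2 := by
      rw [integral_add k2 (integrable_const _), integral_add (k1.const_mul _) (h7.const_mul _),
        integral_const_mul, integral_const_mul, e1]
      simp
    change _ ≤ C * (1 + ‖dtU t‖ ^ 2) * relMean p (ν (t, x)) (r t x) (U t x)
        + 2 * δ * (∫ z, ‖z.2 - meanVelocity ν (t, x)‖ ^ 2 ∂ν (t, x))
        + 2 * δ * ‖meanVelocity ν (t, x) - U t x‖ ^ 2
    rw [← e2]
    refine integral_mono_ae (integrable_remainder h1 h2 h3 h4 h5 _ _ _ _ _)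
      (k2.add (integrable_const _)) ?_
    filter_upwards [h8] with z hz
    refine (hrem t ht x hxc (extendZero d t x) z hz).trans ?_
    have g1 := relEnergy_nonneg hp hr (U t x) hz
    have g2 : ‖extendZero d t x‖ ≤ ‖dtU t‖ := by
      rw [← hdt]; exact norm_extendZero_le d t x
    have g3 : C * (1 + ‖extendZero d t x‖ ^ 2) * relEnergy p (r t x) (U t x) z
        ≤ C * (1 + ‖dtU t‖ ^ 2) * relEnergy p (r t x) (U t x) z := by gcongr
    -- The velocity error splits into the fluctuation of v about its mean, left for the defect, and
    -- u - U, left for Poincaré's inequality. The factor 2δ·4R² = 8δR² in the conclusion arises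
    -- here.
    have g4 : ‖z.2 - U t x‖ ^ 2
        ≤ 2 * ‖z.2 - meanVelocity ν (t, x)‖ ^ 2 + 2 * ‖meanVelocity ν (t, x) - U t x‖ ^ 2 := by
      have s1 := norm_sub_le_norm_sub_add_norm_sub z.2 (meanVelocity ν (t, x)) (U t x)
      have s2 : ‖z.2 - U t x‖ ^ 2
        ≤ (‖z.2 - meanVelocity ν (t, x)‖ + ‖meanVelocity ν (t, x) - U t x‖) ^ 2 := by gcongr
      linarith [sq_nonneg (‖z.2 - meanVelocity ν (t, x)‖ - ‖meanVelocity ν (t, x) - U t x‖)]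
    have g5 := mul_le_mul_of_nonneg_left g4 hδ
    linarith
  rw [integral_add (by exact (iE.const_mul _).add (hfl.const_mul _)) (iw.const_mul _),
    integral_add (iE.const_mul _) (hfl.const_mul _), integral_const_mul, integral_const_mul,
    integral_const_mul] at hle
  rw [hid]
  have hpo' := mul_le_mul_of_nonneg_left hpo (by positivity : (0 : ℝ) ≤ 2 * δ)
  linarith

end Slice

/-! ### Norm bounds and Grönwall's inequality with a dissipative term -/

theorem integrable_mul_of_ae_bound {α : Type*} [MeasurableSpace α] {m : Measure α} {f g : α → ℝ}
    {B : ℝ} (hf : Integrable f m) (hg : AEStronglyMeasurable g m) (hB : ∀ᵐ x ∂m, |g x| ≤ B) :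
    Integrable (fun x => f x * g x) m := by
  refine (hf.norm.mul_const B).mono' (hf.1.mul hg) ?_
  filter_upwards [hB] with x hx
  rw [norm_mul, Real.norm_eq_abs (g x)]
  gcongr

theorem integral_norm_le_of_eLpNorm_one_le {α : Type*} [MeasurableSpace α] {m : Measure α}
    {f : α → ℝ} {M : ℝ} (hM : 0 ≤ M) (hf : Integrable f m)
    (h : eLpNorm f 1 m ≤ ENNReal.ofReal M) : ∫ x, |f x| ∂m ≤ M := by
  rw [eLpNorm_one_eq_lintegral_enorm] at h
  have h1 := integral_norm_eq_lintegral_enorm hf.1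
  simp only [Real.norm_eq_abs] at h1
  rw [h1]
  exact ENNReal.toReal_le_of_le_ofReal hM h

theorem integral_norm_sq_le_of_eLpNorm_two_le {α E : Type*} [MeasurableSpace α]
    [NormedAddCommGroup E] {m : Measure α} {f : α → E} {M : ℝ} (hM : 0 ≤ M) (hf : MemLp f 2 m)
    (h : eLpNorm f 2 m ≤ ENNReal.ofReal M) : ∫ x, ‖f x‖ ^ 2 ∂m ≤ M ^ 2 := by
  have h1 := hf.eLpNorm_eq_integral_rpow_norm (by norm_num) (by norm_num)
  have h0 : 0 ≤ ∫ x, ‖f x‖ ^ 2 ∂m := integral_nonneg fun x => by positivity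
  rw [h1] at h
  simp only [ENNReal.toReal_ofNat, Real.rpow_ofNat] at h
  have h2 := (ENNReal.ofReal_le_ofReal_iff hM).1 h
  have h3 : ((∫ x, ‖f x‖ ^ 2 ∂m) ^ (2⁻¹ : ℝ)) ^ 2 = ∫ x, ‖f x‖ ^ 2 ∂m := by
    rw [← Real.rpow_natCast, ← Real.rpow_mul h0]
    norm_num
  rw [← h3]
  have : 0 ≤ (∫ x, ‖f x‖ ^ 2 ∂m) ^ (2⁻¹ : ℝ) := Real.rpow_nonneg h0 _
  gcongr

theorem intervalIntegral_le_integral_timeMeasure {T τ : ℝ} (hτ : τ ∈ Icc 0 T) {f : ℝ → ℝ}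
    (hf : Integrable f (timeMeasure T)) (h0 : ∀ᵐ t ∂timeMeasure T, 0 ≤ f t) :
    ∫ t in (0 : ℝ)..τ, f t ≤ ∫ t, f t ∂timeMeasure T := by
  rw [intervalIntegral.integral_of_le hτ.1]
  exact integral_mono_measure (restrict_Ioc_le_timeMeasure hτ) h0 hf

/-- Grönwall's inequality with an additional nonnegative term on the left. -/
theorem gronwall_add {T E₀ L : ℝ} {F W h : ℝ → ℝ}
    (hh : Integrable h (timeMeasure T)) (hh0 : ∀ᵐ t ∂timeMeasure T, 0 ≤ h t)
    (hhF : Integrable (fun t => h t * F t) (timeMeasure T))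
    (hW : ∀ᵐ τ ∂timeMeasure T, 0 ≤ W τ) (hE₀ : 0 ≤ E₀) (hL : ∫ t, h t ∂timeMeasure T ≤ L)
    (hF : ∀ᵐ τ ∂timeMeasure T, F τ + W τ ≤ E₀ + ∫ t in (0 : ℝ)..τ, h t * F t) :
    ∀ᵐ τ ∂timeMeasure T, F τ + W τ ≤ (1 + L * Real.exp L) * E₀ := by
  have hmem : ∀ᵐ τ ∂timeMeasure T, τ ∈ Ioo 0 T := ae_restrict_mem measurableSet_Ioo
  have hle : ∀ τ ∈ Icc 0 T, ∫ t in (0 : ℝ)..τ, h t ≤ L := fun τ hτ =>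
    (intervalIntegral_le_integral_timeMeasure hτ hh hh0).trans hL
  have hG := gronwall_of_integrable (E₀ := E₀) hh hh0 hhF (by
    filter_upwards [hF, hW] with τ h1 h2
    linarith)
  -- Grönwall bounds F alone. Inserting this bound back into the time integral recovers the term W
  -- and gives the factor 1 + L exp(L).
  have hG' : ∀ᵐ t ∂timeMeasure T, h t * F t ≤ h t * (E₀ * Real.exp L) := by
    filter_upwards [hG, hh0, hmem] with t h1 h2 ht
    refine mul_le_mul_of_nonneg_left (h1.trans ?_) h2
    gcongr
    exact hle t (Ioo_subset_Icc_self ht)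
  filter_upwards [hF, hmem] with τ h1 hτ
  have hτ' := Ioo_subset_Icc_self hτ
  have h2 := intervalIntegral_mono_timeMeasure hτ' hhF (hh.mul_const _) hG'
  rw [intervalIntegral.integral_mul_const] at h2
  have h3 : (∫ t in (0 : ℝ)..τ, h t) * (E₀ * Real.exp L) ≤ L * (E₀ * Real.exp L) := by
    have := hle τ hτ'
    gcongr
  linarith

/-! ### The stability estimate -/

section Stability

variable {T : ℝ} {Ω : Set (Vec N)} {p : ℝ → ℝ} {μ η cP : ℝ}
  {ν : ℝ × Vec N → Measure (ℝ × Vec N)} {ν₀ : Vec N → Measure (ℝ × Vec N)} {D : ℝ → ℝ}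
  {gradu : ℝ × Vec N → Mat N} {χ ξ : ℝ → ℝ} {r : ℝ → Vec N → ℝ}
  {gradr : ℝ → Vec N → (Vec N →L[ℝ] ℝ)} {U : ℝ → Vec N → Vec N} {gradU : ℝ → Vec N → Mat N}
  {dtU : ℝ → (closure Ω →ᵇ Vec N)}

theorem integrable_relMean (hD : IsDissipativeMVSolution T Ω p μ η cP ν ν₀ D gradu χ ξ)
    (hS : IsStrongSolution T Ω p μ η r gradr U gradU dtU)
    (hΩ : IsOpen Ω) (hb : Bornology.IsBounded Ω) (hp : IsPressure p) :
    Integrable (fun q => relMean p (ν q) (r q.1 q.2) (U q.1 q.2)) (cylMeasure T Ω) := by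
  refine ((hD.int_energy.2.sub (integrable_bilin_cyl hΩ hb innerBilin hD.int_momentum.2
    hS.cont_U)).add (integrable_bilin_cyl hΩ hb (ContinuousLinearMap.mul ℝ ℝ) hD.int_density.2
    (g := fun t x => 1 / 2 * ‖U t x‖ ^ 2 - deriv (potential p) (r t x)) ?_)).add
    (integrable_cyl_of_continuousOn hΩ hb (g := fun t x => p (r t x)) ?_)
  · exact ((hS.cont_U.norm.pow 2).const_smul (1 / 2 : ℝ)).sub
      (hS.continuousOn_comp_density hp.continuousOn_deriv_potential)
  · exact hS.continuousOn_comp_density (hp.continuousOn.mono Ioi_subset_Ici_self)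

theorem ae_relMean_eq (hD : IsDissipativeMVSolution T Ω p μ η cP ν ν₀ D gradu χ ξ)
    (hS : IsStrongSolution T Ω p μ η r gradr U gradU dtU) (hΩ : IsOpen Ω) (hp : IsPressure p) :
    ∀ᵐ q ∂cylMeasure T Ω, relMean p (ν q) (r q.1 q.2) (U q.1 q.2)
      = ∫ z, relEnergy p (r q.1 q.2) (U q.1 q.2) z ∂ν q := by
  filter_upwards [hD.young.prob, hD.int_density.1, hD.int_momentum.1, hD.int_energy.1,
    ae_mem_cyl hΩ] with q h1 h2 h3 h4 hq
  exact (integral_relEnergy hp h2 h3 h4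
    (hS.r_pos q.1 (Ioo_subset_Icc_self hq.1) q.2 (subset_closure hq.2)) _).symm

theorem ae_relMean_init_eq (hD : IsDissipativeMVSolution T Ω p μ η cP ν ν₀ D gradu χ ξ)
    (hS : IsStrongSolution T Ω p μ η r gradr U gradU dtU) (hT : 0 ≤ T) (hΩ : IsOpen Ω)
    (hp : IsPressure p) :
    ∀ᵐ x ∂volume.restrict Ω, relMean p (ν₀ x) (r 0 x) (U 0 x)
      = ∫ z, relEnergy p (r 0 x) (U 0 x) z ∂ν₀ x := by
  filter_upwards [hD.young_init.prob, hD.int_init_density.1, hD.int_init_momentum.1,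
    hD.int_init_energy.1, ae_restrict_mem hΩ.measurableSet] with x h1 h2 h3 h4 hx
  exact (integral_relEnergy hp h2 h3 h4 (hS.r_pos 0 ⟨le_rfl, hT⟩ x (subset_closure hx)) _).symm

theorem ae_relEnergy_mean_nonneg (hD : IsDissipativeMVSolution T Ω p μ η cP ν ν₀ D gradu χ ξ)
    (hS : IsStrongSolution T Ω p μ η r gradr U gradU dtU) (hΩ : IsOpen Ω) (hp : IsPressure p) :
    ∀ᵐ q ∂cylMeasure T Ω, 0 ≤ ∫ z, relEnergy p (r q.1 q.2) (U q.1 q.2) z ∂ν q := by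
  filter_upwards [hD.young.density_nonneg, ae_mem_cyl hΩ] with q h1 hq
  have hz : ∀ᵐ z ∂ν q, 0 ≤ z.1 := by
    rw [ae_iff]; simpa using h1
  refine integral_nonneg_of_ae ?_
  filter_upwards [hz] with z hz
  exact relEnergy_nonneg hp (hS.r_pos q.1 (Ioo_subset_Icc_self hq.1) q.2 (subset_closure hq.2)) _ hz

theorem integral_relEnergy_init_nonneg (hD : IsDissipativeMVSolution T Ω p μ η cP ν ν₀ D gradu χ ξ)
    (hS : IsStrongSolution T Ω p μ η r gradr U gradU dtU) (hT : 0 ≤ T) (hΩ : IsOpen Ω)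
    (hp : IsPressure p) : 0 ≤ ∫ x in Ω, ∫ z, relEnergy p (r 0 x) (U 0 x) z ∂ν₀ x := by
  refine integral_nonneg_of_ae ?_
  filter_upwards [hD.young_init.density_nonneg, ae_restrict_mem hΩ.measurableSet] with x h1 hx
  have hz : ∀ᵐ z ∂ν₀ x, 0 ≤ z.1 := by
    rw [ae_iff]; simpa using h1
  refine integral_nonneg_of_ae ?_
  filter_upwards [hz] with z hz
  exact relEnergy_nonneg hp (hS.r_pos 0 ⟨le_rfl, hT⟩ x (subset_closure hx)) _ hz

/-- The relative energy is bounded in time. -/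
theorem exists_bound_integral_relMean (hD : IsDissipativeMVSolution T Ω p μ η cP ν ν₀ D gradu χ ξ)
    (hS : IsStrongSolution T Ω p μ η r gradr U gradU dtU)
    (hΩ : IsOpen Ω) (hb : Bornology.IsBounded Ω) (hp : IsPressure p) (hμ : 0 ≤ μ) (hη : 0 ≤ η) :
    ∃ B, ∀ᵐ t ∂timeMeasure T, |∫ x in Ω, relMean p (ν (t, x)) (r t x) (U t x)| ≤ B := by
  obtain ⟨w, Kw, hwi, hw, hwK⟩ := hD.exists_majorant hb hp hμ hη
  have hfin : IsFiniteMeasure (volume.restrict Ω) := ⟨by simpa using hb.measure_lt_top⟩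
  obtain ⟨C₁, hC₁⟩ := exists_bound_cyl hb hS.cont_U
  obtain ⟨C₂, hC₂⟩ := exists_bound_cyl hb (g := fun t x => 1 / 2 * ‖U t x‖ ^ 2
    - deriv (potential p) (r t x)) (((hS.cont_U.norm.pow 2).const_smul (1 / 2 : ℝ)).sub
      (hS.continuousOn_comp_density hp.continuousOn_deriv_potential))
  obtain ⟨C₃, hC₃⟩ := exists_bound_cyl hb (g := fun t x => p (r t x))
    (hS.continuousOn_comp_density (hp.continuousOn.mono Ioi_subset_Ici_self))
  have hmem : ∀ᵐ t ∂timeMeasure T, t ∈ Ioo 0 T := ae_restrict_mem measurableSet_Ioo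
  set C := |C₁| + |C₂| with hC
  refine ⟨(∫ x in Ω, ∫ z, energy p z ∂ν₀ x) + C * Kw + ∫ _ in Ω, C₃, ?_⟩
  filter_upwards [ae_ae_of_ae_cylMeasure (ae_relMean_eq hD hS hΩ hp),
    ae_ae_of_ae_cylMeasure (ae_relEnergy_mean_nonneg hD hS hΩ hp), hmem,
    ae_integrable_slice (integrable_relMean hD hS hΩ hb hp), ae_ae_of_ae_cylMeasure hw, hwK,
    ae_integrable_slice hwi, ae_integrable_slice hD.int_energy.2, hD.ae_integral_energy_le hμ hη]
    with t h1 h2 htT h3 h4 h5 h6 h7 h8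
  have ht := Ioo_subset_Icc_self htT
  have hn : 0 ≤ ∫ x in Ω, relMean p (ν (t, x)) (r t x) (U t x) := by
    refine integral_nonneg_of_ae ?_
    filter_upwards [h1, h2] with x g1 g2
    exact g2.trans_eq g1.symm
  rw [abs_of_nonneg hn]
  have hle : ∫ x in Ω, relMean p (ν (t, x)) (r t x) (U t x)
      ≤ ∫ x in Ω, ((∫ z, energy p z ∂ν (t, x)) + C * w (t, x) + C₃) := by
    refine integral_mono_ae h3 ((h7.add (h6.const_mul _)).add (integrable_const _)) ?_
    filter_upwards [h4, ae_restrict_mem hΩ.measurableSet] with x g4 hx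
    have hxc := subset_closure hx
    have a1 := (hC₁ t ht x hxc).trans (le_abs_self _)
    have a2 := (hC₂ t ht x hxc).trans (le_abs_self _)
    have a3 := (le_abs_self _).trans (hC₃ t ht x hxc)
    have b1 := neg_le_of_abs_le ((abs_real_inner_le_norm (∫ z, z.1 • z.2 ∂ν (t, x)) (U t x)).trans
      (mul_le_mul_of_nonneg_left a1 (norm_nonneg _)))
    have b2 : (∫ z, z.1 ∂ν (t, x)) * (1 / 2 * ‖U t x‖ ^ 2 - deriv (potential p) (r t x))
        ≤ |∫ z, z.1 ∂ν (t, x)| * |C₂| := by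
      refine (le_abs_self _).trans ?_
      rw [abs_mul]
      exact mul_le_mul_of_nonneg_left a2 (abs_nonneg _)
    have b3 := mul_le_mul_of_nonneg_left g4 (by positivity : 0 ≤ C)
    have b4 := mul_nonneg (abs_nonneg C₁) (abs_nonneg (∫ z, z.1 ∂ν (t, x)))
    have b5 := mul_nonneg (abs_nonneg C₂) (norm_nonneg (∫ z, z.1 • z.2 ∂ν (t, x)))
    rw [hC] at b3 ⊢
    simp only [relMean]
    linarith
  rw [integral_add (by exact h7.add (h6.const_mul _)) (integrable_const _),
    integral_add h7 (h6.const_mul _), integral_const_mul] at hle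
  have := mul_le_mul_of_nonneg_left h5 (by positivity : 0 ≤ C)
  linarith

theorem integrable_velocity_gradient_sub (hD : IsDissipativeMVSolution T Ω p μ η cP ν ν₀ D gradu χ ξ)
    (hS : IsStrongSolution T Ω p μ η r gradr U gradU dtU)
    (hΩ : IsOpen Ω) (hb : Bornology.IsBounded Ω) :
    Integrable (fun q => contr (gradu q - gradU q.1 q.2) (gradu q - gradU q.1 q.2))
      (cylMeasure T Ω) := by
  have hfin := isFiniteMeasure_cyl (T := T) hb
  obtain ⟨C, hC⟩ := exists_bound_cyl hb hS.cont_gradU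
  have h1 : MemLp (fun q : ℝ × Vec N => gradU q.1 q.2) 2 (cylMeasure T Ω) := by
    refine MemLp.of_bound (aestronglyMeasurable_cyl hΩ hS.cont_gradU) C ?_
    filter_upwards [ae_mem_cyl hΩ] with q hq
    exact hC q.1 (Ioo_subset_Icc_self hq.1) q.2 (subset_closure hq.2)
  have h2 := hD.velocity_mem.2.1.sub h1
  exact integrable_bilin contrBilin h2 h2

end Stability

section Stability

variable {T : ℝ} {Ω : Set (Vec N)} {p : ℝ → ℝ} {μ η cP : ℝ}
  {ν : ℝ × Vec N → Measure (ℝ × Vec N)} {ν₀ : Vec N → Measure (ℝ × Vec N)} {D : ℝ → ℝ}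
  {gradu : ℝ × Vec N → Mat N} {χ ξ : ℝ → ℝ} {r : ℝ → Vec N → ℝ}
  {gradr : ℝ → Vec N → (Vec N →L[ℝ] ℝ)} {U : ℝ → Vec N → Vec N} {gradU : ℝ → Vec N → Mat N}
  {dtU : ℝ → (closure Ω →ᵇ Vec N)}

theorem NormsBoundedBy.mono {M M' : ℝ} (h : NormsBoundedBy M T Ω r gradr U gradU dtU χ ξ)
    (hM : M ≤ M') : NormsBoundedBy M' T Ω r gradr U gradU dtU χ ξ where
  bound_r t ht x hx := (h.bound_r t ht x hx).trans hM
  bound_gradr t ht x hx := (h.bound_gradr t ht x hx).trans hM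
  bound_inv_r t ht x hx := (h.bound_inv_r t ht x hx).trans hM
  bound_U t ht x hx := (h.bound_U t ht x hx).trans hM
  bound_gradU t ht x hx := (h.bound_gradU t ht x hx).trans hM
  bound_dtU := h.bound_dtU.trans (ENNReal.ofReal_le_ofReal hM)
  bound_chi := h.bound_chi.trans (ENNReal.ofReal_le_ofReal hM)
  bound_xi := h.bound_xi.trans (ENNReal.ofReal_le_ofReal hM)

theorem NormsBoundedBy.density_mem_Icc {M : ℝ}
    (h : NormsBoundedBy M T Ω r gradr U gradU dtU χ ξ) {t : ℝ} (ht : t ∈ Icc 0 T) {x : Vec N}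
    (hx : x ∈ closure Ω) (hr : 0 < r t x) : r t x ∈ Icc M⁻¹ M := by
  refine ⟨?_, (le_abs_self _).trans (h.bound_r t ht x hx)⟩
  have h1 := h.bound_inv_r t ht x hx
  rw [abs_of_pos (inv_pos.2 hr)] at h1
  exact inv_le_of_inv_le₀ hr h1

/-- The weight in Grönwall's inequality. -/
def gronwallWeight {Ω : Set (Vec N)} (C C' : ℝ) (dtU : ℝ → (closure Ω →ᵇ Vec N)) (χ ξ : ℝ → ℝ)
    (t : ℝ) : ℝ :=
  C * (1 + ‖dtU t‖ ^ 2) + 4 * C' * (|χ t| + |ξ t|)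

theorem integrable_gronwallWeight (hD : IsDissipativeMVSolution T Ω p μ η cP ν ν₀ D gradu χ ξ)
    (hS : IsStrongSolution T Ω p μ η r gradr U gradU dtU) (C C' : ℝ) :
    Integrable (gronwallWeight C C' dtU χ ξ) (timeMeasure T) :=
  (((integrable_const _).add (hS.dtU_memLp.integrable_norm_pow (by norm_num))).const_mul _).add
    ((hD.chi_integrable.abs.add hD.xi_integrable.abs).const_mul _)

theorem integral_gronwallWeight_le (hD : IsDissipativeMVSolution T Ω p μ η cP ν ν₀ D gradu χ ξ)
    (hS : IsStrongSolution T Ω p μ η r gradr U gradU dtU) (hT : 0 ≤ T) {M C C' : ℝ} (hM : 0 ≤ M)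
    (hC : 0 ≤ C) (hC' : 0 ≤ C') (h : NormsBoundedBy M T Ω r gradr U gradU dtU χ ξ) :
    ∫ t, gronwallWeight C C' dtU χ ξ t ∂timeMeasure T
      ≤ C * (T + M ^ 2) + 4 * C' * (M + M) := by
  have i1 : Integrable (fun t => ‖dtU t‖ ^ 2) (timeMeasure T) :=
    hS.dtU_memLp.integrable_norm_pow (by norm_num)
  have i2 := hD.chi_integrable.abs
  have i3 := hD.xi_integrable.abs
  have i4 : Integrable (fun t => 1 + ‖dtU t‖ ^ 2) (timeMeasure T) := (integrable_const _).add i1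
  have i5 : Integrable (fun t => |χ t| + |ξ t|) (timeMeasure T) := i2.add i3
  unfold gronwallWeight
  rw [integral_add (i4.const_mul _) (i5.const_mul _), integral_const_mul, integral_const_mul,
    integral_add (integrable_const _) i1, integral_add i2 i3]
  have e1 : ∫ _, (1 : ℝ) ∂timeMeasure T = T := by
    simp [timeMeasure, hT]
  rw [e1]
  have := integral_norm_sq_le_of_eLpNorm_two_le hM hS.dtU_memLp h.bound_dtU
  have := integral_norm_le_of_eLpNorm_one_le hM hD.chi_integrable h.bound_chi
  have := integral_norm_le_of_eLpNorm_one_le hM hD.xi_integrable h.bound_xi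
  gcongr

/-- The estimate to which Grönwall's inequality is applied. -/
theorem ae_relEnergy_gronwall (hD : IsDissipativeMVSolution T Ω p μ η cP ν ν₀ D gradu χ ξ)
    (hS : IsStrongSolution T Ω p μ η r gradr U gradU dtU) (hT : 0 < T)
    (hΩ : IsOpen Ω) (hb : Bornology.IsBounded Ω) (hne : Ω.Nonempty) (hp : IsPressure p)
    (hμ : 0 ≤ μ) (hη : 0 ≤ η) (i : Fin N) {R M K C δ : ℝ} (hR : ∀ x ∈ Ω, ‖x‖ ≤ R)
    (hU : ∀ t ∈ Icc 0 T, ∀ x ∈ closure Ω, ‖U t x‖ ≤ M)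
    (hgU : ∀ t ∈ Icc 0 T, ∀ x ∈ closure Ω, ‖gradU t x‖ ≤ M)
    (hP : ∀ t ∈ Icc 0 T, ∀ x ∈ closure Ω, |deriv (potential p) (r t x)| ≤ K)
    (hP' : ∀ t ∈ Icc 0 T, ∀ x ∈ closure Ω, ‖(deriv p (r t x) / r t x) • gradr t x‖ ≤ K)
    (hC : 0 ≤ C) (hC' : 0 ≤ M + M ^ 2 + K) (hδ : 0 ≤ δ) (hδP : 2 * δ * cP ≤ 1 / 2)
    (hδR : 8 * δ * R ^ 2 ≤ μ / 2)
    (hrem : ∀ t ∈ Icc 0 T, ∀ x ∈ closure Ω, ∀ (a : Vec N) (z : ℝ × Vec N), 0 ≤ z.1 →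
      remainder p (r t x) (gradr t x) (U t x) a (gradU t x) z
        ≤ C * (1 + ‖a‖ ^ 2) * relEnergy p (r t x) (U t x) z + δ * ‖z.2 - U t x‖ ^ 2) :
    Integrable (fun t => gronwallWeight C (M + M ^ 2 + K) dtU χ ξ t
        * ((∫ x in Ω, relMean p (ν (t, x)) (r t x) (U t x)) + 1 / 2 * D t)) (timeMeasure T) ∧
    ∀ᵐ τ ∂timeMeasure T,
      ((∫ x in Ω, relMean p (ν (τ, x)) (r τ x) (U τ x)) + 1 / 2 * D τ)
        + μ / 2 * cylInt Ω τ (fun q => contr (gradu q - gradU q.1 q.2) (gradu q - gradU q.1 q.2))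
      ≤ (∫ x in Ω, relMean p (ν₀ x) (r 0 x) (U 0 x))
        + ∫ t in (0 : ℝ)..τ, gronwallWeight C (M + M ^ 2 + K) dtU χ ξ t
          * ((∫ x in Ω, relMean p (ν (t, x)) (r t x) (U t x)) + 1 / 2 * D t) := by
  obtain ⟨d, -, hd, hJ, hineq⟩ := ae_relEnergy_strong hD hS hT hΩ hb hne hp hμ hη hU hgU hP hP'
  obtain ⟨B, hB⟩ := exists_bound_integral_relMean hD hS hΩ hb hp hμ hη
  have hmem : ∀ᵐ τ ∂timeMeasure T, τ ∈ Ioo 0 T := ae_restrict_mem measurableSet_Ioo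
  have hslice := ae_integral_testIntegrand_le hD hS hΩ hb hp hd hμ hη i hR hJ hC hδ hrem
  set E : ℝ → ℝ := fun t => ∫ x in Ω, relMean p (ν (t, x)) (r t x) (U t x) with hE
  set C' := M + M ^ 2 + K
  have iE : Integrable E (timeMeasure T) :=
    integrable_integral_slice (integrable_relMean hD hS hΩ hb hp)
  have hE0 : ∀ᵐ t ∂timeMeasure T, 0 ≤ E t := by
    filter_upwards [ae_ae_of_ae_cylMeasure (ae_relMean_eq hD hS hΩ hp),
      ae_ae_of_ae_cylMeasure (ae_relEnergy_mean_nonneg hD hS hΩ hp)] with t h1 h2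
    refine integral_nonneg_of_ae ?_
    filter_upwards [h1, h2] with x g1 g2
    exact g2.trans_eq g1.symm
  have i1 : Integrable (fun t => ‖dtU t‖ ^ 2) (timeMeasure T) :=
    hS.dtU_memLp.integrable_norm_pow (by norm_num)
  have i4 : Integrable (fun t => C * (1 + ‖dtU t‖ ^ 2)) (timeMeasure T) :=
    ((integrable_const _).add i1).const_mul _
  -- The weight is only in L¹(0,T), so integrability of the product relies on E being bounded in
  -- time.
  have iE1 : Integrable (fun t => C * (1 + ‖dtU t‖ ^ 2) * E t) (timeMeasure T) :=
    integrable_mul_of_ae_bound i4 iE.1 hB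
  have ih := integrable_gronwallWeight hD hS C C'
  have ihE := integrable_mul_of_ae_bound ih iE.1 hB
  have iχ := hD.integrable_mul_defect hD.chi_integrable
  have iξ := hD.integrable_mul_defect hD.xi_integrable
  have iχξ : Integrable (fun t => (|χ t| + |ξ t|) * D t) (timeMeasure T) := by
    simp only [add_mul]
    exact iχ.add iξ
  have ihD : Integrable (fun t => gronwallWeight C C' dtU χ ξ t * D t) (timeMeasure T) := by
    have h1 := hD.integrable_mul_defect i4
    refine (h1.add (iχξ.const_mul (4 * C'))).congr (Eventually.of_forall fun t => ?_)
    simp only [Pi.add_apply, gronwallWeight]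
    rw [abs_of_nonneg (by positivity)]
    ring
  have ihF : Integrable (fun t => gronwallWeight C C' dtU χ ξ t * (E t + 1 / 2 * D t))
      (timeMeasure T) := by
    refine (ihE.add (ihD.const_mul (1 / 2))).congr (Eventually.of_forall fun t => ?_)
    simp only [Pi.add_apply]
    ring
  refine ⟨ihF, ?_⟩
  have iJ := integrable_integral_slice hJ
  have iS := integrable_integral_slice (integrable_dissipation hD)
  have iF := integrable_integral_slice hD.int_fluctuation.2
  have iG := integrable_integral_slice (integrable_velocity_gradient_sub hD hS hΩ hb)
  have hG0 : ∀ t, 0 ≤ ∫ x in Ω, contr (gradu (t, x) - gradU t x) (gradu (t, x) - gradU t x) :=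
    fun t => integral_nonneg fun x => contr_self_nonneg _
  have hslice' : ∀ᵐ t ∂timeMeasure T,
      ∫ x in Ω, testIntegrand p μ η (ν (t, x)) (gradu (t, x)) (r t x)
        (dtDensity r gradr U gradU t x) (gradr t x) (U t x) (extendZero d t x) (gradU t x)
      ≤ C * (1 + ‖dtU t‖ ^ 2) * E t
        + (∫ x in Ω, contr (stress μ η (gradu (t, x))) (gradu (t, x)))
        + 2 * δ * (∫ x in Ω, ∫ z, ‖z.2 - meanVelocity ν (t, x)‖ ^ 2 ∂ν (t, x))
        - μ / 2 * ∫ x in Ω, contr (gradu (t, x) - gradU t x) (gradu (t, x) - gradU t x) := by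
    filter_upwards [hslice] with t ht
    have := mul_le_mul_of_nonneg_right (by linarith : μ / 2 ≤ μ - 8 * δ * R ^ 2) (hG0 t)
    linarith
  -- Only ½D is available in the Grönwall quantity, hence the coefficient 4C' in the weight in place
  -- of 2C'. The mixed terms created by the product are nonnegative.
  have hweight : ∀ᵐ t ∂timeMeasure T, C * (1 + ‖dtU t‖ ^ 2) * E t
      + 2 * C' * ((|χ t| + |ξ t|) * D t)
      ≤ gronwallWeight C C' dtU χ ξ t * (E t + 1 / 2 * D t) := by
    filter_upwards [hE0, hD.defect_nonneg] with t h1 h2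
    have a1 : 0 ≤ C * (1 + ‖dtU t‖ ^ 2) * (1 / 2 * D t) := by positivity
    have a2 : 0 ≤ 4 * C' * (|χ t| + |ξ t|) * E t := by positivity
    simp only [gronwallWeight]
    linarith
  filter_upwards [hineq, hmem, hD.poincare, hD.defect_nonneg] with τ h1 hτ h2 h3
  have hτ' := Ioo_subset_Icc_self hτ
  have s1 := intervalIntegral_mono_timeMeasure hτ' iJ
    (((iE1.add iS).add (iF.const_mul (2 * δ))).sub (iG.const_mul (μ / 2))) hslice'
  have s2 := intervalIntegral_mono_timeMeasure hτ' (iE1.add (iχξ.const_mul (2 * C'))) ihF hweight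
  have hi : ∀ {f : ℝ → ℝ}, Integrable f (timeMeasure T) → IntervalIntegrable f volume 0 τ :=
    fun h => intervalIntegrable_of_timeMeasure hτ' h
  simp only [Pi.add_apply, Pi.sub_apply] at s1 s2
  rw [intervalIntegral.integral_sub
      (hi (by exact (iE1.add iS).add (iF.const_mul (2 * δ)))) (hi (iG.const_mul (μ / 2))),
    intervalIntegral.integral_add (hi (by exact iE1.add iS)) (hi (iF.const_mul (2 * δ))),
    intervalIntegral.integral_add (hi iE1) (hi iS), intervalIntegral.integral_const_mul,
    intervalIntegral.integral_const_mul] at s1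
  rw [intervalIntegral.integral_add (hi iE1) (hi (iχξ.const_mul (2 * C'))),
    intervalIntegral.integral_const_mul] at s2
  -- The Poincaré-type inequality for the fluctuations spends half of the defect on the left.
  have s3 : 2 * δ * (∫ t in (0 : ℝ)..τ, ∫ x in Ω, ∫ z, ‖z.2 - meanVelocity ν (t, x)‖ ^ 2 ∂ν (t, x))
      ≤ 1 / 2 * D τ := by
    calc _ ≤ 2 * δ * (cP * D τ) := by gcongr
      _ = 2 * δ * cP * D τ := by ring
      _ ≤ 1 / 2 * D τ := by gcongr
  simp only [cylInt] at h1 ⊢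
  linarith

/-- Stability of strong solutions in the class of dissipative measure-valued solutions. -/
theorem exists_stability_constant (hT : 0 < T) (hΩ : IsOpen Ω) (hb : Bornology.IsBounded Ω)
    (hne : Ω.Nonempty) (hp : IsPressure p) (hμ : 0 < μ) (hη : 0 ≤ η) (i : Fin N) (cP M : ℝ) :
    ∃ Λ : ℝ, ∀ (ν : ℝ × Vec N → Measure (ℝ × Vec N)) (ν₀ : Vec N → Measure (ℝ × Vec N))
        (D : ℝ → ℝ) (gradu : ℝ × Vec N → Mat N) (χ ξ : ℝ → ℝ)
        (r : ℝ → Vec N → ℝ) (gradr : ℝ → Vec N → (Vec N →L[ℝ] ℝ))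
        (U : ℝ → Vec N → Vec N) (gradU : ℝ → Vec N → Mat N) (dtU : ℝ → (closure Ω →ᵇ Vec N)),
        IsDissipativeMVSolution T Ω p μ η cP ν ν₀ D gradu χ ξ →
        IsStrongSolution T Ω p μ η r gradr U gradU dtU →
        NormsBoundedBy M T Ω r gradr U gradU dtU χ ξ →
        ∀ᵐ τ ∂timeMeasure T,
          (∫ x in Ω, ∫ z, relEnergy p (r τ x) (U τ x) z ∂ν (τ, x))
            + (∫ t in (0 : ℝ)..τ, ∫ x in Ω,
                contr (gradu (t, x) - gradU t x) (gradu (t, x) - gradU t x))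
            + D τ
          ≤ Λ * ∫ x in Ω, ∫ z, relEnergy p (r 0 x) (U 0 x) z ∂ν₀ x := by
  -- The bound is raised to at least 1, as the coercivity estimate requires; then r takes values in
  -- [1/m, m].
  obtain ⟨m, hMm, hm⟩ : ∃ m, M ≤ m ∧ 1 ≤ m := ⟨max M 1, le_max_left _ _, le_max_right _ _⟩
  have hm0 : 0 < m := by linarith
  obtain ⟨R, hR⟩ := hb.exists_norm_le
  have hI : Icc m⁻¹ m ⊆ Ioi 0 := fun r hr => (inv_pos.2 hm0).trans_le hr.1
  obtain ⟨K₁, hK₁⟩ := isCompact_Icc.exists_bound_of_continuousOn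
    (hp.continuousOn_deriv_potential.mono hI)
  obtain ⟨K₂, hK₂⟩ := isCompact_Icc.exists_bound_of_continuousOn
    (f := fun r => deriv p r / r) ((hp.continuousOn_deriv.mono hI).div continuousOn_id
      fun r hr => (hI hr).ne')
  set K := |K₁| + |K₂| * m with hK
  -- So small that the fluctuations cost at most half the defect and u - U at most half the viscous
  -- dissipation; it depends on `cP`, μ and the radius R of `Ω` only.
  obtain ⟨δ, hδ, hδP, hδR⟩ : ∃ δ : ℝ, 0 < δ ∧ 2 * δ * cP ≤ 1 / 2 ∧ 8 * δ * R ^ 2 ≤ μ / 2 := by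
    refine ⟨min (1 / (4 * (|cP| + 1))) (μ / (16 * (R ^ 2 + 1))), by positivity, ?_, ?_⟩
    · have h1 : min (1 / (4 * (|cP| + 1))) (μ / (16 * (R ^ 2 + 1))) * (4 * (|cP| + 1)) ≤ 1 := by
        rw [← le_div_iff₀ (by positivity)]; exact min_le_left _ _
      have h0 : 0 ≤ min (1 / (4 * (|cP| + 1))) (μ / (16 * (R ^ 2 + 1))) := by positivity
      have h2 := mul_le_mul_of_nonneg_left (le_abs_self cP) h0
      linarith
    · have h1 : min (1 / (4 * (|cP| + 1))) (μ / (16 * (R ^ 2 + 1))) * (16 * (R ^ 2 + 1)) ≤ μ := by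
        rw [← le_div_iff₀ (by positivity)]; exact min_le_right _ _
      have h0 : 0 ≤ min (1 / (4 * (|cP| + 1))) (μ / (16 * (R ^ 2 + 1))) := by positivity
      linarith
  obtain ⟨C, hC, hrem⟩ := hp.exists_remainder_le (N := N) hm hδ
  have hC' : 0 ≤ m + m ^ 2 + K := by positivity
  set L := C * (T + m ^ 2) + 4 * (m + m ^ 2 + K) * (m + m) with hL
  have hL0 : 0 ≤ L := by positivity
  -- Grönwall controls E + ½D + (μ/2)W, where W is the gradient term; the factor 2 + 2/μ restores
  -- coefficients of at least 1. Everything is fixed before the solutions are introduced.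
  refine ⟨(2 + 2 / μ) * (1 + L * Real.exp L), ?_⟩
  intro ν ν₀ D gradu χ ξ r gradr U gradU dtU hD hS hM
  have hM' := hM.mono hMm
  have hrI : ∀ t ∈ Icc 0 T, ∀ x ∈ closure Ω, r t x ∈ Icc m⁻¹ m := fun t ht x hx =>
    hM'.density_mem_Icc ht hx (hS.r_pos t ht x hx)
  obtain ⟨ihF, hF⟩ := ae_relEnergy_gronwall hD hS hT hΩ hb hne hp hμ.le hη i hR (M := m) (K := K)
    hM'.bound_U hM'.bound_gradU (fun t ht x hx => by
      have h1 := (hK₁ _ (hrI t ht x hx)).trans (le_abs_self _)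
      have h2 : 0 ≤ |K₂| * m := by positivity
      rw [Real.norm_eq_abs] at h1
      linarith) (fun t ht x hx => by
      have h1 := (hK₂ _ (hrI t ht x hx)).trans (le_abs_self _)
      have h2 : ‖(deriv p (r t x) / r t x) • gradr t x‖ ≤ |K₂| * m := by
        rw [norm_smul]
        exact mul_le_mul h1 (hM'.bound_gradr t ht x hx) (norm_nonneg _) (abs_nonneg _)
      linarith [abs_nonneg K₁]) hC hC' hδ.le hδP hδR
    (fun t ht x hx a z hz => hrem _ (hrI t ht x hx) _ _ a _ (hM'.bound_gradr t ht x hx)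
      (hM'.bound_U t ht x hx) (hM'.bound_gradU t ht x hx) z hz)
  have hmem : ∀ᵐ τ ∂timeMeasure T, τ ∈ Ioo 0 T := ae_restrict_mem measurableSet_Ioo
  have e0 := integral_congr_ae (ae_relMean_init_eq hD hS hT.le hΩ hp)
  have hE₀ := integral_relEnergy_init_nonneg hD hS hT.le hΩ hp
  have hW : ∀ᵐ τ ∂timeMeasure T, 0 ≤ μ / 2 * cylInt Ω τ (fun q =>
      contr (gradu q - gradU q.1 q.2) (gradu q - gradU q.1 q.2)) := by
    filter_upwards [hmem] with τ hτ
    refine mul_nonneg (by positivity) (intervalIntegral.integral_nonneg hτ.1.le fun t _ =>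
      integral_nonneg fun x => contr_self_nonneg _)
  have hG := gronwall_add (integrable_gronwallWeight hD hS C (m + m ^ 2 + K))
    (Eventually.of_forall fun t => by unfold gronwallWeight; positivity) ihF hW (e0 ▸ hE₀)
    (integral_gronwallWeight_le hD hS hT.le hm0.le hC hC' hM') hF
  rw [e0] at hG
  filter_upwards [hG, ae_ae_of_ae_cylMeasure (ae_relMean_eq hD hS hΩ hp), hW, hD.defect_nonneg,
    ae_ae_of_ae_cylMeasure (ae_relEnergy_mean_nonneg hD hS hΩ hp)]
    with τ h1 h2 h3 h4 h5
  rw [integral_congr_ae h2] at h1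
  have h6 : 0 ≤ ∫ x in Ω, ∫ z, relEnergy p (r τ x) (U τ x) z ∂ν (τ, x) :=
    integral_nonneg_of_ae h5
  change _ + cylInt Ω τ (fun q => contr (gradu q - gradU q.1 q.2) (gradu q - gradU q.1 q.2))
    + _ ≤ _
  set W := cylInt Ω τ (fun q => contr (gradu q - gradU q.1 q.2) (gradu q - gradU q.1 q.2))
  set Eτ := ∫ x in Ω, ∫ z, relEnergy p (r τ x) (U τ x) z ∂ν (τ, x)
  have hW0 : 0 ≤ W := by
    by_contra hneg
    have := mul_neg_of_pos_of_neg (half_pos hμ) (not_le.1 hneg)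
    linarith
  have e2 : (2 + 2 / μ) * (Eτ + 1 / 2 * D τ + μ / 2 * W)
      = 2 * Eτ + D τ + W + (2 / μ * (Eτ + 1 / 2 * D τ) + μ * W) := by
    field_simp
    ring
  have e3 : 0 ≤ 2 / μ * (Eτ + 1 / 2 * D τ) + μ * W := by positivity
  have e4 := mul_le_mul_of_nonneg_left h1 (by positivity : 0 ≤ 2 + 2 / μ)
  rw [e2] at e4
  linarith

end Stability

/-! ### Weak–strong uniqueness -/

/-- The coercivity bounds with vanishing right-hand side exclude small and large s and force (s -
r)² = 0 in between. -/
theorem IsPressure.eq_of_relPotential_eq_zero {p : ℝ → ℝ} (hp : IsPressure p) {r s : ℝ} (hr : 0 < r)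
    (hs : 0 ≤ s) (h : potential p s - deriv (potential p) r * (s - r) - potential p r = 0) :
    s = r := by
  set M := 1 + r + r⁻¹ with hM
  have hri : 0 < r⁻¹ := inv_pos.2 hr
  have hM1 : 1 ≤ M := by linarith
  have hmem : r ∈ Icc M⁻¹ M := ⟨inv_le_of_inv_le₀ hr (by linarith), by linarith⟩
  obtain ⟨C, -, hC⟩ := hp.coercive hM1
  obtain ⟨-, h2, h3, h4⟩ := hC r hmem s hs
  rw [h, mul_zero] at h2 h3 h4
  rcases le_total s (2 * M)⁻¹ with h' | h'
  · linarith [h2 h']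
  rcases le_total s (2 * M) with h'' | h''
  · have := pow_eq_zero_iff (two_ne_zero) |>.1 (le_antisymm (h3 h' h'') (sq_nonneg _))
    linarith
  · linarith [h4 h'']

/-- Both nonnegative summands vanish. The potential part gives s = r, and because r > 0 the kinetic
part then determines the velocity. -/
theorem IsPressure.eq_of_relEnergy_eq_zero {p : ℝ → ℝ} (hp : IsPressure p) {r : ℝ} (hr : 0 < r)
    {U : Vec N} {z : ℝ × Vec N} (hz : 0 ≤ z.1) (h : relEnergy p r U z = 0) : z = (r, U) := by
  have h1 := hp.relPotential_nonneg hr hz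
  have h2 : 0 ≤ 1 / 2 * z.1 * ‖z.2 - U‖ ^ 2 := by positivity
  unfold relEnergy at h
  have h3 := hp.eq_of_relPotential_eq_zero hr hz (by linarith)
  have h4 : 1 / 2 * z.1 * ‖z.2 - U‖ ^ 2 = 0 := by linarith
  rw [h3] at h4
  have h5 : ‖z.2 - U‖ ^ 2 = 0 := by
    rcases mul_eq_zero.1 h4 with h | h
    · linarith
    · exact h
  have h6 : z.2 = U := by
    rwa [sq_eq_zero_iff, norm_eq_zero, sub_eq_zero] at h5
  exact Prod.ext h3 h6

/-- The identity and the constant map agree almost everywhere, so they have the same push-forward.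
-/
theorem eq_dirac_of_ae_eq {α : Type*} [MeasurableSpace α] {m : Measure α} [IsProbabilityMeasure m]
    {c : α} (h : ∀ᵐ z ∂m, z = c) : m = Measure.dirac c := by
  have h1 : m.map id = m.map fun _ => c := Measure.map_congr h
  rwa [Measure.map_id, Measure.map_const, measure_univ, one_smul] at h1

section Uniqueness

variable {T : ℝ} {Ω : Set (Vec N)} {p : ℝ → ℝ} {μ η cP : ℝ}
  {ν : ℝ × Vec N → Measure (ℝ × Vec N)} {ν₀ : Vec N → Measure (ℝ × Vec N)} {D : ℝ → ℝ}
  {gradu : ℝ × Vec N → Mat N} {χ ξ : ℝ → ℝ} {r : ℝ → Vec N → ℝ}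
  {gradr : ℝ → Vec N → (Vec N →L[ℝ] ℝ)} {U : ℝ → Vec N → Vec N} {gradU : ℝ → Vec N → Mat N}
  {dtU : ℝ → (closure Ω →ᵇ Vec N)}

/-- Uniqueness presupposes no quantitative bounds; compactness of [0,T] × `closure Ω` and the
integrability assumptions supply some M. -/
theorem exists_normsBoundedBy (hD : IsDissipativeMVSolution T Ω p μ η cP ν ν₀ D gradu χ ξ)
    (hS : IsStrongSolution T Ω p μ η r gradr U gradU dtU) (hb : Bornology.IsBounded Ω) :
    ∃ M, NormsBoundedBy M T Ω r gradr U gradU dtU χ ξ := by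
  obtain ⟨C₁, h₁⟩ := exists_bound_cyl hb hS.cont_r
  obtain ⟨C₂, h₂⟩ := exists_bound_cyl hb hS.cont_gradr
  obtain ⟨C₃, h₃⟩ := exists_bound_cyl hb (g := fun t x => (r t x)⁻¹)
    (hS.cont_r.inv₀ fun q hq => (hS.r_pos q.1 hq.1 q.2 hq.2).ne')
  obtain ⟨C₄, h₄⟩ := exists_bound_cyl hb hS.cont_U
  obtain ⟨C₅, h₅⟩ := exists_bound_cyl hb hS.cont_gradU
  have b : ∀ {x : ENNReal} {M : ℝ}, x ≠ ⊤ → x.toReal ≤ M → x ≤ ENNReal.ofReal M :=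
    fun hx h => (ENNReal.ofReal_toReal hx).symm.le.trans (ENNReal.ofReal_le_ofReal h)
  have a₆ : 0 ≤ (eLpNorm dtU 2 (timeMeasure T)).toReal := ENNReal.toReal_nonneg
  have a₇ : 0 ≤ (eLpNorm χ 1 (timeMeasure T)).toReal := ENNReal.toReal_nonneg
  have a₈ : 0 ≤ (eLpNorm ξ 1 (timeMeasure T)).toReal := ENNReal.toReal_nonneg
  have a₁ := abs_nonneg C₁
  have a₂ := abs_nonneg C₂
  have a₃ := abs_nonneg C₃
  have a₄ := abs_nonneg C₄
  have a₅ := abs_nonneg C₅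
  refine ⟨|C₁| + |C₂| + |C₃| + |C₄| + |C₅| + (eLpNorm dtU 2 (timeMeasure T)).toReal
    + (eLpNorm χ 1 (timeMeasure T)).toReal + (eLpNorm ξ 1 (timeMeasure T)).toReal, ?_⟩
  exact
    { bound_r := fun t ht x hx => ((h₁ t ht x hx).trans (le_abs_self _)).trans (by linarith)
      bound_gradr := fun t ht x hx => ((h₂ t ht x hx).trans (le_abs_self _)).trans (by linarith)
      bound_inv_r := fun t ht x hx => ((h₃ t ht x hx).trans (le_abs_self _)).trans (by linarith)
      bound_U := fun t ht x hx => ((h₄ t ht x hx).trans (le_abs_self _)).trans (by linarith)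
      bound_gradU := fun t ht x hx => ((h₅ t ht x hx).trans (le_abs_self _)).trans (by linarith)
      bound_dtU := b hS.dtU_memLp.2.ne (by linarith)
      bound_chi := b (memLp_one_iff_integrable.2 hD.chi_integrable).2.ne (by linarith)
      bound_xi := b (memLp_one_iff_integrable.2 hD.xi_integrable).2.ne (by linarith) }

/-- Weak–strong uniqueness. -/
theorem weak_strong_uniqueness (hD : IsDissipativeMVSolution T Ω p μ η cP ν ν₀ D gradu χ ξ)
    (hS : IsStrongSolution T Ω p μ η r gradr U gradU dtU) (hT : 0 < T) (hΩ : IsOpen Ω)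
    (hb : Bornology.IsBounded Ω) (hne : Ω.Nonempty) (hp : IsPressure p) (hμ : 0 < μ) (hη : 0 ≤ η)
    (i : Fin N) (h0 : ∀ᵐ x ∂volume.restrict Ω, ν₀ x = Measure.dirac (r 0 x, U 0 x)) :
    (∀ᵐ τ ∂timeMeasure T, D τ = 0) ∧
      ∀ᵐ q ∂cylMeasure T Ω, ν q = Measure.dirac (r q.1 q.2, U q.1 q.2) := by
  obtain ⟨M, hM⟩ := exists_normsBoundedBy hD hS hb
  obtain ⟨Λ, hΛ⟩ := exists_stability_constant hT hΩ hb hne hp hμ hη i cP M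
  have hst := hΛ ν ν₀ D gradu χ ξ r gradr U gradU dtU hD hS hM
  have hinit : ∫ x in Ω, ∫ z, relEnergy p (r 0 x) (U 0 x) z ∂ν₀ x = 0 := by
    refine integral_eq_zero_of_ae ?_
    filter_upwards [h0] with x hx
    rw [hx, integral_dirac]
    simp [relEnergy]
  rw [hinit, mul_zero] at hst
  have hmem : ∀ᵐ τ ∂timeMeasure T, τ ∈ Ioo 0 T := ae_restrict_mem measurableSet_Ioo
  have hE0 := ae_relEnergy_mean_nonneg hD hS hΩ hp
  have hzero : ∀ᵐ τ ∂timeMeasure T, D τ = 0 ∧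
      ∫ x in Ω, ∫ z, relEnergy p (r τ x) (U τ x) z ∂ν (τ, x) = 0 := by
    filter_upwards [hst, hmem, hD.defect_nonneg, ae_ae_of_ae_cylMeasure hE0] with τ h1 hτ h2 h3
    have h4 : 0 ≤ ∫ x in Ω, ∫ z, relEnergy p (r τ x) (U τ x) z ∂ν (τ, x) :=
      integral_nonneg_of_ae h3
    have h5 : 0 ≤ ∫ t in (0 : ℝ)..τ, ∫ x in Ω,
        contr (gradu (t, x) - gradU t x) (gradu (t, x) - gradU t x) :=
      intervalIntegral.integral_nonneg hτ.1.le fun t _ =>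
        integral_nonneg fun x => contr_self_nonneg _
    constructor <;> linarith
  refine ⟨hzero.mono fun τ h => h.1, ?_⟩
  have hint : Integrable (fun q => ∫ z, relEnergy p (r q.1 q.2) (U q.1 q.2) z ∂ν q)
      (cylMeasure T Ω) :=
    (integrable_relMean hD hS hΩ hb hp).congr (ae_relMean_eq hD hS hΩ hp)
  -- By Fubini the mean relative energy has zero integral over the cylinder. Being nonnegative, it
  -- vanishes at almost every (t, x), and there the relative energy density vanishes ν-almost
  -- everywhere.
  have hcyl : ∫ q, ∫ z, relEnergy p (r q.1 q.2) (U q.1 q.2) z ∂ν q ∂cylMeasure T Ω = 0 := by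
    rw [cylMeasure_eq_prod] at hint ⊢
    rw [integral_prod _ hint]
    exact integral_eq_zero_of_ae (hzero.mono fun τ h => h.2)
  have hae := (integral_eq_zero_iff_of_nonneg_ae hE0 hint).1 hcyl
  filter_upwards [hae, hD.young.prob, hD.young.density_nonneg, hD.int_density.1,
    hD.int_momentum.1, hD.int_energy.1, ae_mem_cyl hΩ] with q h1 h2 h3 h4 h5 h6 hq
  have hr := hS.r_pos q.1 (Ioo_subset_Icc_self hq.1) q.2 (subset_closure hq.2)
  have hz : ∀ᵐ z ∂ν q, 0 ≤ z.1 := by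
    rw [ae_iff]; simpa using h3
  have hn : 0 ≤ᵐ[ν q] relEnergy p (r q.1 q.2) (U q.1 q.2) := by
    filter_upwards [hz] with z hz using relEnergy_nonneg hp hr _ hz
  have h7 := (integral_eq_zero_iff_of_nonneg_ae hn (integrable_relEnergy h4 h5 h6 _ _)).1 h1
  refine eq_dirac_of_ae_eq ?_
  filter_upwards [h7, hz] with z g1 g2 using hp.eq_of_relEnergy_eq_zero hr g2 g1

end Uniqueness

end NSMV

end

open NSMV in
theorem mainTheorem1 {N : ℕ} (hN : N = 2 ∨ N = 3) (Ω : Set (Vec N)) (hΩ : IsSmoothBoundedDomain Ω)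
    (p : ℝ → ℝ) (hp : IsPressure p) (μ η : ℝ) (hμ : 0 < μ) (hη : 0 ≤ η) (T : ℝ) (hT : 0 < T)
    (cP : ℝ) :
    (∀ M : ℝ, ∃ Λ : ℝ,
      ∀ (ν : ℝ × Vec N → Measure (ℝ × Vec N)) (ν₀ : Vec N → Measure (ℝ × Vec N)) (D : ℝ → ℝ)
        (gradu : ℝ × Vec N → Mat N) (χ ξ : ℝ → ℝ)
        (r : ℝ → Vec N → ℝ) (gradr : ℝ → Vec N → (Vec N →L[ℝ] ℝ))
        (U : ℝ → Vec N → Vec N) (gradU : ℝ → Vec N → Mat N) (dtU : ℝ → (closure Ω →ᵇ Vec N)),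
        IsDissipativeMVSolution T Ω p μ η cP ν ν₀ D gradu χ ξ →
        IsStrongSolution T Ω p μ η r gradr U gradU dtU →
        NormsBoundedBy M T Ω r gradr U gradU dtU χ ξ →
        ∀ᵐ τ ∂timeMeasure T,
          (∫ x in Ω, ∫ z, relEnergy p (r τ x) (U τ x) z ∂ν (τ, x))
            + (∫ t in (0 : ℝ)..τ, ∫ x in Ω,
                contr (gradu (t, x) - gradU t x) (gradu (t, x) - gradU t x))
            + D τ
          ≤ Λ * ∫ x in Ω, ∫ z, relEnergy p (r 0 x) (U 0 x) z ∂ν₀ x) ∧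
    (∀ (ν : ℝ × Vec N → Measure (ℝ × Vec N)) (ν₀ : Vec N → Measure (ℝ × Vec N)) (D : ℝ → ℝ)
        (gradu : ℝ × Vec N → Mat N) (χ ξ : ℝ → ℝ)
        (r : ℝ → Vec N → ℝ) (gradr : ℝ → Vec N → (Vec N →L[ℝ] ℝ))
        (U : ℝ → Vec N → Vec N) (gradU : ℝ → Vec N → Mat N) (dtU : ℝ → (closure Ω →ᵇ Vec N)),
        IsDissipativeMVSolution T Ω p μ η cP ν ν₀ D gradu χ ξ →
        IsStrongSolution T Ω p μ η r gradr U gradU dtU →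
        (∀ᵐ x ∂volume.restrict Ω, ν₀ x = Measure.dirac (r 0 x, U 0 x)) →
        (∀ᵐ τ ∂timeMeasure T, D τ = 0) ∧
        (∀ᵐ q ∂cylMeasure T Ω, ν q = Measure.dirac (r q.1 q.2, U q.1 q.2))) := by
  -- Poincaré's inequality integrates by parts in one coordinate direction, so one must exist.
  have i : Fin N := ⟨0, by omega⟩
  exact ⟨exists_stability_constant hT hΩ.isOpen hΩ.isBounded hΩ.isConnected.nonempty hp hμ hη i cP,
    fun ν ν₀ D gradu χ ξ r gradr U gradU dtU hD hS h0 =>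
      weak_strong_uniqueness hD hS hT hΩ.isOpen hΩ.isBounded hΩ.isConnected.nonempty hp hμ hη i h0⟩
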